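/- **Setting.** Let $\mathcal S,\mathcal A$ be finite, let $\mathsf P(\cdot|s,a)$ be a transition kernel, $\zeta$ an initial distribution on $\mathcal S$ and $\gamma\in(0,1)$. Let $\Theta_p=\{\theta\in\mathbb R^{\mathcal S\times\mathcal A}:\theta_{s,a}\ge 0,\ \sum_a\theta_{s,a}=1\ \forall s\}$ and $\pi_\theta(a|s)=\theta_{s,a}$ (direct parameterization); the expert policy $\pi_E$ is a stationary policy. For a policy $\pi$ and a reward $r$ let $V(\pi,r)=\mathbb E[\sum_{t\ge0}\gamma^t r(s_t,a_t)]$ with $s_0\sim\zeta$, $a_t\sim\pi(\cdot|s_t)$, $s_{t+1}\sim\mathsf P(\cdot|s_t,a_t)$. Rewards $r_\alpha(s,a)$ are parameterized by $\alpha$ in a nonempty closed bounded set $\Lambda\subset\mathbb R^q$, $\psi$ is a regularizer, and $$F(\theta,\alpha)=V(\pi_E,r_\alpha)-V(\pi_\theta,r_\alpha)-\psi(\alpha),\qquad g(\theta)=\max_{\alpha\in\Lambda}F(\theta,\alpha),\qquad \theta^*\in\operatorname{argmin}_{\theta\in\Theta_p}g(\theta).$$ Put $\tilde{\mathsf P}(\cdot|s,a)=\gamma\mathsf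 P(\cdot|s,a)+(1-\gamma)\zeta$. **Assumptions** (with constants $C_\alpha,C_r,L_r,L_\psi$ and $\mu>0$, $C_M\ge1$, $\rho\in(0,1)$, $\zeta_0>0$): (i) $\|\alpha_1-\alpha_2\|_2\le C_\alpha$ on $\Lambda$; (ii) $\psi$ is differentiable on $\Lambda$, with $L_\psi$-Lipschitz gradient there; (iii) for each $\theta\in\Theta_p$, $\Lambda$ is convex and $F(\theta,\cdot)$ is $\mu$-strongly concave on $\Lambda$; (iv) for one of the two kernels $\mathsf P$, $\tilde{\mathsf P}$ and every $\theta\in\Theta_p$, the state chain under $\pi_\theta$ has a stationary distribution $\chi_\theta$ with $\sup_s d_{TV}(\mathbb P(s_t\in\cdot|s_0=s),\chi_\theta)\le C_M\rho^t$ for all $t\ge0$; (v) $r_\alpha(s,a)$ is differentiable in $\alpha$ on $\Lambda$, with $\bigl(\sum_{i=1}^q\|\partial r_\alpha/\partial\alpha_i\|_\infty^2\bigr)^{1/2}\le C_r$, with $\|\nabla r_{\alpha_1}(s,a)-\nabla r_{\alpha_2}(s,a)\|_2\le L_r\|\alpha_1-\alpha_2\|_2$, and with $|r_\alpha(s,a)|\le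 C_rC_\alpha$; (vi) $\zeta(s)\ge\zeta_0$ for all $s$. **Algorithm (PPG-GAIL).** Start from any $\theta_0\in\Theta_p$ and any (random) initial states of two Markov chains with kernel $\tilde{\mathsf P}$: an expert's chain with actions from $\pi_E$, and a learner's chain with actions from the current $\pi_{\theta_t}$. Each is one trajectory for the whole execution. For $t=0,1,\dots,T-1$: pick $\alpha_0^t\in\Lambda$ by any rule (fixed or random with a discrete law, possibly depending on $t$, $\theta_t$ and the current states of the chains). For $k=0,\dots,K-1$, draw the next $B$ samples $(s_i^E,a_i^E)$, $(s_i^\theta,a_i^\theta)$ of both chains and put $$\alpha_{k+1}^t=P_\Lambda\Bigl(\alpha_k^t+\beta\Bigl[\tfrac1{(1-\gamma)B}\sum_{i=0}^{B-1}\bigl(\nabla r_{\alpha_k^t}(s_i^E,a_i^E)-\nabla r_{\alpha_k^t}(s_i^\theta,a_i^\theta)\bigr)-\nabla\psi(\alpha_k^t)\Bigr]\Bigr).$$ Let $\alpha_t=\alpha_K^t$. Draw the next $b$ samples $(s_i,a_i)$ of the learner's chain and, for every $i$ and $a$, a fresh independent estimate $\hat Q_i(s_i,a)=\sum_{j=0}^{N}\gamma^{j/2}r_{\alpha_t}(s'_j,a'_j)$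 of the $Q$-value, along a rollout with kernel $\mathsf P$ and policy $\pi_{\theta_t}$ from $(s'_0,a'_0)=(s_i,a)$, where $N$ is independent with $\mathbb P(N=n)=(1-\gamma^{1/2})\gamma^{n/2}$, $n\ge0$. Put $$\theta_{t+1}=P_{\Theta_p}\bigl(\theta_t-\eta\,\widehat\nabla_\theta F_t\bigr),\qquad \widehat\nabla_\theta F_t(s,a)=-\frac1{b(1-\gamma)}\sum_{i=0}^{b-1}\hat Q_i(s,a)\mathbf 1\{s_i=s\}.$$ $P_\Lambda$ and $P_{\Theta_p}$ are the Euclidean projections. The stepsizes are $\eta=\bigl(L_{11}+L_{12}L_{21}/\mu\bigr)^{-1}$ and $\beta=\mu/(4L_{22}^2)$, where, with $m=1+\lceil\log_\rho C_M^{-1}\rceil+(1-\rho)^{-1}$, $$L_{11}=\tfrac{2\sqrt2|\mathcal A|C_rC_\alpha}{(1-\gamma)^2}m,\quad L_{12}=\tfrac{\sqrt{|\mathcal A|}C_r}{(1-\gamma)^2},\quad L_{21}=\tfrac{C_r\sqrt{|\mathcal A|}}{1-\gamma}m,\quad L_{22}=\tfrac{2\sqrt q L_r}{1-\gamma}+L_\psi.$$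 **Theorem.** There are constants $C,c>0$ that depend only on $\mathcal S,\mathcal A,q,C_\alpha,C_r,L_r,L_\psi,\mu,C_M,\rho,\zeta_0$ (not on $\gamma$, $\mathsf P$, $\zeta$, $\pi_E$, $\Lambda$, $r$, $\psi$, nor on $T,K,B,b$, $\theta_0$, the initial states, the picks) such that for all $T,K,B,b\ge1$ $$\frac1T\sum_{t=0}^{T-1}\mathbb E[g(\theta_t)]-g(\theta^*)\le\frac{C}{(1-\gamma)^3\sqrt T}+\frac{C}{(1-\gamma)^2}e^{-c(1-\gamma)^2K}+\frac{C}{(1-\gamma)^3\sqrt B}+\frac{C}{(1-\gamma)^3\sqrt b}.$$ Consequently, for each $\gamma\in(0,1)$ there is $D>0$, depending only on $\gamma$ and the parameters listed above, such that for every $\varepsilon\in(0,1)$ there are $T,B,b\le D/\varepsilon^2$ and $K\le D(1+\log\frac1\varepsilon)$ (positive integers that depend on nothing else) for which the averaged optimality gap is at most $\varepsilon$ in every such problem, with total sample complexity $T(KB+b)\le D\,\varepsilon^{-4}(1+\log\frac1\varepsilon)=\tilde{\mathcal O}(\varepsilon^{-4})$. -/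

import Mathlib

noncomputable section

namespace GAIL

/-- The set `Θ_p` of directly parameterized policies: vectors `θ` indexed by state-action pairs,
with nonnegative entries that sum to one over the actions at every state. -/
def policySet (S A : Type*) [Fintype S] [Fintype A] : Set (EuclideanSpace ℝ (S × A)) :=
  {θ | (∀ s a, 0 ≤ θ (s, a)) ∧ ∀ s, ∑ a, θ (s, a) = 1}

/-- A stationary policy, given by its vector in `Θ_p`. -/
abbrev Policy (S A : Type*) [Fintype S] [Fintype A] : Type _ := ↥(policySet S A)

/-- `π_θ(· | s)`, the distribution of the action at state `s`. -/
def Policy.act {S A : Type*} [Fintype S] [Fintype A] (π : Policy S A) (s : S) : PMF A :=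
  PMF.ofFintype (fun a => ENNReal.ofReal (π.1 (s, a))) (by
    rw [← ENNReal.ofReal_sum_of_nonneg fun a _ => π.2.1 s a, π.2.2 s, ENNReal.ofReal_one])

/-- Expectation of a real function under a discrete distribution. -/
def expect {X : Type*} (p : PMF X) (f : X → ℝ) : ℝ := ∑' x, (p x).toReal * f x

/-- Total variation distance of two distributions on a finite set. -/
def tvDist {S : Type*} [Fintype S] (p p' : PMF S) : ℝ :=
  (1 / 2) * ∑ s, |(p s).toReal - (p' s).toReal|

/-- Euclidean projection onto a set `C` (for a closed convex `C` the nearest point exists and is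
unique, so that the choice is immaterial). -/
def proj {E : Type*} [Dist E] {C : Set E} (hC : Nonempty C) (x : E) : C :=
  @Classical.epsilon C hC fun y => ∀ z : C, dist x y ≤ dist x z

/-- The data of a GAIL problem: a finite MDP without reward (kernel `P`, initial distribution `ζ`,
discount factor `γ`), an expert policy `πE`, a set `Λ ⊆ ℝ^q` of reward parameters, the
parameterized reward `r α s a` and the regularizer `ψ`. -/
structure Model (S A : Type*) [Fintype S] [Fintype A] (q : ℕ) where
  P : S → A → PMF S
  ζ : PMF S
  γ : ℝ
  γ_pos : 0 < γ
  γ_lt_one : γ < 1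
  πE : Policy S A
  Λ : Set (EuclideanSpace ℝ (Fin q))
  r : EuclideanSpace ℝ (Fin q) → S → A → ℝ
  ψ : EuclideanSpace ℝ (Fin q) → ℝ

section

variable {S A : Type*} [Fintype S] [Fintype A] {q : ℕ} (M : Model S A q)

/-- The kernel `γ P(· | s, a) + (1 - γ) ζ`. -/
def Model.restart (s : S) (a : A) : PMF S :=
  PMF.ofFintype (fun s' => ENNReal.ofReal M.γ * M.P s a s' + ENNReal.ofReal (1 - M.γ) * M.ζ s') (by
    rw [Finset.sum_add_distrib, ← Finset.mul_sum, ← Finset.mul_sum, ← tsum_fintype (L := .unconditional S),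
      ← tsum_fintype (L := .unconditional S), PMF.tsum_coe, PMF.tsum_coe, mul_one, mul_one,
      ← ENNReal.ofReal_add M.γ_pos.le (sub_nonneg.2 M.γ_lt_one.le), add_sub_cancel,
      ENNReal.ofReal_one])

/-- Distribution of the state after `t` steps, for the initial distribution `p`, the transition
kernel `κ` and the policy `π`. -/
def stateLaw (κ : S → A → PMF S) (π : Policy S A) (p : PMF S) : ℕ → PMF S
  | 0 => p
  | t + 1 => (stateLaw κ π p t).bind fun s => (π.act s).bind fun a => κ s a

/-- The average value `V(π, ρ) = E[∑ γ^t ρ(s_t, a_t)]`, with `s_0 ∼ ζ`, for the reward `ρ`. -/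
def Model.V (π : Policy S A) (ρ : S → A → ℝ) : ℝ :=
  ∑' t : ℕ, M.γ ^ t *
    expect (stateLaw M.P π M.ζ t) fun s => expect (π.act s) fun a => ρ s a

/-- The objective `F(θ, α) = V(π_E, r_α) - V(π_θ, r_α) - ψ(α)`. -/
def Model.F (θ : Policy S A) (α : EuclideanSpace ℝ (Fin q)) : ℝ :=
  M.V M.πE (M.r α) - M.V θ (M.r α) - M.ψ α

/-- The marginal maximum `g(θ) = max_{α ∈ Λ} F(θ, α)`. -/
def Model.g (θ : Policy S A) : ℝ := sSup (M.F θ '' M.Λ)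

/-- The gradient in `α` of `r_α(s, a)`. -/
def Model.gradR (α : EuclideanSpace ℝ (Fin q)) (s : S) (a : A) : EuclideanSpace ℝ (Fin q) :=
  gradient (fun α' => M.r α' s a) α

/-- Uniform ergodicity, with constants `CM` and `ρ`, of the state chains that the transition
kernel `κ` has under the policies in `Θ_p`. -/
def UniformlyErgodic (κ : S → A → PMF S) (CM ρ : ℝ) : Prop :=
  ∀ π : Policy S A, ∃ χ : PMF S,
    (χ.bind fun s => (π.act s).bind fun a => κ s a) = χ ∧
    ∀ (t : ℕ) (s : S), tvDist (stateLaw κ π (PMF.pure s) t) χ ≤ CM * ρ ^ t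

/-- The standing assumptions, with their constants. -/
structure Model.Assumptions (Cα Cr Lr Lψ μ CM ρ ζ₀ : ℝ) : Prop where
  /-- `Λ` is non-empty, closed and bounded (its convexity is part of strong concavity below). -/
  Λ_nonempty : M.Λ.Nonempty
  Λ_closed : IsClosed M.Λ
  Λ_bounded : ∀ α₁ ∈ M.Λ, ∀ α₂ ∈ M.Λ, ‖α₁ - α₂‖ ≤ Cα
  /-- The regularizer has a Lipschitz gradient. -/
  ψ_diff : ∀ α ∈ M.Λ, DifferentiableAt ℝ M.ψ α
  ψ_lip : ∀ α₁ ∈ M.Λ, ∀ α₂ ∈ M.Λ, ‖gradient M.ψ α₁ - gradient M.ψ α₂‖ ≤ Lψ * ‖α₁ - α₂‖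
  /-- The objective is strongly concave in the reward parameter. -/
  F_concave : ∀ θ : Policy S A, StrongConcaveOn M.Λ μ (M.F θ)
  /-- Ergodicity. -/
  ergodic : UniformlyErgodic M.P CM ρ ∨ UniformlyErgodic M.restart CM ρ
  /-- The reward is differentiable in its parameter, with bounded and Lipschitz gradient. -/
  r_diff : ∀ α ∈ M.Λ, ∀ s a, DifferentiableAt ℝ (fun α' => M.r α' s a) α
  r_grad : ∀ α ∈ M.Λ, √(∑ i : Fin q, (⨆ x : S × A, |M.gradR α x.1 x.2 i|) ^ 2) ≤ Cr
  r_lip : ∀ s a, ∀ α₁ ∈ M.Λ, ∀ α₂ ∈ M.Λ,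
    ‖M.gradR α₁ s a - M.gradR α₂ s a‖ ≤ Lr * ‖α₁ - α₂‖
  /-- The reward is bounded, by a number that is at most `Cr * Cα`. -/
  r_bound : ∀ α ∈ M.Λ, ∀ s a, |M.r α s a| ≤ Cr * Cα
  /-- The initial distribution gives mass at least `ζ₀` to every state. -/
  ζ_min : ∀ s, ζ₀ ≤ (M.ζ s).toReal

/-! The Lipschitz constants and the stepsizes. -/

/-- `1 + ⌈log_ρ (CM⁻¹)⌉ + (1 - ρ)⁻¹`. -/
def mixConst (CM ρ : ℝ) : ℝ := 1 + (⌈Real.logb ρ CM⁻¹⌉ : ℝ) + (1 - ρ)⁻¹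

/-- `L₁₁`, where `nA` is the number of actions. -/
def L11 (nA : ℕ) (γ Cα Cr CM ρ : ℝ) : ℝ :=
  2 * √2 * nA * Cr * Cα / (1 - γ) ^ 2 * mixConst CM ρ

def L12 (nA : ℕ) (γ Cr : ℝ) : ℝ := √nA * Cr / (1 - γ) ^ 2

def L21 (nA : ℕ) (γ Cr CM ρ : ℝ) : ℝ := Cr * √nA / (1 - γ) * mixConst CM ρ

def L22 (q : ℕ) (γ Lr Lψ : ℝ) : ℝ := 2 * √q * Lr / (1 - γ) + Lψ

/-- The stepsize of the policy update. -/
def stepη (nA : ℕ) (γ Cα Cr μ CM ρ : ℝ) : ℝ :=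
  (L11 nA γ Cα Cr CM ρ + L12 nA γ Cr * L21 nA γ Cr CM ρ / μ)⁻¹

/-- The stepsize of the reward update. -/
def stepβ (q : ℕ) (γ Lr Lψ μ : ℝ) : ℝ := μ / (4 * L22 q γ Lr Lψ ^ 2)

/-! The algorithm. A chain is always passed on as the state at which its next action is due, so
that all samples of the learner (of the expert) lie on a single trajectory of the kernel
`γ P + (1 - γ) ζ`. -/

/-- `n` further steps of the chain with policy `π`, from the state `s`: the joint law of
`∑_i ∇_α r_α(s_i, a_i)` and of the next state. -/
def Model.rewardBatch (π : Policy S A) (α : EuclideanSpace ℝ (Fin q)) :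
    ℕ → S → PMF (EuclideanSpace ℝ (Fin q) × S)
  | 0, s => PMF.pure (0, s)
  | n + 1, s => (π.act s).bind fun a => (M.restart s a).bind fun s' =>
      (Model.rewardBatch π α n s').map fun x => (M.gradR α s a + x.1, x.2)

/-- One step of stochastic projected gradient ascent on the reward parameter, with batch size `B`
and stepsize `β`. The triple consists of the reward parameter, the current state of the expert's
chain and the current state of the learner's chain. -/
def Model.rewardStep (B : ℕ) (β : ℝ) (θ : Policy S A) (x : M.Λ × S × S) : PMF (M.Λ × S × S) :=
  (M.rewardBatch M.πE x.1 B x.2.1).bind fun e => (M.rewardBatch θ x.1 B x.2.2).map fun l =>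
    (proj ⟨x.1⟩ ((x.1 : EuclideanSpace ℝ (Fin q)) +
      β • ((1 / ((1 - M.γ) * B)) • (e.1 - l.1) - gradient M.ψ x.1)), e.2, l.2)

/-- `K` steps of the inner loop. -/
def Model.rewardLoop (B : ℕ) (β : ℝ) (θ : Policy S A) : ℕ → M.Λ × S × S → PMF (M.Λ × S × S)
  | 0, x => PMF.pure x
  | K + 1, x => (Model.rewardLoop B β θ K x).bind (M.rewardStep B β θ)

/-- The law of `∑_{t ≤ n} γ^{t/2} ρ(s_t, a_t)` along the chain with kernel `P` and policy `π`,
started from `(s_0, a_0) = (s, a)`. -/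
def Model.rollout (π : Policy S A) (ρ : S → A → ℝ) : ℕ → S → A → PMF ℝ
  | 0, s, a => PMF.pure (ρ s a)
  | n + 1, s, a => (M.P s a).bind fun s' => (π.act s').bind fun a' =>
      (Model.rollout π ρ n s' a').map fun v => ρ s a + √M.γ * v

/-- The geometric law `n ↦ (1 - γ^{1/2}) γ^{n/2}` on the natural numbers. -/
def Model.horizon : PMF ℕ :=
  ⟨fun n => ENNReal.ofReal ((1 - √M.γ) * √M.γ ^ n), by
    have h0 : 0 ≤ √M.γ := Real.sqrt_nonneg _
    have h1 : √M.γ < 1 := by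
      rw [Real.sqrt_lt' one_pos, one_pow]
      exact M.γ_lt_one
    have h := (hasSum_geometric_of_lt_one h0 h1).mul_left (1 - √M.γ)
    rw [mul_inv_cancel₀ (sub_pos.2 h1).ne'] at h
    have h' := ENNReal.ofReal_tsum_of_nonneg
      (fun n => mul_nonneg (sub_pos.2 h1).le (pow_nonneg h0 n)) h.summable
    rw [h.tsum_eq, ENNReal.ofReal_one] at h'
    rw [h']
    exact ENNReal.summable.hasSum⟩

/-- The estimator EstQ of the value `Q(s, a)` of policy `π` for the reward `ρ`: a rollout of random
geometric length. -/
def Model.estQ (π : Policy S A) (ρ : S → A → ℝ) (s : S) (a : A) : PMF ℝ :=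
  M.horizon.bind fun n => M.rollout π ρ n s a

open Classical in
/-- Independent calls of EstQ at `(s, a)`, one for each action `a` in a list. -/
def Model.estQList (π : Policy S A) (ρ : S → A → ℝ) (s : S) : List A → PMF (A → ℝ)
  | [] => PMF.pure 0
  | a :: l => (M.estQ π ρ s a).bind fun v =>
      (Model.estQList π ρ s l).map fun f => Function.update f a v

open Classical in
/-- The vector indexed by state-action pairs with entries `f a` in row `s` and zero elsewhere. -/
def rowVec (s : S) (f : A → ℝ) : EuclideanSpace ℝ (S × A) :=
  WithLp.toLp 2 fun x => if x.1 = s then f x.2 else 0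

/-- `n` further steps of the learner's chain from the state `s`: the joint law of the vector
`∑_i Q̂_i(s, a) 1{s_i = s}` (with fresh calls of EstQ for every `i`) and of the next state. -/
def Model.policyBatch (π : Policy S A) (ρ : S → A → ℝ) :
    ℕ → S → PMF (EuclideanSpace ℝ (S × A) × S)
  | 0, s => PMF.pure (0, s)
  | n + 1, s => (π.act s).bind fun a => (M.estQList π ρ s Finset.univ.toList).bind fun f =>
      (M.restart s a).bind fun s' =>
        (Model.policyBatch π ρ n s').map fun x => (rowVec s f + x.1, x.2)

/-- One step of projected policy gradient with batch size `b` and stepsize `η`, at the reward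
parameter `α`, with the learner's chain at the state `s`. -/
def Model.policyStep (b : ℕ) (η : ℝ) (θ : Policy S A) (α : EuclideanSpace ℝ (Fin q)) (s : S) :
    PMF (Policy S A × S) :=
  (M.policyBatch θ (M.r α) b s).map fun x =>
    (proj ⟨θ⟩ ((θ : EuclideanSpace ℝ (S × A)) -
      η • ((-(1 / (b * (1 - M.γ)))) • x.1)), x.2)

/-- The law of PPG-GAIL after `t` outer iterations: of the policy `θ_t`, the state of the expert's
chain and the state of the learner's chain. The algorithm starts from the policy `θ₀` and from
initial states of law `ι`; `pick t` is the rule that draws the initial reward parameter of the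
inner loop of iteration `t`, and may depend on the current position of the algorithm. -/
def Model.ppg (K B b : ℕ) (η β : ℝ) (θ₀ : Policy S A) (ι : PMF (S × S))
    (pick : ℕ → Policy S A × S × S → PMF M.Λ) : ℕ → PMF (Policy S A × S × S)
  | 0 => ι.map fun x => (θ₀, x)
  | t + 1 => (Model.ppg K B b η β θ₀ ι pick t).bind fun x => (pick t x).bind fun α₀ =>
      (M.rewardLoop B β x.1 K (α₀, x.2)).bind fun y =>
        (M.policyStep b η x.1 y.1 y.2.2).map fun z => (z.1, y.2.1, z.2)

/-- The averaged optimality gap `(1/T) ∑_{t<T} E[g(θ_t)] - g(θ*)` of PPG-GAIL. -/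
def Model.avgGap (T K B b : ℕ) (η β : ℝ) (θ₀ : Policy S A) (ι : PMF (S × S))
    (pick : ℕ → Policy S A × S × S → PMF M.Λ) (θs : Policy S A) : ℝ :=
  (1 / (T : ℝ)) * (∑ t ∈ Finset.range T,
    expect (M.ppg K B b η β θ₀ ι pick t) fun x => M.g x.1) - M.g θs

end

end GAIL

end

open GAIL

noncomputable section

namespace GAIL

open scoped ENNReal

/-! ### Expectations under discrete laws. -/

section Expectation

variable {X Y : Type*}

/-! Everything reduces to a one-step inequality that is affine in `g` and in squared errors, so that
it survives expectations and telescopes. Its ingredients are the following.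

Gradient dominance: with the reward frozen at the maximizer of `F(θ, ·)`, the gap of `g` is at most
a multiple of the first-order gain towards a greedy policy, because every state has discounted
occupation at least `ζ₀` (`Model.exists_V_sub_le`, `g_sub_le`). Descent: strong concavity pays for
the motion of the maximizer, so `g` has a quadratic upper model with constant `(1 - 1/m) / η`,
strictly below the inverse stepsize (`g_le`). A projected step with an inexact gradient then
satisfies `gap_le`, which has a free parameter `τ`.

The constants come from one fact: the resolvent `∑ γ^t P_π^t` expands oscillations at most by `κ =
2m - 3`, independently of `γ` (`Model.oscBound`). Rows of a difference of policies sum to zero and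
see only oscillations, so this replaces a power of `(1 - γ)⁻¹` by a multiple of `m`. The same
resolvent solves the Poisson equation of the restarted chain. Hence batch sums are martingales up to
a bounded boundary term, and batch means have squared error of order `1/n` from any initial state
(`Model.OscBound.lexp_batch_le`). The rollout estimator is unbiased since both its discount and the
tail of its horizon contribute `γ^{j/2}` (`Model.expect_estQ`).

The inner loop contracts squared errors by `1 - a`, with `a` proportional to `μ² / L22²`, up to
batch noise (`lexp_rewardLoop_le`). Summation over the outer loop (`avgGap_le`) and a balanced
choice of `τ` give the rate (`avgGap_le_rate`).

Second moments are bounded through `lexp` in the extended nonnegative reals, where sums may be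
interchanged without any summability check; `expect_le_of_lexp` leads back to real expectations of
bounded functions. -/

theorem toReal_nonneg (p : PMF X) (x : X) : 0 ≤ (p x).toReal := ENNReal.toReal_nonneg

theorem tsum_toReal (p : PMF X) : ∑' x, (p x).toReal = 1 := by
  rw [← ENNReal.tsum_toReal_eq (p.apply_ne_top), p.tsum_coe, ENNReal.toReal_one]

theorem summable_toReal (p : PMF X) : Summable fun x => (p x).toReal :=
  ENNReal.summable_toReal p.tsum_coe_ne_top

theorem summable_expect (p : PMF X) {f : X → ℝ} {C : ℝ} (hf : ∀ x ∈ p.support, |f x| ≤ C) :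
    Summable fun x => (p x).toReal * f x := by
  refine Summable.of_norm_bounded ((summable_toReal p).mul_right C) fun x => ?_
  rw [norm_mul, Real.norm_of_nonneg (toReal_nonneg p x)]
  by_cases hx : x ∈ p.support
  · exact mul_le_mul_of_nonneg_left (hf x hx) (toReal_nonneg p x)
  · rw [PMF.mem_support_iff, not_not] at hx
    simp [hx]

theorem expect_congr (p : PMF X) {f g : X → ℝ} (h : ∀ x ∈ p.support, f x = g x) :
    expect p f = expect p g := by
  refine tsum_congr fun x => ?_
  by_cases hx : x ∈ p.support
  · rw [h x hx]
  · rw [PMF.mem_support_iff, not_not] at hx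
    simp [hx]

theorem expect_mono (p : PMF X) {f g : X → ℝ} {C D : ℝ} (hf : ∀ x ∈ p.support, |f x| ≤ C)
    (hg : ∀ x ∈ p.support, |g x| ≤ D) (h : ∀ x ∈ p.support, f x ≤ g x) :
    expect p f ≤ expect p g := by
  refine (summable_expect p hf).tsum_le_tsum (fun x => ?_) (summable_expect p hg)
  by_cases hx : x ∈ p.support
  · exact mul_le_mul_of_nonneg_left (h x hx) (toReal_nonneg p x)
  · rw [PMF.mem_support_iff, not_not] at hx
    simp [hx]

theorem expect_const (p : PMF X) (c : ℝ) : expect p (fun _ => c) = c := by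
  rw [expect, tsum_mul_right, tsum_toReal, one_mul]

theorem expect_const_mul (p : PMF X) (c : ℝ) (f : X → ℝ) :
    expect p (fun x => c * f x) = c * expect p f := by
  rw [expect, expect, ← tsum_mul_left]
  exact tsum_congr fun x => by ring

theorem expect_add (p : PMF X) {f g : X → ℝ} {C D : ℝ} (hf : ∀ x ∈ p.support, |f x| ≤ C)
    (hg : ∀ x ∈ p.support, |g x| ≤ D) :
    expect p (fun x => f x + g x) = expect p f + expect p g := by
  rw [expect, expect, expect, ← (summable_expect p hf).tsum_add (summable_expect p hg)]
  exact tsum_congr fun x => by ring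

theorem expect_sub (p : PMF X) {f g : X → ℝ} {C D : ℝ} (hf : ∀ x ∈ p.support, |f x| ≤ C)
    (hg : ∀ x ∈ p.support, |g x| ≤ D) :
    expect p (fun x => f x - g x) = expect p f - expect p g := by
  rw [expect, expect, expect, ← (summable_expect p hf).tsum_sub (summable_expect p hg)]
  exact tsum_congr fun x => by ring

theorem expect_pure (x : X) (f : X → ℝ) : expect (PMF.pure x) f = f x := by
  rw [expect, tsum_eq_single x fun y hy => by simp [PMF.pure_apply, hy]]
  simp

theorem expect_le (p : PMF X) {f : X → ℝ} {C c : ℝ} (hf : ∀ x ∈ p.support, |f x| ≤ C)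
    (h : ∀ x ∈ p.support, f x ≤ c) : expect p f ≤ c := by
  rw [← expect_const p c]
  exact expect_mono p hf (D := |c|) (fun _ _ => le_rfl) h

theorem abs_expect_le (p : PMF X) {f : X → ℝ} {C : ℝ} (hf : ∀ x ∈ p.support, |f x| ≤ C) :
    |expect p f| ≤ C := by
  refine abs_le.2 ⟨?_, expect_le p hf fun x hx => (abs_le.1 (hf x hx)).2⟩
  rw [← expect_const p (-C)]
  exact expect_mono p (C := |(-C)|) (fun _ _ => le_rfl) hf fun x hx => (abs_le.1 (hf x hx)).1

theorem expect_nonneg (p : PMF X) {f : X → ℝ} (h : ∀ x, 0 ≤ f x) : 0 ≤ expect p f :=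
  tsum_nonneg fun x => mul_nonneg (toReal_nonneg p x) (h x)

/-- The expectation of the positive part of a function, as an extended nonnegative real. -/
def lexp (p : PMF X) (f : X → ℝ) : ℝ≥0∞ := ∑' x, p x * ENNReal.ofReal (f x)

theorem lexp_eq (p : PMF X) {f : X → ℝ} {C : ℝ} (hf : ∀ x ∈ p.support, |f x| ≤ C)
    (h : ∀ x ∈ p.support, 0 ≤ f x) : lexp p f = ENNReal.ofReal (expect p f) := by
  have h0 : ∀ x, 0 ≤ (p x).toReal * f x := fun x => by
    by_cases hx : x ∈ p.support
    · exact mul_nonneg (toReal_nonneg p x) (h x hx)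
    · rw [PMF.mem_support_iff, not_not] at hx
      simp [hx]
  rw [expect, ENNReal.ofReal_tsum_of_nonneg h0 (summable_expect p hf)]
  exact tsum_congr fun x => by
    rw [ENNReal.ofReal_mul (toReal_nonneg p x), ENNReal.ofReal_toReal (p.apply_ne_top x)]

theorem lexp_mono (p : PMF X) {f g : X → ℝ} (h : ∀ x ∈ p.support, f x ≤ g x) :
    lexp p f ≤ lexp p g := by
  refine ENNReal.tsum_le_tsum fun x => ?_
  by_cases hx : x ∈ p.support
  · gcongr
    exact h x hx
  · rw [PMF.mem_support_iff, not_not] at hx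
    simp [hx]

theorem lexp_const (p : PMF X) (c : ℝ) : lexp p (fun _ => c) = ENNReal.ofReal c := by
  rw [lexp, ENNReal.tsum_mul_right, p.tsum_coe, one_mul]

theorem lexp_pure (x : X) (f : X → ℝ) : lexp (PMF.pure x) f = ENNReal.ofReal (f x) := by
  rw [lexp, tsum_eq_single x fun y hy => by simp [PMF.pure_apply, hy]]
  simp

theorem lexp_const_mul (p : PMF X) {c : ℝ} (hc : 0 ≤ c) (f : X → ℝ) :
    lexp p (fun x => c * f x) = ENNReal.ofReal c * lexp p f := by
  rw [lexp, lexp, ← ENNReal.tsum_mul_left]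
  exact tsum_congr fun x => by rw [ENNReal.ofReal_mul hc]; ring

theorem lexp_add_le (p : PMF X) (f g : X → ℝ) :
    lexp p (fun x => f x + g x) ≤ lexp p f + lexp p g := by
  rw [lexp, lexp, lexp, ← ENNReal.tsum_add]
  refine ENNReal.tsum_le_tsum fun x => ?_
  rw [← mul_add]
  gcongr
  exact ENNReal.ofReal_add_le

theorem lexp_sum_le {ι : Type*} (p : PMF X) (s : Finset ι) (f : ι → X → ℝ) :
    lexp p (fun x => ∑ i ∈ s, f i x) ≤ ∑ i ∈ s, lexp p (f i) := by
  classical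
  induction s using Finset.induction_on with
  | empty => simp [lexp_const]
  | insert i s hi ih =>
    simp only [Finset.sum_insert hi]
    exact (lexp_add_le p _ _).trans (by gcongr)

theorem lexp_bind (p : PMF Y) (k : Y → PMF X) (f : X → ℝ) :
    lexp (p.bind k) f = ∑' y, p y * lexp (k y) f := by
  simp only [lexp, PMF.bind_apply, ← ENNReal.tsum_mul_right, ← ENNReal.tsum_mul_left]
  rw [ENNReal.tsum_comm]
  exact tsum_congr fun y => tsum_congr fun x => by ring

theorem lexp_bind_le (p : PMF Y) (k : Y → PMF X) {f : X → ℝ} {c : Y → ℝ}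
    (h : ∀ y ∈ p.support, lexp (k y) f ≤ ENNReal.ofReal (c y)) :
    lexp (p.bind k) f ≤ lexp p c := by
  rw [lexp_bind]
  refine ENNReal.tsum_le_tsum fun y => ?_
  by_cases hy : y ∈ p.support
  · gcongr
    exact h y hy
  · rw [PMF.mem_support_iff, not_not] at hy
    simp [hy]

theorem lexp_map (p : PMF Y) (k : Y → X) (f : X → ℝ) :
    lexp (p.map k) f = lexp p fun y => f (k y) := by
  rw [PMF.map, lexp_bind]
  simp only [Function.comp, lexp_pure]
  rfl

/-- Tonelli for extended nonnegative sums; boundedness makes both sides finite, so the identity can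
be read in the reals. -/
theorem expect_bind_of_nonneg (p : PMF Y) (k : Y → PMF X) {f : X → ℝ} {C : ℝ}
    (hf : ∀ x, |f x| ≤ C) (h : ∀ x, 0 ≤ f x) :
    expect (p.bind k) f = expect p fun y => expect (k y) f := by
  have h1 := lexp_bind p k f
  rw [lexp_eq _ (fun x _ => hf x) (fun x _ => h x)] at h1
  have h2 : ∑' y, p y * lexp (k y) f = lexp p fun y => expect (k y) f := by
    refine tsum_congr fun y => ?_
    rw [lexp_eq _ (fun x _ => hf x) (fun x _ => h x)]
  rw [h2, lexp_eq _ (fun y _ => abs_expect_le _ fun x _ => hf x)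
    (fun y _ => expect_nonneg _ h)] at h1
  exact (ENNReal.ofReal_eq_ofReal_iff (expect_nonneg _ h)
    (expect_nonneg _ fun y => expect_nonneg _ h)).1 h1

theorem expect_bind_of_bounded (p : PMF Y) (k : Y → PMF X) {f : X → ℝ} {C : ℝ}
    (hf : ∀ x, |f x| ≤ C) : expect (p.bind k) f = expect p fun y => expect (k y) f := by
  have hC : ∀ x : X, |C| ≤ |C| := fun _ => le_rfl
  have hfC : ∀ x, |f x + C| ≤ C + C := fun x => by
    have := abs_le.1 (hf x)
    exact abs_le.2 ⟨by linarith, by linarith⟩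
  have h := expect_bind_of_nonneg p k hfC fun x => by linarith [(abs_le.1 (hf x)).1]
  rw [expect_add _ (fun x _ => hf x) (fun x _ => hC x), expect_const] at h
  have h2 : ∀ y, expect (k y) (fun x => f x + C) = expect (k y) f + C := fun y => by
    rw [expect_add _ (fun x _ => hf x) (fun x _ => hC x), expect_const]
  simp only [h2] at h
  rw [expect_add _ (fun y _ => abs_expect_le _ fun x _ => hf x) (fun _ _ => le_refl |C|),
    expect_const] at h
  linarith

theorem expect_bind (p : PMF Y) (k : Y → PMF X) {f : X → ℝ} {C : ℝ} (hC : 0 ≤ C)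
    (hf : ∀ y ∈ p.support, ∀ x ∈ (k y).support, |f x| ≤ C) :
    expect (p.bind k) f = expect p fun y => expect (k y) f := by
  classical
  -- Truncation to zero off the support of the mixture changes no expectation and turns a bound on
  -- supports into a global one.
  have h := expect_bind_of_bounded p k (f := fun x => if x ∈ (p.bind k).support then f x else 0)
    (C := C) fun x => by
      split_ifs with hx
      · obtain ⟨y, hy, hxy⟩ := (PMF.mem_support_bind_iff _ _ _).1 hx
        exact hf y hy x hxy
      · simpa using hC
  rw [expect_congr (p.bind k) (g := f) fun x hx => by simp only [hx, if_true]] at h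
  rw [h]
  refine expect_congr p fun y hy => expect_congr _ fun x hx => ?_
  rw [if_pos ((PMF.mem_support_bind_iff _ _ _).2 ⟨y, hy, hx⟩)]

theorem expect_map_of_bounded (p : PMF Y) (k : Y → X) {f : X → ℝ} {C : ℝ}
    (hf : ∀ x, |f x| ≤ C) : expect (p.map k) f = expect p fun y => f (k y) := by
  rw [PMF.map, expect_bind_of_bounded _ _ hf]
  simp only [Function.comp, expect_pure]

theorem expect_map (p : PMF Y) (k : Y → X) {f : X → ℝ} {C : ℝ} (hC : 0 ≤ C)
    (hf : ∀ y ∈ p.support, |f (k y)| ≤ C) :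
    expect (p.map k) f = expect p fun y => f (k y) := by
  rw [PMF.map, expect_bind _ _ hC]
  · simp only [Function.comp, expect_pure]
  · intro y hy x hx
    simp only [Function.comp, PMF.mem_support_pure_iff] at hx
    exact hx ▸ hf y hy

theorem expect_fintype [Fintype X] (p : PMF X) (f : X → ℝ) :
    expect p f = ∑ x, (p x).toReal * f x := tsum_fintype _

theorem sum_toReal [Fintype X] (p : PMF X) : ∑ x, (p x).toReal = 1 := by
  rw [← tsum_toReal p, tsum_fintype]

/-- An upper bound for an expectation from an upper bound by a function with finite `lexp`. -/
theorem expect_le_of_lexp (p : PMF X) {f h : X → ℝ} {a b c C : ℝ} (hf : ∀ x, |f x| ≤ C)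
    (hb : 0 ≤ b) (hc : 0 ≤ c) (h0 : ∀ x, 0 ≤ h x) (hfh : ∀ x ∈ p.support, f x ≤ a + b * h x)
    (hh : lexp p h ≤ ENNReal.ofReal c) : expect p f ≤ a + b * c := by
  -- The positive part of `f - a` mediates: it is bounded and nonnegative, so its `lexp` is a real
  -- expectation, while `h` itself need not be bounded.
  have hbd : ∀ x ∈ p.support, |max (f x - a) 0| ≤ C + |a| := fun x _ => by
    have h1 := abs_le.1 (hf x)
    have h2 := neg_abs_le a
    have h3 := le_abs_self a
    rw [abs_of_nonneg (le_max_right _ _)]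
    exact max_le (by linarith) (by linarith [abs_nonneg a])
  have h1 : lexp p (fun x => max (f x - a) 0) ≤ ENNReal.ofReal (b * c) := by
    calc lexp p (fun x => max (f x - a) 0) ≤ lexp p (fun x => b * h x) :=
          lexp_mono _ fun x hx => max_le (by linarith [hfh x hx]) (mul_nonneg hb (h0 x))
      _ ≤ _ := by
          rw [lexp_const_mul _ hb, ENNReal.ofReal_mul hb]
          gcongr
  rw [lexp_eq p hbd fun x _ => le_max_right _ _,
    ENNReal.ofReal_le_ofReal_iff (mul_nonneg hb hc)] at h1
  have h2 : expect p (fun x => a + max (f x - a) 0) = a + expect p fun x => max (f x - a) 0 := by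
    rw [expect_add p (fun _ _ => le_refl |a|) hbd, expect_const]
  have h3 : expect p f ≤ expect p (fun x => a + max (f x - a) 0) :=
    expect_mono p (fun x _ => hf x) (D := |a| + (C + |a|))
      (fun x hx => (abs_add_le _ _).trans (by gcongr; exact hbd x hx))
      fun x _ => by linarith [le_max_left (f x - a) 0]
  linarith

end Expectation

/-! ### Value functions and the discounted resolvent. -/

section MDP

theorem exists_center {X : Type*} [Finite X] [Nonempty X] (f : X → ℝ) {D : ℝ}
    (hD : ∀ x y, f x - f y ≤ D) : ∃ c, ∀ x, |f x - c| ≤ D / 2 := by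
  obtain ⟨x₁, h₁⟩ := Finite.exists_max f
  obtain ⟨x₀, h₀⟩ := Finite.exists_min f
  refine ⟨(f x₁ + f x₀) / 2, fun x => abs_le.2 ⟨?_, ?_⟩⟩ <;>
  linarith [h₁ x, h₀ x, hD x₁ x₀]

/-- Zero total mass allows `f` to be recentred at its midrange, where it is bounded by half its
oscillation. That half matches the factor in `tvDist`. -/
theorem abs_sum_mul_le_osc {X : Type*} [Fintype X] (ν f : X → ℝ) {D : ℝ} (hν : ∑ x, ν x = 0)
    (hD : ∀ x y, f x - f y ≤ D) : |∑ x, ν x * f x| ≤ (∑ x, |ν x|) * (D / 2) := by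
  rcases isEmpty_or_nonempty X with h | h
  · simp
  obtain ⟨c, hc⟩ := exists_center f hD
  have : ∑ x, ν x * f x = ∑ x, ν x * (f x - c) := by
    simp only [mul_sub, Finset.sum_sub_distrib, ← Finset.sum_mul, hν, zero_mul, sub_zero]
  rw [this, Finset.sum_mul]
  refine (Finset.abs_sum_le_sum_abs _ _).trans (Finset.sum_le_sum fun x _ => ?_)
  rw [abs_mul]
  exact mul_le_mul_of_nonneg_left (hc x) (abs_nonneg _)

variable {S A : Type*} [Fintype S] [Fintype A] {q : ℕ}

theorem act_toReal (π : Policy S A) (s : S) (a : A) : (π.act s a).toReal = π.1 (s, a) := by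
  simp [Policy.act, ENNReal.toReal_ofReal (π.2.1 s a)]

theorem expect_act (π : Policy S A) (s : S) (f : A → ℝ) :
    expect (π.act s) f = ∑ a, π.1 (s, a) * f a := by
  simp only [expect_fintype, act_toReal]

theorem finite_bdd {X : Type*} [Finite X] (f : X → ℝ) : ∃ C, 0 ≤ C ∧ ∀ x, |f x| ≤ C := by
  have := Fintype.ofFinite X
  exact ⟨∑ x, |f x|, Finset.sum_nonneg fun _ _ => abs_nonneg _,
    fun x => Finset.single_le_sum (f := fun x => |f x|) (fun _ _ => abs_nonneg _)
      (Finset.mem_univ x)⟩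

/-- The transition operator of the state chain, acting on functions. -/
def stepOp (κ : S → A → PMF S) (π : Policy S A) : (S → ℝ) →ₗ[ℝ] (S → ℝ) where
  toFun f s := ∑ a, π.1 (s, a) * ∑ s', (κ s a s').toReal * f s'
  map_add' f g := by
    funext s
    simp only [Pi.add_apply, mul_add, Finset.sum_add_distrib]
  map_smul' c f := by
    funext s
    simp only [Pi.smul_apply, smul_eq_mul, RingHom.id_apply, Finset.mul_sum]
    exact Finset.sum_congr rfl fun a _ => Finset.sum_congr rfl fun s' _ => by ring

theorem stepOp_apply (κ : S → A → PMF S) (π : Policy S A) (f : S → ℝ) (s : S) :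
    stepOp κ π f s = ∑ a, π.1 (s, a) * ∑ s', (κ s a s').toReal * f s' := rfl

theorem stepOp_mono (κ : S → A → PMF S) (π : Policy S A) {f g : S → ℝ} (h : ∀ s, f s ≤ g s)
    (s : S) : stepOp κ π f s ≤ stepOp κ π g s := by
  simp only [stepOp_apply]
  gcongr with a _ s' _
  · exact π.2.1 s a
  · exact h s'

theorem stepOp_const (κ : S → A → PMF S) (π : Policy S A) (c : ℝ) (s : S) :
    stepOp κ π (fun _ => c) s = c := by
  simp only [stepOp_apply, ← Finset.sum_mul, sum_toReal, one_mul, π.2.2 s]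

theorem expect_step (κ : S → A → PMF S) (π : Policy S A) (f : S → ℝ) (s : S) :
    expect ((π.act s).bind fun a => κ s a) f = stepOp κ π f s := by
  obtain ⟨C, _, hC⟩ := finite_bdd f
  rw [expect_bind_of_bounded _ _ hC, expect_act, stepOp_apply]
  simp only [expect_fintype]

theorem expect_stateLaw (κ : S → A → PMF S) (π : Policy S A) (p : PMF S) (t : ℕ) (f : S → ℝ) :
    expect (stateLaw κ π p t) f = expect p ((stepOp κ π ^ t) f) := by
  induction t generalizing f with
  | zero => simp [stateLaw]
  | succ t ih =>
    obtain ⟨C, _, hC⟩ := finite_bdd f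
    rw [stateLaw, expect_bind_of_bounded _ _ hC]
    simp only [expect_step]
    rw [ih, pow_succ]
    rfl

theorem stepOp_pow_mono (κ : S → A → PMF S) (π : Policy S A) (t : ℕ) {f g : S → ℝ}
    (h : ∀ s, f s ≤ g s) (s : S) : (stepOp κ π ^ t) f s ≤ (stepOp κ π ^ t) g s := by
  induction t generalizing f g with
  | zero => simpa using h s
  | succ t ih =>
    rw [pow_succ]
    exact ih (stepOp_mono κ π h)

theorem stepOp_pow_const (κ : S → A → PMF S) (π : Policy S A) (t : ℕ) (c : ℝ) (s : S) :
    (stepOp κ π ^ t) (fun _ => c) s = c := by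
  induction t with
  | zero => simp
  | succ t ih =>
    rw [pow_succ, Module.End.mul_apply]
    have : stepOp κ π (fun _ => c) = fun _ => c := funext (stepOp_const κ π c)
    rw [this, ih]

theorem abs_stepOp_pow_le (κ : S → A → PMF S) (π : Policy S A) (t : ℕ) {f : S → ℝ} {C : ℝ}
    (h : ∀ s, |f s| ≤ C) (s : S) : |(stepOp κ π ^ t) f s| ≤ C := by
  refine abs_le.2 ⟨?_, ?_⟩
  · rw [← stepOp_pow_const κ π t (-C) s]
    exact stepOp_pow_mono κ π t (fun s => (abs_le.1 (h s)).1) s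
  · rw [← stepOp_pow_const κ π t C s]
    exact stepOp_pow_mono κ π t (fun s => (abs_le.1 (h s)).2) s

variable (M : Model S A q)

theorem Model.one_sub_pos : 0 < 1 - M.γ := sub_pos.2 M.γ_lt_one

theorem Model.summable_res (π : Policy S A) (f : S → ℝ) (s : S) :
    Summable fun t : ℕ => M.γ ^ t * (stepOp M.P π ^ t) f s := by
  obtain ⟨C, _, hC⟩ := finite_bdd f
  refine Summable.of_norm_bounded
    ((summable_geometric_of_lt_one M.γ_pos.le M.γ_lt_one).mul_right C) fun t => ?_
  rw [norm_mul, Real.norm_of_nonneg (pow_nonneg M.γ_pos.le t)]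
  exact mul_le_mul_of_nonneg_left (abs_stepOp_pow_le _ _ _ hC s) (pow_nonneg M.γ_pos.le t)

/-- The discounted resolvent `∑_t γ^t P_π^t` of the state chain. -/
def Model.res (π : Policy S A) : (S → ℝ) →ₗ[ℝ] (S → ℝ) where
  toFun f s := ∑' t : ℕ, M.γ ^ t * (stepOp M.P π ^ t) f s
  map_add' f g := by
    funext s
    rw [Pi.add_apply, ← (M.summable_res π f s).tsum_add (M.summable_res π g s)]
    exact tsum_congr fun t => by rw [map_add, Pi.add_apply, mul_add]
  map_smul' c f := by
    funext s
    rw [RingHom.id_apply, Pi.smul_apply, smul_eq_mul, ← tsum_mul_left]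
    exact tsum_congr fun t => by rw [map_smul, Pi.smul_apply, smul_eq_mul]; ring

theorem Model.res_apply (π : Policy S A) (f : S → ℝ) (s : S) :
    M.res π f s = ∑' t : ℕ, M.γ ^ t * (stepOp M.P π ^ t) f s := rfl

theorem Model.le_res (π : Policy S A) {f : S → ℝ} (hf : ∀ s, 0 ≤ f s) (s : S) :
    f s ≤ M.res π f s := by
  have h0 : ∀ t, 0 ≤ M.γ ^ t * (stepOp M.P π ^ t) f s := fun t => by
    refine mul_nonneg (pow_nonneg M.γ_pos.le t) ?_
    rw [← stepOp_pow_const M.P π t 0 s]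
    exact stepOp_pow_mono _ _ _ hf s
  rw [M.res_apply]
  simpa using (M.summable_res π f s).le_tsum 0 fun t _ => h0 t

theorem Model.res_mono (π : Policy S A) {f g : S → ℝ} (h : ∀ s, f s ≤ g s) (s : S) :
    M.res π f s ≤ M.res π g s := by
  have := M.le_res π (f := g - f) (fun s => sub_nonneg.2 (h s)) s
  rw [map_sub, Pi.sub_apply, Pi.sub_apply] at this
  linarith [h s]

theorem Model.res_const (π : Policy S A) (c : ℝ) (s : S) :
    M.res π (fun _ => c) s = c / (1 - M.γ) := by
  rw [M.res_apply]
  simp only [stepOp_pow_const]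
  rw [tsum_mul_right, tsum_geometric_of_lt_one M.γ_pos.le M.γ_lt_one]
  field_simp

theorem Model.abs_res_le (π : Policy S A) {f : S → ℝ} {C : ℝ} (h : ∀ s, |f s| ≤ C) (s : S) :
    |M.res π f s| ≤ C / (1 - M.γ) := by
  refine abs_le.2 ⟨?_, ?_⟩
  · rw [← neg_div, ← M.res_const π (-C) s]
    exact M.res_mono π (fun s => (abs_le.1 (h s)).1) s
  · rw [← M.res_const π C s]
    exact M.res_mono π (fun s => (abs_le.1 (h s)).2) s

theorem Model.res_bellman (π : Policy S A) (f : S → ℝ) :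
    M.res π f = f + M.γ • M.res π (stepOp M.P π f) := by
  funext s
  rw [M.res_apply, (M.summable_res π f s).tsum_eq_zero_add]
  simp only [pow_zero, Module.End.one_apply, one_mul, Pi.add_apply, Pi.smul_apply, smul_eq_mul,
    M.res_apply, ← tsum_mul_left, add_right_inj]
  exact tsum_congr fun t => by rw [pow_succ, pow_succ, Module.End.mul_apply]; ring

theorem Model.stepOp_res (π : Policy S A) (f : S → ℝ) :
    stepOp M.P π (M.res π f) = M.res π (stepOp M.P π f) := by
  funext s
  rw [stepOp_apply]
  have h : ∀ a, HasSum (fun t : ℕ => ∑ s', (M.P s a s').toReal *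
      (M.γ ^ t * (stepOp M.P π ^ t) f s')) (∑ s', (M.P s a s').toReal * M.res π f s') :=
    fun a => hasSum_sum fun s' _ => (M.summable_res π f s').hasSum.mul_left _
  have h2 := hasSum_sum fun a (_ : a ∈ Finset.univ) => (h a).mul_left (π.1 (s, a))
  rw [← h2.tsum_eq, M.res_apply]
  refine tsum_congr fun t => ?_
  rw [← Module.End.mul_apply, ← pow_succ, pow_succ', Module.End.mul_apply, stepOp_apply]
  simp only [Finset.mul_sum]
  exact Finset.sum_congr rfl fun a _ => Finset.sum_congr rfl fun s' _ => by ring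

/-- The resolvent equation. -/
theorem Model.res_eq (π : Policy S A) (f : S → ℝ) (s : S) :
    M.res π f s = f s + M.γ * stepOp M.P π (M.res π f) s := by
  conv_lhs => rw [M.res_bellman π f, ← M.stepOp_res]
  rfl

/-- Uniqueness for the Bellman equation: the resolvent applied to `u - γ P_π u` telescopes to `u`.
Identities between value functions are proved below by verifying this fixed-point equation. -/
theorem Model.eq_res (π : Policy S A) {f u : S → ℝ}
    (h : ∀ s, u s = f s + M.γ * stepOp M.P π u s) : u = M.res π f := by
  have h1 : f = u - M.γ • stepOp M.P π u := by
    funext s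
    simp [h s]
  have h2 := M.res_bellman π u
  rw [h1, map_sub, map_smul]
  nth_rewrite 1 [h2]
  simp

/-- The average of a reward over the actions of a policy. -/
def avg (π : Policy S A) (ρ : S → A → ℝ) (s : S) : ℝ := ∑ a, π.1 (s, a) * ρ s a

theorem abs_avg_le (π : Policy S A) {ρ : S → A → ℝ} {C : ℝ} (h : ∀ s a, |ρ s a| ≤ C) (s : S) :
    |avg π ρ s| ≤ C := by
  rw [avg, ← expect_act]
  exact abs_expect_le _ fun a _ => h s a

/-- The mean of a function under the initial distribution. -/
def Model.init : (S → ℝ) →ₗ[ℝ] ℝ where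
  toFun f := ∑ s, (M.ζ s).toReal * f s
  map_add' f g := by simp [mul_add, Finset.sum_add_distrib]
  map_smul' c f := by
    simp only [Pi.smul_apply, smul_eq_mul, RingHom.id_apply, Finset.mul_sum]
    exact Finset.sum_congr rfl fun _ _ => by ring

theorem Model.init_apply (f : S → ℝ) : M.init f = ∑ s, (M.ζ s).toReal * f s := rfl

theorem Model.init_const (c : ℝ) : M.init (fun _ => c) = c := by
  rw [M.init_apply, ← Finset.sum_mul, sum_toReal, one_mul]

theorem Model.init_mono {f g : S → ℝ} (h : ∀ s, f s ≤ g s) : M.init f ≤ M.init g := by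
  simp only [M.init_apply]
  gcongr with s _
  exact h s

theorem Model.abs_init_le {f : S → ℝ} {C : ℝ} (h : ∀ s, |f s| ≤ C) : |M.init f| ≤ C := by
  rw [M.init_apply, ← expect_fintype]
  exact abs_expect_le _ fun s _ => h s

theorem Model.V_eq (π : Policy S A) (ρ : S → A → ℝ) :
    M.V π ρ = M.init (M.res π (avg π ρ)) := by
  have h : HasSum (fun t : ℕ => ∑ s, (M.ζ s).toReal * (M.γ ^ t * (stepOp M.P π ^ t) (avg π ρ) s))
      (M.init (M.res π (avg π ρ))) :=
    hasSum_sum fun s _ => (M.summable_res π _ s).hasSum.mul_left _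
  rw [← h.tsum_eq, Model.V]
  refine tsum_congr fun t => ?_
  have : (fun s => expect (π.act s) fun a => ρ s a) = avg π ρ := funext fun s => expect_act _ _ _
  rw [this, expect_stateLaw, expect_fintype, Finset.mul_sum]
  exact Finset.sum_congr rfl fun s _ => by ring

/-- The state-action value function. -/
def Model.Q (π : Policy S A) (ρ : S → A → ℝ) (s : S) (a : A) : ℝ :=
  ρ s a + M.γ * ∑ s', (M.P s a s').toReal * M.res π (avg π ρ) s'

theorem Model.avg_Q (π : Policy S A) (ρ : S → A → ℝ) (s : S) :
    avg π (M.Q π ρ) s = M.res π (avg π ρ) s := by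
  rw [M.res_eq, avg, avg, stepOp_apply, Finset.mul_sum, ← Finset.sum_add_distrib]
  exact Finset.sum_congr rfl fun a _ => by rw [Model.Q]; ring

theorem Model.abs_Q_le (π : Policy S A) {ρ : S → A → ℝ} {C : ℝ} (h : ∀ s a, |ρ s a| ≤ C) (s : S)
    (a : A) : |M.Q π ρ s a| ≤ C / (1 - M.γ) := by
  have h1 : |∑ s', (M.P s a s').toReal * M.res π (avg π ρ) s'| ≤ C / (1 - M.γ) := by
    rw [← expect_fintype]
    exact abs_expect_le _ fun s' _ => M.abs_res_le π (abs_avg_le π h) s'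
  have h0 := M.one_sub_pos
  calc |M.Q π ρ s a| ≤ |ρ s a| + |M.γ * ∑ s', (M.P s a s').toReal * M.res π (avg π ρ) s'| :=
        abs_add_le _ _
    _ ≤ C + M.γ * (C / (1 - M.γ)) := by
        rw [abs_mul, abs_of_pos M.γ_pos]
        gcongr
        · exact h s a
        · exact M.γ_pos.le
    _ = C / (1 - M.γ) := by field_simp; ring

/-- The performance difference formula. -/
theorem Model.res_avg_sub (π π' : Policy S A) (ρ : S → A → ℝ) :
    M.res π' (avg π' ρ) - M.res π (avg π ρ) =
      M.res π' (fun s => ∑ a, (π'.1 (s, a) - π.1 (s, a)) * M.Q π ρ s a) := by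
  apply M.eq_res
  intro s
  rw [map_sub, Pi.sub_apply, Pi.sub_apply, M.res_eq π' (avg π' ρ)]
  have h1 : ∑ a, (π'.1 (s, a) - π.1 (s, a)) * M.Q π ρ s a =
      avg π' (M.Q π ρ) s - avg π (M.Q π ρ) s := by
    simp only [sub_mul, Finset.sum_sub_distrib, avg]
  have h2 : avg π' (M.Q π ρ) s = avg π' ρ s + M.γ * stepOp M.P π' (M.res π (avg π ρ)) s := by
    rw [avg, avg, stepOp_apply, Finset.mul_sum, ← Finset.sum_add_distrib]
    exact Finset.sum_congr rfl fun a _ => by rw [Model.Q]; ring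
  rw [h1, h2, M.avg_Q]
  ring

/-- A second resolvent identity. It extracts a factor `π' - π` from a change of policy inside the
resolvent; after the performance difference formula has produced one such factor, this one makes the
linearization error quadratic. -/
theorem Model.res_sub_res (π π' : Policy S A) (f : S → ℝ) :
    M.res π' f - M.res π f = M.res π' (fun s => M.γ *
      ∑ a, (π'.1 (s, a) - π.1 (s, a)) * ∑ s', (M.P s a s').toReal * M.res π f s') := by
  apply M.eq_res
  intro s
  rw [map_sub, Pi.sub_apply, Pi.sub_apply, M.res_eq π' f, M.res_eq π f]
  simp only [sub_mul, Finset.sum_sub_distrib, ← stepOp_apply]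
  have h : M.res π f = fun s => f s + M.γ * stepOp M.P π (M.res π f) s := funext (M.res_eq π f)
  rw [stepOp_apply M.P π', stepOp_apply M.P π]
  ring

end MDP

/-! ### Mixing and oscillation. -/

section Mixing

variable {S A : Type*} [Fintype S] [Fintype A] {q : ℕ} (M : Model S A q)

theorem expect_sub_le_tvDist (p p' : PMF S) {f : S → ℝ} {D : ℝ} (hD : ∀ x y, f x - f y ≤ D) :
    |expect p f - expect p' f| ≤ tvDist p p' * D := by
  have h := abs_sum_mul_le_osc (fun s => (p s).toReal - (p' s).toReal) f
    (by rw [Finset.sum_sub_distrib, sum_toReal, sum_toReal, sub_self]) hD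
  simp only [sub_mul, Finset.sum_sub_distrib] at h
  rw [expect_fintype, expect_fintype, tvDist]
  linarith

theorem expect_sub_le_osc (p p' : PMF S) {f : S → ℝ} {D : ℝ} (hD : ∀ x y, f x - f y ≤ D) :
    expect p f - expect p' f ≤ D := by
  obtain ⟨C, _, hC⟩ := finite_bdd f
  have h1 : ∀ y, expect p f - f y ≤ D := fun y => by
    have : expect p f ≤ f y + D := expect_le p (fun x _ => hC x) fun x _ => by linarith [hD x y]
    linarith
  have h2 : expect p' (fun _ => expect p f - D) ≤ expect p' f :=
    expect_mono p' (fun _ _ => le_rfl) (fun x _ => hC x) fun y _ => by linarith [h1 y]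
  rw [expect_const] at h2
  linarith

/-- Averaging never increases oscillations, and passing through the stationary law costs `CM * ρ ^
t` for each of the two initial states. Keeping the minimum makes the sum over `t` grow only with the
logarithm of `CM`. -/
theorem UniformlyErgodic.stepOp_pow_sub_le {κ : S → A → PMF S} {CM ρ : ℝ}
    (h : UniformlyErgodic κ CM ρ) (π : Policy S A) (t : ℕ) {f : S → ℝ} {D : ℝ}
    (hD : ∀ x y, f x - f y ≤ D) (s s' : S) :
    (stepOp κ π ^ t) f s - (stepOp κ π ^ t) f s' ≤ min 1 (2 * CM * ρ ^ t) * D := by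
  have hD0 : 0 ≤ D := by simpa using hD s s
  have he : ∀ s, (stepOp κ π ^ t) f s = expect (stateLaw κ π (PMF.pure s) t) f := fun s => by
    rw [expect_stateLaw, expect_pure]
  rw [he, he, min_mul_of_nonneg _ _ hD0, one_mul]
  refine le_min (expect_sub_le_osc _ _ hD) ?_
  obtain ⟨χ, -, hχ⟩ := h π
  have h1 := (abs_le.1 (expect_sub_le_tvDist (stateLaw κ π (PMF.pure s) t) χ hD)).2
  have h2 := (abs_le.1 (expect_sub_le_tvDist (stateLaw κ π (PMF.pure s') t) χ hD)).1
  have h3 := mul_le_mul_of_nonneg_right (hχ t s) hD0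
  have h4 := mul_le_mul_of_nonneg_right (hχ t s') hD0
  linarith

theorem Model.restart_toReal (s : S) (a : A) (s' : S) :
    (M.restart s a s').toReal = M.γ * (M.P s a s').toReal + (1 - M.γ) * (M.ζ s').toReal := by
  have h0 := M.one_sub_pos.le
  rw [Model.restart, PMF.ofFintype_apply, ENNReal.toReal_add, ENNReal.toReal_mul,
    ENNReal.toReal_mul, ENNReal.toReal_ofReal M.γ_pos.le, ENNReal.toReal_ofReal h0]
  · exact ENNReal.mul_ne_top ENNReal.ofReal_ne_top (PMF.apply_ne_top _ _)
  · exact ENNReal.mul_ne_top ENNReal.ofReal_ne_top (PMF.apply_ne_top _ _)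

theorem Model.stepOp_restart (π : Policy S A) (f : S → ℝ) (s : S) :
    stepOp M.restart π f s = M.γ * stepOp M.P π f s + (1 - M.γ) * M.init f := by
  simp only [stepOp_apply, M.restart_toReal, add_mul, Finset.sum_add_distrib, mul_add]
  congr 1
  · simp only [Finset.mul_sum]
    exact Finset.sum_congr rfl fun a _ => Finset.sum_congr rfl fun s' _ => by ring
  · simp only [mul_assoc, ← Finset.mul_sum]
    rw [← Finset.sum_mul, π.2.2, one_mul, M.init_apply]

/-- A restart adds the same number at every state, which oscillations do not see. So mixing of the
restarted chain controls `γ^t P_π^t f` itself, and both alternatives of the ergodicity assumption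
lead to one estimate. -/
theorem Model.stepOp_restart_pow (π : Policy S A) (f : S → ℝ) (t : ℕ) :
    ∃ c, ∀ s, (stepOp M.restart π ^ t) f s = M.γ ^ t * (stepOp M.P π ^ t) f s + c := by
  induction t with
  | zero => exact ⟨0, fun s => by simp⟩
  | succ t ih =>
    obtain ⟨c, hc⟩ := ih
    refine ⟨M.γ * c + (1 - M.γ) * M.init ((stepOp M.restart π ^ t) f), fun s => ?_⟩
    have h : (stepOp M.restart π ^ t) f = M.γ ^ t • (stepOp M.P π ^ t) f + fun _ => c :=
      funext fun s => by simp [hc s]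
    rw [pow_succ' (stepOp M.restart π), Module.End.mul_apply, M.stepOp_restart,
      pow_succ' (stepOp M.P π), Module.End.mul_apply, ← add_assoc]
    congr 1
    rw [h, map_add, map_smul, Pi.add_apply, stepOp_const]
    simp only [Pi.smul_apply, smul_eq_mul]
    ring

/-- The resolvent increases oscillations at most by the factor `κ`. -/
def Model.OscBound (κ : ℝ) : Prop := ∀ (π : Policy S A) (f : S → ℝ) (D : ℝ),
  (∀ s s', f s - f s' ≤ D) → ∀ s s', M.res π f s - M.res π f s' ≤ κ * D

theorem mixing_sum {CM ρ : ℝ} (hCM : 1 ≤ CM) (hρ₀ : 0 < ρ) (hρ₁ : ρ < 1) :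
    Summable (fun t : ℕ => min 1 (2 * CM * ρ ^ t)) ∧
      ∑' t : ℕ, min 1 (2 * CM * ρ ^ t) ≤ 2 * mixConst CM ρ - 3 := by
  have h0 : ∀ t : ℕ, 0 ≤ min 1 (2 * CM * ρ ^ t) := fun t => le_min zero_le_one (by positivity)
  have hs : Summable (fun t : ℕ => min 1 (2 * CM * ρ ^ t)) := by
    refine Summable.of_nonneg_of_le h0 (fun t => min_le_right _ _) ?_
    exact (summable_geometric_of_lt_one hρ₀.le hρ₁).mul_left _
  refine ⟨hs, ?_⟩
  have hlog : 0 ≤ Real.logb ρ CM⁻¹ :=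
    Real.logb_nonneg_of_base_lt_one hρ₀ hρ₁ (by positivity) (inv_le_one_of_one_le₀ hCM)
  obtain ⟨n, hn⟩ := Int.eq_ofNat_of_zero_le (Int.ceil_nonneg hlog)
  have hpow : CM * ρ ^ n ≤ 1 := by
    have h1 : Real.logb ρ CM⁻¹ ≤ n := by
      have := Int.le_ceil (Real.logb ρ CM⁻¹)
      rw [hn] at this
      exact_mod_cast this
    have h2 : ρ ^ (n : ℝ) ≤ CM⁻¹ := by
      rw [Real.logb_le_iff_le_rpow_of_base_lt_one hρ₀ hρ₁ (by positivity)] at h1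
      exact h1
    rw [Real.rpow_natCast] at h2
    calc CM * ρ ^ n ≤ CM * CM⁻¹ := by gcongr
      _ = 1 := mul_inv_cancel₀ (by positivity)
  -- Terms up to `n`, where `CM * ρ ^ n ≤ 1`, count one each, and later ones are at most `2ρ * ρ ^
  -- t`. The total `n - 1 + 2/(1 - ρ)` is within `2m - 3 = 2n - 1 + 2/(1 - ρ)`; the same estimate
  -- with a cut at `n` would be too large for `n = 0`.
  have hsum := hs.sum_add_tsum_nat_add (n + 1)
  have h1 : ∑ t ∈ Finset.range (n + 1), min 1 (2 * CM * ρ ^ t) ≤ n + 1 := by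
    calc ∑ t ∈ Finset.range (n + 1), min 1 (2 * CM * ρ ^ t) ≤ ∑ t ∈ Finset.range (n + 1), (1 : ℝ) :=
          Finset.sum_le_sum fun t _ => min_le_left _ _
      _ = n + 1 := by simp
  have hg := (summable_geometric_of_lt_one hρ₀.le hρ₁).mul_left (2 * ρ)
  have h2 : ∑' t : ℕ, min 1 (2 * CM * ρ ^ (t + (n + 1))) ≤ ∑' t : ℕ, 2 * ρ * ρ ^ t := by
    refine ((summable_nat_add_iff (n + 1)).2 hs).tsum_le_tsum (fun t => ?_) hg
    refine (min_le_right _ _).trans ?_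
    calc 2 * CM * ρ ^ (t + (n + 1)) = (CM * ρ ^ n) * (2 * ρ * ρ ^ t) := by ring
      _ ≤ 1 * (2 * ρ * ρ ^ t) := by gcongr
      _ = _ := one_mul _
  rw [tsum_mul_left, tsum_geometric_of_lt_one hρ₀.le hρ₁] at h2
  have h3 : 2 * ρ * (1 - ρ)⁻¹ = 2 * (1 - ρ)⁻¹ - 2 := by
    have : 1 - ρ ≠ 0 := (sub_pos.2 hρ₁).ne'
    field_simp
    ring
  have h4 : mixConst CM ρ = 1 + n + (1 - ρ)⁻¹ := by
    rw [mixConst, hn]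
    simp
  have hn0 : (0 : ℝ) ≤ n := Nat.cast_nonneg n
  rw [h4]
  linarith

theorem Model.oscBound {CM ρ : ℝ} (hCM : 1 ≤ CM) (hρ₀ : 0 < ρ) (hρ₁ : ρ < 1)
    (h : UniformlyErgodic M.P CM ρ ∨ UniformlyErgodic M.restart CM ρ) :
    M.OscBound (2 * mixConst CM ρ - 3) := by
  intro π f D hD s s'
  have hD0 : 0 ≤ D := by simpa using hD s s
  have h0 : ∀ t : ℕ, 0 ≤ min 1 (2 * CM * ρ ^ t) := fun t => le_min zero_le_one (by positivity)
  obtain ⟨hs, hsum⟩ := mixing_sum hCM hρ₀ hρ₁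
  have key : ∀ t : ℕ, M.γ ^ t * (stepOp M.P π ^ t) f s - M.γ ^ t * (stepOp M.P π ^ t) f s' ≤
      min 1 (2 * CM * ρ ^ t) * D := by
    intro t
    rcases h with h | h
    · have h1 := h.stepOp_pow_sub_le π t hD s s'
      rw [← mul_sub]
      calc M.γ ^ t * ((stepOp M.P π ^ t) f s - (stepOp M.P π ^ t) f s')
          ≤ M.γ ^ t * (min 1 (2 * CM * ρ ^ t) * D) :=
            mul_le_mul_of_nonneg_left h1 (pow_nonneg M.γ_pos.le t)
        _ ≤ 1 * (min 1 (2 * CM * ρ ^ t) * D) :=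
            mul_le_mul_of_nonneg_right (pow_le_one₀ M.γ_pos.le M.γ_lt_one.le)
              (mul_nonneg (h0 t) hD0)
        _ = _ := one_mul _
    · have h1 := h.stepOp_pow_sub_le π t hD s s'
      obtain ⟨c, hc⟩ := M.stepOp_restart_pow π f t
      rw [hc, hc] at h1
      linarith
  rw [M.res_apply, M.res_apply, ← (M.summable_res π f s).tsum_sub (M.summable_res π f s')]
  calc _ ≤ ∑' t : ℕ, min 1 (2 * CM * ρ ^ t) * D :=
        ((M.summable_res π f s).sub (M.summable_res π f s')).tsum_le_tsum key (hs.mul_right D)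
    _ ≤ _ := by
        rw [tsum_mul_right]
        gcongr

theorem two_le_mixConst {CM ρ : ℝ} (hCM : 1 ≤ CM) (hρ₀ : 0 < ρ) (hρ₁ : ρ < 1) :
    2 ≤ mixConst CM ρ := by
  have hlog : 0 ≤ Real.logb ρ CM⁻¹ :=
    Real.logb_nonneg_of_base_lt_one hρ₀ hρ₁ (by positivity) (inv_le_one_of_one_le₀ hCM)
  have h1 : (0 : ℝ) ≤ (⌈Real.logb ρ CM⁻¹⌉ : ℝ) := by exact_mod_cast Int.ceil_nonneg hlog
  have h2 : 1 ≤ (1 - ρ)⁻¹ := (one_le_inv₀ (sub_pos.2 hρ₁)).2 (by linarith)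
  rw [mixConst]
  linarith

end Mixing

/-! ### The policy gradient and gradient dominance. -/

section PolicyGradient

variable {S A : Type*} [Fintype S] [Fintype A] {q : ℕ} (M : Model S A q)

theorem sum_abs_row_le (Δ : EuclideanSpace ℝ (S × A)) (s : S) :
    ∑ a, |Δ (s, a)| ≤ √(Fintype.card A) * ‖Δ‖ := by
  refine le_of_sq_le_sq (a := ∑ a, |Δ (s, a)|) ?_ (by positivity)
  rw [mul_pow, Real.sq_sqrt (Nat.cast_nonneg _), EuclideanSpace.real_norm_sq_eq]
  refine (sq_sum_le_card_mul_sum_sq (s := Finset.univ) (f := fun a => |Δ (s, a)|)).trans ?_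
  rw [Finset.card_univ]
  gcongr
  simp only [sq_abs]
  rw [Fintype.sum_prod_type]
  exact Finset.single_le_sum (f := fun s => ∑ a, Δ (s, a) ^ 2)
    (fun s _ => Finset.sum_nonneg fun a _ => sq_nonneg _) (Finset.mem_univ s)

theorem abs_row_mul_le (Δ : EuclideanSpace ℝ (S × A)) {f : S → A → ℝ} {C : ℝ} (s : S)
    (h : ∀ a, |f s a| ≤ C) : |∑ a, Δ (s, a) * f s a| ≤ √(Fintype.card A) * ‖Δ‖ * C := by
  rcases isEmpty_or_nonempty A with hA | ⟨⟨a⟩⟩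
  · simp
  have hC : 0 ≤ C := (abs_nonneg _).trans (h a)
  calc |∑ a, Δ (s, a) * f s a| ≤ ∑ a, |Δ (s, a) * f s a| := Finset.abs_sum_le_sum_abs _ _
    _ ≤ ∑ a, |Δ (s, a)| * C := by
        gcongr with a _
        rw [abs_mul]
        gcongr
        exact h a
    _ ≤ _ := by
        rw [← Finset.sum_mul]
        gcongr
        exact sum_abs_row_le Δ s

theorem policy_sub_sum (π π' : Policy S A) (s : S) :
    ∑ a, (π'.1 - π.1) (s, a) = 0 := by
  simp [Finset.sum_sub_distrib, π.2.2, π'.2.2]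

/-- Rows of a difference of policies have sum zero, so only the oscillation of `f` over the actions
counts. This is the entry point for `OscBound`. -/
theorem abs_policy_sub_mul_le (π π' : Policy S A) (f : A → ℝ) {D : ℝ} (s : S)
    (h : ∀ a a', f a - f a' ≤ D) :
    |∑ a, (π'.1 - π.1) (s, a) * f a| ≤ √(Fintype.card A) * ‖π'.1 - π.1‖ * (D / 2) := by
  refine (abs_sum_mul_le_osc _ _ (policy_sub_sum π π' s) h).trans ?_
  rcases isEmpty_or_nonempty A with hA | ⟨⟨a⟩⟩
  · simp
  have hD : 0 ≤ D := by simpa using h a a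
  gcongr
  exact sum_abs_row_le _ s

open Classical in
/-- The total discounted time spent in a state. -/
def Model.visit (π : Policy S A) (s : S) : ℝ := M.init (M.res π (Pi.single s 1))

theorem Model.init_res (π : Policy S A) (f : S → ℝ) :
    M.init (M.res π f) = ∑ s, M.visit π s * f s := by
  classical
  have := LinearMap.pi_apply_eq_sum_univ (M.init ∘ₗ M.res π) f
  rw [LinearMap.comp_apply] at this
  rw [this]
  refine Finset.sum_congr rfl fun s _ => ?_
  rw [smul_eq_mul, mul_comm, Model.visit, LinearMap.comp_apply]
  congr 4
  funext i
  simp [Pi.single_apply, eq_comm]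

theorem Model.visit_ge (π : Policy S A) (s : S) : (M.ζ s).toReal ≤ M.visit π s := by
  classical
  have h : M.init (Pi.single s 1) = (M.ζ s).toReal := by
    rw [M.init_apply, Finset.sum_eq_single s]
    · simp
    · intro b _ hb
      simp [hb]
    · simp
  rw [← h, Model.visit]
  refine M.init_mono (M.le_res π fun s' => ?_)
  by_cases hs : s' = s
  · subst hs; simp
  · simp [hs]

theorem Model.visit_nonneg (π : Policy S A) (s : S) : 0 ≤ M.visit π s :=
  (toReal_nonneg _ _).trans (M.visit_ge π s)

theorem Model.sum_visit (π : Policy S A) : ∑ s, M.visit π s = 1 / (1 - M.γ) := by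
  have := M.init_res π (fun _ => 1)
  simp only [mul_one] at this
  rw [← this]
  have h : M.res π (fun _ => 1) = fun _ => 1 / (1 - M.γ) := funext (M.res_const π 1)
  rw [h, M.init_const]

theorem Model.visit_le (π : Policy S A) (s : S) : M.visit π s ≤ 1 / (1 - M.γ) := by
  rw [← M.sum_visit π]
  exact Finset.single_le_sum (fun s _ => M.visit_nonneg π s) (Finset.mem_univ s)

/-- The gradient of `θ ↦ -V(π_θ, ρ)`. -/
def Model.polGrad (θ : Policy S A) (ρ : S → A → ℝ) : EuclideanSpace ℝ (S × A) :=
  WithLp.toLp 2 fun x => -(M.visit θ x.1 * M.Q θ ρ x.1 x.2)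

theorem Model.inner_polGrad (θ : Policy S A) (ρ : S → A → ℝ) (Δ : EuclideanSpace ℝ (S × A)) :
    inner ℝ (M.polGrad θ ρ) Δ =
      -M.init (M.res θ fun s => ∑ a, Δ (s, a) * M.Q θ ρ s a) := by
  rw [M.init_res, PiLp.inner_apply, Fintype.sum_prod_type, ← Finset.sum_neg_distrib]
  refine Finset.sum_congr rfl fun s _ => ?_
  rw [Finset.mul_sum, ← Finset.sum_neg_distrib]
  refine Finset.sum_congr rfl fun a _ => ?_
  simp only [Model.polGrad, RCLike.inner_apply, conj_trivial]
  ring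

theorem Model.Q_sub (θ : Policy S A) (ρ₁ ρ₂ : S → A → ℝ) (s : S) (a : A) :
    M.Q θ (fun s a => ρ₁ s a - ρ₂ s a) s a = M.Q θ ρ₁ s a - M.Q θ ρ₂ s a := by
  have h : avg θ (fun s a => ρ₁ s a - ρ₂ s a) = avg θ ρ₁ - avg θ ρ₂ := by
    funext s
    simp only [avg, Pi.sub_apply, mul_sub, Finset.sum_sub_distrib]
  simp only [Model.Q, h, map_sub, Pi.sub_apply, mul_sub, Finset.sum_sub_distrib]
  ring

theorem Model.polGrad_sub (θ : Policy S A) (ρ₁ ρ₂ : S → A → ℝ) :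
    M.polGrad θ ρ₁ - M.polGrad θ ρ₂ = M.polGrad θ (fun s a => ρ₁ s a - ρ₂ s a) := by
  ext x
  simp only [Model.polGrad, PiLp.sub_apply, M.Q_sub]
  ring

/-- In `visit ^ 2` one factor is bounded by `1 / (1 - γ)` and the other is summed over the states,
so the number of states does not enter. -/
theorem Model.norm_polGrad_le (θ : Policy S A) {ρ : S → A → ℝ} {R : ℝ}
    (hρ : ∀ s a, |ρ s a| ≤ R) (hR : 0 ≤ R) :
    ‖M.polGrad θ ρ‖ ≤ √(Fintype.card A) * R / (1 - M.γ) ^ 2 := by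
  have h0 := M.one_sub_pos
  refine le_of_sq_le_sq ?_ (by positivity)
  rw [EuclideanSpace.real_norm_sq_eq, Fintype.sum_prod_type]
  calc ∑ s, ∑ a, (M.polGrad θ ρ (s, a)) ^ 2
      ≤ ∑ s, ∑ a : A, M.visit θ s * (1 / (1 - M.γ)) * (R / (1 - M.γ)) ^ 2 := by
        gcongr with s _ a _
        simp only [Model.polGrad, neg_sq, mul_pow]
        refine mul_le_mul ?_ ?_ (sq_nonneg _) ?_
        · rw [sq]
          exact mul_le_mul_of_nonneg_left (M.visit_le θ s) (M.visit_nonneg θ s)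
        · exact sq_le_sq' (abs_le.1 (M.abs_Q_le θ hρ s a)).1 (abs_le.1 (M.abs_Q_le θ hρ s a)).2
        · exact mul_nonneg (M.visit_nonneg θ s) (by positivity)
    _ = (√(Fintype.card A) * R / (1 - M.γ) ^ 2) ^ 2 := by
        simp only [Finset.sum_const, Finset.card_univ, nsmul_eq_mul, ← Finset.sum_mul,
          ← Finset.mul_sum, M.sum_visit]
        have hs := Real.sq_sqrt (Nat.cast_nonneg (α := ℝ) (Fintype.card A))
        field_simp
        rw [hs]
        ring

/-- The cruder of two estimates, from the size of `Q` alone; it leads to `L12`. The next one uses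
mixing and leads to `L21`. The descent inequality needs both. -/
theorem Model.abs_inner_polGrad_le (θ π π' : Policy S A) {ρ : S → A → ℝ} {d : ℝ}
    (hρ : ∀ s a, |ρ s a| ≤ d) :
    |inner ℝ (M.polGrad θ ρ) (π'.1 - π.1)| ≤
      √(Fintype.card A) * d / (1 - M.γ) ^ 2 * ‖π'.1 - π.1‖ := by
  rw [M.inner_polGrad, abs_neg]
  refine (M.abs_init_le (M.abs_res_le θ fun s =>
    abs_row_mul_le _ s fun a => M.abs_Q_le θ hρ s a)).trans (le_of_eq ?_)
  have := M.one_sub_pos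
  field_simp

-- Over the actions `Q` oscillates by at most `2d` from the reward and `2dκ` from the value of the
-- next state. So one factor `(1 - γ)⁻¹` is replaced by `1 + κ`.
variable {M} in
theorem Model.OscBound.abs_inner_polGrad_le {κ : ℝ} (hκ : M.OscBound κ) (hκ0 : 0 ≤ κ)
    (θ π π' : Policy S A) {ρ : S → A → ℝ} {d : ℝ} (hρ : ∀ s a, |ρ s a| ≤ d) (hd : 0 ≤ d) :
    |inner ℝ (M.polGrad θ ρ) (π'.1 - π.1)| ≤
      √(Fintype.card A) * d * (1 + κ) / (1 - M.γ) * ‖π'.1 - π.1‖ := by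
  have h0 := M.one_sub_pos
  have hosc : ∀ s a a', M.Q θ ρ s a - M.Q θ ρ s a' ≤ 2 * d * (1 + κ) := by
    intro s a a'
    have h1 : ∀ s s', M.res θ (avg θ ρ) s - M.res θ (avg θ ρ) s' ≤ κ * (2 * d) :=
      hκ θ _ _ fun s s' => by
        have h1 := abs_le.1 (abs_avg_le θ hρ s)
        have h2 := abs_le.1 (abs_avg_le θ hρ s')
        linarith
    have h2 := expect_sub_le_osc (M.P s a) (M.P s a') h1
    have h3 := abs_le.1 (hρ s a)
    have h4 := abs_le.1 (hρ s a')
    rw [expect_fintype, expect_fintype] at h2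
    have h5 := mul_le_mul_of_nonneg_left h2 M.γ_pos.le
    have h6 : M.γ * (κ * (2 * d)) ≤ 1 * (κ * (2 * d)) := by
      gcongr
      exact M.γ_lt_one.le
    simp only [Model.Q]
    linarith
  rw [M.inner_polGrad, abs_neg]
  refine (M.abs_init_le (M.abs_res_le θ fun s =>
    abs_policy_sub_mul_le π π' _ s (hosc s))).trans (le_of_eq ?_)
  field_simp

variable {M} in
/-- The error of the linear approximation of the value function is quadratic. -/
theorem Model.OscBound.abs_V_sub_le {κ : ℝ} (hκ : M.OscBound κ) (θ θ' : Policy S A)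
    {ρ : S → A → ℝ} {R : ℝ} (hρ : ∀ s a, |ρ s a| ≤ R) :
    |M.V θ' ρ - M.V θ ρ + inner ℝ (M.polGrad θ ρ) (θ'.1 - θ.1)| ≤
      Fintype.card A * R * κ / (1 - M.γ) ^ 2 * ‖θ'.1 - θ.1‖ ^ 2 := by
  have h0 := M.one_sub_pos
  set f : S → ℝ := fun s => ∑ a, (θ'.1 - θ.1) (s, a) * M.Q θ ρ s a with hf
  have hfb : ∀ s, |f s| ≤ √(Fintype.card A) * ‖θ'.1 - θ.1‖ * (R / (1 - M.γ)) := fun s =>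
    abs_row_mul_le _ s fun a => M.abs_Q_le θ hρ s a
  have h1 : ∀ s s', M.res θ f s - M.res θ f s' ≤
      κ * (2 * (√(Fintype.card A) * ‖θ'.1 - θ.1‖ * (R / (1 - M.γ)))) :=
    hκ θ f _ fun s s' => by
      have h1 := abs_le.1 (hfb s)
      have h2 := abs_le.1 (hfb s')
      linarith
  -- The performance difference is `res θ' f` and the linear term is `res θ f`; `res_sub_res` finds
  -- a second factor `θ' - θ` in their difference.
  have h2 : M.V θ' ρ - M.V θ ρ + inner ℝ (M.polGrad θ ρ) (θ'.1 - θ.1) =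
      M.init (M.res θ' fun s => M.γ * ∑ a, (θ'.1 (s, a) - θ.1 (s, a)) *
        ∑ s', (M.P s a s').toReal * M.res θ f s') := by
    rw [M.V_eq, M.V_eq, M.inner_polGrad, ← map_sub, M.res_avg_sub, ← sub_eq_add_neg, ← map_sub,
      ← M.res_sub_res]
    rfl
  rw [h2]
  refine (M.abs_init_le (M.abs_res_le θ'
    (C := 1 * (√(Fintype.card A) * ‖θ'.1 - θ.1‖ *
      (κ * (2 * (√(Fintype.card A) * ‖θ'.1 - θ.1‖ * (R / (1 - M.γ)))) / 2)))
    fun s => ?_)).trans (le_of_eq ?_)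
  · rw [abs_mul, abs_of_pos M.γ_pos]
    refine mul_le_mul M.γ_lt_one.le ?_ (abs_nonneg _) zero_le_one
    refine abs_policy_sub_mul_le θ θ' (fun a => ∑ s', (M.P s a s').toReal * M.res θ f s') s
      fun a a' => ?_
    simp only [← expect_fintype]
    exact expect_sub_le_osc _ _ h1
  · have hs := Real.sq_sqrt (Nat.cast_nonneg (α := ℝ) (Fintype.card A))
    field_simp
    rw [hs]
    ring

/-- Gradient dominance of the value function. -/
theorem Model.exists_V_sub_le {ζ₀ : ℝ} (hζ₀ : 0 < ζ₀) (hζ : ∀ s, ζ₀ ≤ (M.ζ s).toReal)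
    (θ θ' : Policy S A) (ρ : S → A → ℝ) :
    ∃ θb : Policy S A, M.V θ' ρ - M.V θ ρ ≤
      1 / ((1 - M.γ) * ζ₀) * inner ℝ (M.polGrad θ ρ) (θ.1 - θb.1) := by
  classical
  have h0 := M.one_sub_pos
  have hex : ∀ s, ∃ a, ∀ a', M.Q θ ρ s a' ≤ M.Q θ ρ s a := fun s => by
    have : Nonempty A := by
      by_contra hA
      rw [not_nonempty_iff] at hA
      simpa using θ.2.2 s
    exact Finite.exists_max _
  choose b hb using hex
  -- The deterministic greedy policy maximizes the linearized gain at all states at once. The gains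
  -- are then nonnegative, and occupation weights can be exchanged state by state.
  let θb : Policy S A := ⟨WithLp.toLp 2 fun x => if x.2 = b x.1 then 1 else 0,
    fun s a => by dsimp only; split_ifs <;> norm_num, fun s => by simp⟩
  have hθb : ∀ s, ∑ a, (θb.1 - θ.1) (s, a) * M.Q θ ρ s a =
      M.Q θ ρ s (b s) - avg θ (M.Q θ ρ) s := fun s => by
    simp [θb, sub_mul, Finset.sum_sub_distrib, avg]
  have hle : ∀ π : Policy S A, ∀ s, avg π (M.Q θ ρ) s ≤ M.Q θ ρ s (b s) := fun π s => by
    calc avg π (M.Q θ ρ) s ≤ ∑ a, π.1 (s, a) * M.Q θ ρ s (b s) := by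
          rw [avg]
          gcongr with a _
          · exact π.2.1 s a
          · exact hb s a
      _ = _ := by rw [← Finset.sum_mul, π.2.2, one_mul]
  refine ⟨θb, ?_⟩
  have h1 : inner ℝ (M.polGrad θ ρ) (θ.1 - θb.1) =
      ∑ s, M.visit θ s * (M.Q θ ρ s (b s) - avg θ (M.Q θ ρ) s) := by
    rw [← neg_sub, inner_neg_right, M.inner_polGrad, neg_neg, M.init_res]
    simp only [hθb]
  rw [h1, M.V_eq, M.V_eq, ← map_sub, M.res_avg_sub, M.init_res, Finset.mul_sum]
  refine Finset.sum_le_sum fun s _ => ?_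
  have h2 : ∑ a, (θ'.1 (s, a) - θ.1 (s, a)) * M.Q θ ρ s a ≤
      M.Q θ ρ s (b s) - avg θ (M.Q θ ρ) s := by
    have : ∑ a, (θ'.1 (s, a) - θ.1 (s, a)) * M.Q θ ρ s a =
        avg θ' (M.Q θ ρ) s - avg θ (M.Q θ ρ) s := by
      simp only [sub_mul, Finset.sum_sub_distrib, avg]
    rw [this]
    linarith [hle θ' s]
  have h3 : 0 ≤ M.Q θ ρ s (b s) - avg θ (M.Q θ ρ) s := sub_nonneg.2 (hle θ s)
  calc M.visit θ' s * ∑ a, (θ'.1 (s, a) - θ.1 (s, a)) * M.Q θ ρ s a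
      ≤ M.visit θ' s * (M.Q θ ρ s (b s) - avg θ (M.Q θ ρ) s) :=
        mul_le_mul_of_nonneg_left h2 (M.visit_nonneg θ' s)
    _ ≤ (1 / ((1 - M.γ) * ζ₀) * M.visit θ s) * (M.Q θ ρ s (b s) - avg θ (M.Q θ ρ) s) := by
        refine mul_le_mul_of_nonneg_right ?_ h3
        -- Distribution mismatch: an occupation is at most the total discounted time, and at least
        -- the initial mass `ζ₀`.
        calc M.visit θ' s ≤ 1 / (1 - M.γ) := M.visit_le θ' s
          _ = 1 / ((1 - M.γ) * ζ₀) * ζ₀ := by field_simp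
          _ ≤ _ := by
            gcongr
            exact (hζ s).trans (M.visit_ge θ s)
    _ = _ := by ring

end PolicyGradient

/-! ### Projections and strong concavity. -/

section Convexity

variable {E : Type*} [NormedAddCommGroup E] [InnerProductSpace ℝ E]

/-- A nearest point exists by closedness and convexity, so the choice in `proj` really is a
minimizer and satisfies the variational inequality. -/
theorem inner_proj_le [CompleteSpace E] {C : Set E} (hC : Nonempty C) (hcl : IsClosed C)
    (hcv : Convex ℝ C) (x z : E) (hz : z ∈ C) :
    inner ℝ (x - (proj hC x : E)) (z - (proj hC x : E)) ≤ 0 := by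
  have hne : C.Nonempty := Set.nonempty_coe_sort.1 hC
  obtain ⟨v, hv, hvx⟩ := exists_norm_eq_iInf_of_complete_convex hne hcl.isComplete hcv x
  have hbdd : BddBelow (Set.range fun w : C => ‖x - w‖) :=
    ⟨0, by rintro _ ⟨w, rfl⟩; exact norm_nonneg _⟩
  have hspec : ∀ z : C, dist x (proj hC x : E) ≤ dist x z :=
    Classical.epsilon_spec (p := fun y : C => ∀ z : C, dist x (y : E) ≤ dist x z)
      ⟨⟨v, hv⟩, fun z => by
        rw [dist_eq_norm, dist_eq_norm, hvx]
        exact ciInf_le hbdd z⟩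
  refine (norm_eq_iInf_iff_real_inner_le_zero hcv (proj hC x).2).1 ?_ z hz
  refine le_antisymm (le_ciInf fun w => ?_) (ciInf_le hbdd (proj hC x))
  rw [← dist_eq_norm, ← dist_eq_norm]
  exact hspec w

/-- Nonexpansiveness in variational form. For the reward update `p'` is the maximizer of `F(θ, ·)`,
which satisfies the inequality without being written as a projection. -/
theorem norm_sub_le_of_inner_le {p p' y w : E} (h : inner ℝ (y - p) (p' - p) ≤ 0)
    (h' : inner ℝ (w - p') (p - p') ≤ 0) : ‖p - p'‖ ≤ ‖y - w‖ := by
  have h1 : inner ℝ (y - w) (p - p') =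
      inner ℝ (p - p') (p - p') - inner ℝ (y - p) (p' - p) - inner ℝ (w - p') (p - p') := by
    rw [← neg_sub p p', inner_neg_right, sub_neg_eq_add, ← inner_add_left, ← inner_sub_left]
    congr 1
    abel
  have h2 := real_inner_le_norm (y - w) (p - p')
  rw [h1, real_inner_self_eq_norm_sq] at h2
  have h3 : ‖p - p'‖ * ‖p - p'‖ ≤ ‖y - w‖ * ‖p - p'‖ := by nlinarith
  rcases (norm_nonneg (p - p')).eq_or_lt with h0 | h0
  · rw [← h0]
    exact norm_nonneg _
  · exact le_of_mul_le_mul_right h3 h0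

/-- Divide the defining inequality by the weight of `y` and let this weight tend to zero; the right
derivative along the segment appears. -/
theorem strongConcaveOn_le [CompleteSpace E] {s : Set E} {m : ℝ} {f : E → ℝ}
    (hf : StrongConcaveOn s m f) {x y G : E} (hx : x ∈ s) (hy : y ∈ s) (hG : HasGradientAt f G x) :
    f y ≤ f x + inner ℝ G (y - x) - m / 2 * ‖y - x‖ ^ 2 := by
  have hd : HasDerivAt (fun t : ℝ => f (x + t • (y - x))) (inner ℝ G (y - x)) 0 := by
    have h1 : HasDerivAt (fun t : ℝ => x + t • (y - x)) (y - x) 0 := by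
      simpa using ((hasDerivAt_id (0 : ℝ)).smul_const (y - x)).const_add x
    have h2 : HasFDerivAt f ((InnerProductSpace.toDual ℝ E) G) (x + (0 : ℝ) • (y - x)) := by
      simpa using hG.hasFDerivAt
    have h3 := h2.comp_hasDerivAt (0 : ℝ) h1
    simpa [Function.comp_def] using h3
  have ht := hd.tendsto_slope_zero_right
  have ht2 : Filter.Tendsto (fun t : ℝ => f y - f x + (1 - t) * (m / 2 * ‖y - x‖ ^ 2))
      (nhdsWithin 0 (Set.Ioi 0)) (nhds (f y - f x + (1 - 0) * (m / 2 * ‖y - x‖ ^ 2))) := by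
    refine Filter.Tendsto.mono_left ?_ nhdsWithin_le_nhds
    exact Continuous.tendsto (by fun_prop) 0
  have hle : ∀ᶠ t in nhdsWithin (0 : ℝ) (Set.Ioi 0),
      f y - f x + (1 - t) * (m / 2 * ‖y - x‖ ^ 2) ≤
        t⁻¹ • (f (x + (0 + t) • (y - x)) - f (x + (0 : ℝ) • (y - x))) := by
    filter_upwards [Ioo_mem_nhdsGT (zero_lt_one (α := ℝ))] with t ht
    have h1 := hf.2 hy hx ht.1.le (sub_nonneg.2 ht.2.le) (by ring)
    have h2 : t • y + (1 - t) • x = x + t • (y - x) := by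
      rw [smul_sub, sub_smul, one_smul]
      abel
    rw [h2] at h1
    simp only [smul_eq_mul, zero_add, zero_smul, add_zero] at h1 ⊢
    rw [inv_mul_eq_div, le_div_iff₀ ht.1]
    nlinarith
  have := le_of_tendsto_of_tendsto ht2 ht hle
  linarith

end Convexity

/-! ### The objective as a function of the reward parameter. -/

section Objective

variable {S A : Type*} [Fintype S] [Fintype A] {q : ℕ} {M : Model S A q}
  {Cα Cr Lr Lψ μ CM ρ ζ₀ : ℝ}

/-- The weights do not depend on the reward, so differentiation in `α` is termwise. -/
theorem Model.V_eq_sum (M : Model S A q) (π : Policy S A) (r : S → A → ℝ) :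
    M.V π r = ∑ s, ∑ a, M.visit π s * π.1 (s, a) * r s a := by
  rw [M.V_eq, M.init_res]
  exact Finset.sum_congr rfl fun s _ => by simp only [avg, Finset.mul_sum, mul_assoc]

theorem Model.sum_visit_mul (M : Model S A q) (π : Policy S A) :
    ∑ s, ∑ a, M.visit π s * π.1 (s, a) = 1 / (1 - M.γ) := by
  simp only [← Finset.mul_sum, π.2.2, mul_one, M.sum_visit]

/-- The gradient in `α` of `V(π, r_α)`. -/
def Model.valGrad (M : Model S A q) (π : Policy S A) (α : EuclideanSpace ℝ (Fin q)) :
    EuclideanSpace ℝ (Fin q) :=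
  ∑ s, ∑ a, (M.visit π s * π.1 (s, a)) • M.gradR α s a

/-- The gradient in `α` of `F(θ, α)`. -/
def Model.gradF (M : Model S A q) (θ : Policy S A) (α : EuclideanSpace ℝ (Fin q)) :
    EuclideanSpace ℝ (Fin q) :=
  M.valGrad M.πE α - M.valGrad θ α - gradient M.ψ α

namespace Model.Assumptions

variable (h : M.Assumptions Cα Cr Lr Lψ μ CM ρ ζ₀)
include h

theorem convex : Convex ℝ M.Λ := (h.F_concave M.πE).1

theorem isCompact : IsCompact M.Λ := by
  refine Metric.isCompact_of_isClosed_isBounded h.Λ_closed ?_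
  refine Metric.isBounded_iff.2 ⟨Cα, fun x hx y hy => ?_⟩
  rw [dist_eq_norm]
  exact h.Λ_bounded x hx y hy

theorem Cr_nonneg : 0 ≤ Cr := by
  obtain ⟨α, hα⟩ := h.Λ_nonempty
  exact (Real.sqrt_nonneg _).trans (h.r_grad α hα)

theorem Cα_nonneg : 0 ≤ Cα := by
  obtain ⟨α, hα⟩ := h.Λ_nonempty
  exact (norm_nonneg _).trans (h.Λ_bounded α hα α hα)

omit h in
theorem abs_gradR_le (α : EuclideanSpace ℝ (Fin q)) (s : S) (a : A) (i : Fin q) :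
    |M.gradR α s a i| ≤ ⨆ x : S × A, |M.gradR α x.1 x.2 i| :=
  le_ciSup (f := fun x : S × A => |M.gradR α x.1 x.2 i|) (Set.finite_range _).bddAbove (s, a)

theorem sum_sup_sq_le {α : EuclideanSpace ℝ (Fin q)} (hα : α ∈ M.Λ) :
    ∑ i : Fin q, (⨆ x : S × A, |M.gradR α x.1 x.2 i|) ^ 2 ≤ Cr ^ 2 :=
  (Real.sqrt_le_left h.Cr_nonneg).1 (h.r_grad α hα)

theorem norm_gradR_le {α : EuclideanSpace ℝ (Fin q)} (hα : α ∈ M.Λ) (s : S) (a : A) :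
    ‖M.gradR α s a‖ ≤ Cr := by
  rw [EuclideanSpace.norm_eq]
  refine (Real.sqrt_le_sqrt ?_).trans (h.r_grad α hα)
  gcongr with i _
  exact abs_gradR_le α s a i

theorem abs_r_sub_le {α₁ α₂ : EuclideanSpace ℝ (Fin q)} (h₁ : α₁ ∈ M.Λ) (h₂ : α₂ ∈ M.Λ) (s : S)
    (a : A) : |M.r α₁ s a - M.r α₂ s a| ≤ Cr * ‖α₁ - α₂‖ := by
  refine h.convex.norm_image_sub_le_of_norm_fderiv_le (𝕜 := ℝ) (f := fun α => M.r α s a)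
    (fun α hα => h.r_diff α hα s a) (fun α hα => ?_) h₂ h₁
  have := h.norm_gradR_le hα s a
  rwa [Model.gradR, gradient, LinearIsometryEquiv.norm_map] at this

theorem hasFDerivAt_V (π : Policy S A) {α : EuclideanSpace ℝ (Fin q)} (hα : α ∈ M.Λ) :
    HasFDerivAt (fun α => M.V π (M.r α))
      ((InnerProductSpace.toDual ℝ (EuclideanSpace ℝ (Fin q))) (M.valGrad π α)) α := by
  have h1 : (fun α => M.V π (M.r α)) =
      fun α => ∑ s, ∑ a, M.visit π s * π.1 (s, a) * M.r α s a :=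
    funext fun α => M.V_eq_sum π _
  rw [h1, Model.valGrad, map_sum]
  simp only [map_sum, map_smulₛₗ, conj_trivial]
  exact HasFDerivAt.fun_sum fun s _ => HasFDerivAt.fun_sum fun a _ =>
    ((h.r_diff α hα s a).hasGradientAt.hasFDerivAt.const_mul _)

theorem hasGradientAt_F (θ : Policy S A) {α : EuclideanSpace ℝ (Fin q)} (hα : α ∈ M.Λ) :
    HasGradientAt (M.F θ) (M.gradF θ α) α := by
  rw [hasGradientAt_iff_hasFDerivAt, Model.gradF, map_sub, map_sub]
  exact ((h.hasFDerivAt_V M.πE hα).sub (h.hasFDerivAt_V θ hα)).sub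
    (h.ψ_diff α hα).hasGradientAt.hasFDerivAt

theorem norm_valGrad_sub_le (π : Policy S A) {α₁ α₂ : EuclideanSpace ℝ (Fin q)} (h₁ : α₁ ∈ M.Λ)
    (h₂ : α₂ ∈ M.Λ) :
    ‖M.valGrad π α₁ - M.valGrad π α₂‖ ≤ Lr / (1 - M.γ) * ‖α₁ - α₂‖ := by
  have hn : ∀ s a, 0 ≤ M.visit π s * π.1 (s, a) := fun s a =>
    mul_nonneg (M.visit_nonneg π s) (π.2.1 s a)
  rw [Model.valGrad, Model.valGrad]
  simp only [← Finset.sum_sub_distrib, ← smul_sub]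
  calc _ ≤ ∑ s, ∑ a, M.visit π s * π.1 (s, a) * (Lr * ‖α₁ - α₂‖) := by
        refine norm_sum_le_of_le _ fun s _ => norm_sum_le_of_le _ fun a _ => ?_
        rw [norm_smul, Real.norm_of_nonneg (hn s a)]
        exact mul_le_mul_of_nonneg_left (h.r_lip s a α₁ h₁ α₂ h₂) (hn s a)
    _ = _ := by
        simp only [← Finset.sum_mul, M.sum_visit_mul]
        ring

theorem norm_gradF_sub_le (θ : Policy S A) {α₁ α₂ : EuclideanSpace ℝ (Fin q)} (h₁ : α₁ ∈ M.Λ)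
    (h₂ : α₂ ∈ M.Λ) :
    ‖M.gradF θ α₁ - M.gradF θ α₂‖ ≤ L22 q M.γ Lr Lψ * ‖α₁ - α₂‖ := by
  -- No sign of `Lr` is assumed: two distinct points force `0 ≤ Lr` and `1 ≤ q`, which are needed to
  -- insert the factor `√q`.
  rcases eq_or_ne α₁ α₂ with rfl | hne
  · simp
  have h0 := M.one_sub_pos
  have hpos : 0 < ‖α₁ - α₂‖ := norm_pos_iff.2 (sub_ne_zero.2 hne)
  have hS : Nonempty S := by
    obtain ⟨s, -⟩ := M.ζ.support_nonempty
    exact ⟨s⟩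
  have hA : Nonempty A := by
    obtain ⟨s⟩ := hS
    obtain ⟨a, -⟩ := (M.πE.act s).support_nonempty
    exact ⟨a⟩
  have hLr : 0 ≤ Lr := by
    have := (norm_nonneg _).trans (h.r_lip hS.some hA.some α₁ h₁ α₂ h₂)
    exact nonneg_of_mul_nonneg_left this hpos
  have hq : 1 ≤ √(q : ℝ) := by
    rw [Real.one_le_sqrt]
    have : q ≠ 0 := by
      rintro rfl
      exact hne (Subsingleton.elim _ _)
    exact_mod_cast Nat.one_le_iff_ne_zero.2 this
  have e : M.gradF θ α₁ - M.gradF θ α₂ = (M.valGrad M.πE α₁ - M.valGrad M.πE α₂) -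
      (M.valGrad θ α₁ - M.valGrad θ α₂) - (gradient M.ψ α₁ - gradient M.ψ α₂) := by
    simp only [Model.gradF]
    abel
  rw [e]
  have h3 := h.norm_valGrad_sub_le M.πE h₁ h₂
  have h4 := h.norm_valGrad_sub_le θ h₁ h₂
  have h5 := h.ψ_lip α₁ h₁ α₂ h₂
  have h6 : 2 * (Lr / (1 - M.γ)) + Lψ ≤ L22 q M.γ Lr Lψ := by
    rw [L22]
    have : 2 * 1 * Lr / (1 - M.γ) ≤ 2 * √q * Lr / (1 - M.γ) := by gcongr
    have e2 : 2 * (Lr / (1 - M.γ)) = 2 * 1 * Lr / (1 - M.γ) := by ring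
    linarith
  calc _ ≤ ‖M.valGrad M.πE α₁ - M.valGrad M.πE α₂‖ + ‖M.valGrad θ α₁ - M.valGrad θ α₂‖ +
        ‖gradient M.ψ α₁ - gradient M.ψ α₂‖ :=
        (norm_sub_le _ _).trans (add_le_add (norm_sub_le _ _) le_rfl)
    _ ≤ (2 * (Lr / (1 - M.γ)) + Lψ) * ‖α₁ - α₂‖ := by linarith
    _ ≤ _ := by gcongr

theorem inner_gradF_sub_le (θ : Policy S A) {α₁ α₂ : EuclideanSpace ℝ (Fin q)} (h₁ : α₁ ∈ M.Λ)
    (h₂ : α₂ ∈ M.Λ) :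
    inner ℝ (M.gradF θ α₁ - M.gradF θ α₂) (α₁ - α₂) ≤ -(μ * ‖α₁ - α₂‖ ^ 2) := by
  have h3 := strongConcaveOn_le (h.F_concave θ) h₁ h₂ (h.hasGradientAt_F θ h₁)
  have h4 := strongConcaveOn_le (h.F_concave θ) h₂ h₁ (h.hasGradientAt_F θ h₂)
  rw [← neg_sub α₁ α₂, inner_neg_right, norm_neg] at h3
  rw [inner_sub_left]
  linarith

/-- Strong monotonicity of the gradient meets its Lipschitz bound. On a singleton neither bound says
anything, hence the two points. -/
theorem le_L22 (hne : ∃ α₁ ∈ M.Λ, ∃ α₂ ∈ M.Λ, α₁ ≠ α₂) : μ ≤ L22 q M.γ Lr Lψ := by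
  obtain ⟨α₁, h₁, α₂, h₂, hne⟩ := hne
  have hpos : 0 < ‖α₁ - α₂‖ := norm_pos_iff.2 (sub_ne_zero.2 hne)
  have h3 := h.inner_gradF_sub_le M.πE h₁ h₂
  have h4 := (abs_le.1 (abs_real_inner_le_norm (M.gradF M.πE α₁ - M.gradF M.πE α₂) (α₁ - α₂))).1
  have h5 := mul_le_mul_of_nonneg_right (h.norm_gradF_sub_le M.πE h₁ h₂) hpos.le
  have h6 : μ * ‖α₁ - α₂‖ ^ 2 ≤ L22 q M.γ Lr Lψ * ‖α₁ - α₂‖ ^ 2 := by nlinarith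
  exact le_of_mul_le_mul_right h6 (by positivity)

theorem exists_isMaxOn (θ : Policy S A) : ∃ α ∈ M.Λ, IsMaxOn (M.F θ) M.Λ α :=
  h.isCompact.exists_isMaxOn h.Λ_nonempty fun _ hα =>
    (h.hasGradientAt_F θ hα).continuousAt.continuousWithinAt

omit h in
/-- The maximizer of `F(θ, ·)` over `Λ`. -/
def _root_.GAIL.Model.best (M : Model S A q) (θ : Policy S A) : EuclideanSpace ℝ (Fin q) :=
  Classical.epsilon fun α => α ∈ M.Λ ∧ IsMaxOn (M.F θ) M.Λ α

theorem best_spec (θ : Policy S A) : M.best θ ∈ M.Λ ∧ IsMaxOn (M.F θ) M.Λ (M.best θ) :=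
  Classical.epsilon_spec (p := fun α => α ∈ M.Λ ∧ IsMaxOn (M.F θ) M.Λ α) (h.exists_isMaxOn θ)

theorem best_mem (θ : Policy S A) : M.best θ ∈ M.Λ := (h.best_spec θ).1

theorem F_le_best (θ : Policy S A) {α : EuclideanSpace ℝ (Fin q)} (hα : α ∈ M.Λ) :
    M.F θ α ≤ M.F θ (M.best θ) := (h.best_spec θ).2 hα

theorem g_eq (θ : Policy S A) : M.g θ = M.F θ (M.best θ) := by
  refine IsGreatest.csSup_eq ⟨⟨_, h.best_mem θ, rfl⟩, ?_⟩
  rintro _ ⟨α, hα, rfl⟩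
  exact h.F_le_best θ hα

theorem F_le_g (θ : Policy S A) {α : EuclideanSpace ℝ (Fin q)} (hα : α ∈ M.Λ) :
    M.F θ α ≤ M.g θ := h.g_eq θ ▸ h.F_le_best θ hα

theorem inner_gradF_best_le (θ : Policy S A) {α : EuclideanSpace ℝ (Fin q)} (hα : α ∈ M.Λ) :
    inner ℝ (M.gradF θ (M.best θ)) (α - M.best θ) ≤ 0 := by
  have h1 := (h.best_spec θ).2.localize.hasFDerivWithinAt_nonpos
    (h.hasGradientAt_F θ (h.best_mem θ)).hasFDerivAt.hasFDerivWithinAt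
    (y := α - M.best θ) (sub_mem_posTangentConeAt_of_segment_subset
      (h.convex.segment_subset (h.best_mem θ) hα))
  simpa using h1

/-- Quadratic growth at the maximizer, whose first-order term is nonpositive on `Λ`. It spares a
Lipschitz estimate for `θ ↦ M.best θ` in the descent inequality. -/
theorem F_le_sub (θ : Policy S A) {α : EuclideanSpace ℝ (Fin q)} (hα : α ∈ M.Λ) :
    M.F θ α ≤ M.g θ - μ / 2 * ‖α - M.best θ‖ ^ 2 := by
  have h1 := strongConcaveOn_le (h.F_concave θ) (h.best_mem θ) hα
    (h.hasGradientAt_F θ (h.best_mem θ))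
  have h2 := h.inner_gradF_best_le θ hα
  rw [h.g_eq]
  linarith

end Model.Assumptions

end Objective

/-! ### Geometry of the policy set. -/

section PolicySet

variable {S A : Type*} [Fintype S] [Fintype A]

theorem isClosed_policySet : IsClosed (policySet S A) := by
  have h1 : ∀ x : S × A, Continuous fun θ : EuclideanSpace ℝ (S × A) => θ x := fun x => by fun_prop
  have : policySet S A = (⋂ s, ⋂ a, {θ | 0 ≤ θ (s, a)}) ∩ ⋂ s, {θ | ∑ a, θ (s, a) = 1} := by
    ext θ
    simp [policySet]
  rw [this]
  refine (isClosed_iInter fun s => isClosed_iInter fun a => ?_).inter (isClosed_iInter fun s => ?_)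
  · exact isClosed_le continuous_const (h1 (s, a))
  · exact isClosed_eq (continuous_finsetSum _ fun a _ => h1 (s, a)) continuous_const

theorem convex_policySet : Convex ℝ (policySet S A) := by
  intro x hx y hy a b ha hb hab
  refine ⟨fun s i => ?_, fun s => ?_⟩
  · simp only [PiLp.add_apply, PiLp.smul_apply, smul_eq_mul]
    exact add_nonneg (mul_nonneg ha (hx.1 s i)) (mul_nonneg hb (hy.1 s i))
  · simp only [PiLp.add_apply, PiLp.smul_apply, smul_eq_mul, Finset.sum_add_distrib,
      ← Finset.mul_sum, hx.2, hy.2, mul_one, hab]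

theorem norm_policy_le (θ : Policy S A) : ‖θ.1‖ ≤ √(Fintype.card S) := by
  rw [EuclideanSpace.norm_eq]
  refine Real.sqrt_le_sqrt ?_
  rw [Fintype.sum_prod_type]
  calc ∑ s, ∑ a, ‖θ.1 (s, a)‖ ^ 2 ≤ ∑ s, ∑ a, θ.1 (s, a) := by
        gcongr with s _ a _
        have h0 := θ.2.1 s a
        have h1 : θ.1 (s, a) ≤ 1 := by
          rw [← θ.2.2 s]
          exact Finset.single_le_sum (fun a _ => θ.2.1 s a) (Finset.mem_univ a)
        rw [Real.norm_of_nonneg h0]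
        nlinarith
    _ = Fintype.card S := by simp [θ.2.2]

theorem norm_policy_sub_le (θ θ' : Policy S A) : ‖θ.1 - θ'.1‖ ≤ 2 * √(Fintype.card S) :=
  (norm_sub_le _ _).trans (by linarith [norm_policy_le θ, norm_policy_le θ'])

end PolicySet

/-! ### One step of the policy and of the reward update. -/

section OneStep

variable {S A : Type*} [Fintype S] [Fintype A] {q : ℕ} {M : Model S A q}
  {Cα Cr Lr Lψ μ CM ρ ζ₀ : ℝ}

/-- Positive `X` is at most the geometric mean of the two bounds, and Young's inequality follows. In
this way the product `L12 * L21`, and not a square, enters the stepsize. -/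
theorem le_of_two_bounds {X K δ n D₁ D₂ μ : ℝ} (hμ : 0 < μ) (hD₁ : 0 ≤ D₁) (hD₂ : 0 ≤ D₂) (h₁ : X ≤ D₁ * δ * n) (h₂ : X ≤ D₂ * δ * n)
    (hK : D₁ * D₂ ≤ 2 * K) : X ≤ μ / 2 * δ ^ 2 + K / μ * n ^ 2 := by
  have hK0 : 0 ≤ K := by nlinarith [mul_nonneg hD₁ hD₂]
  have hR : 0 ≤ μ / 2 * δ ^ 2 + K / μ * n ^ 2 := by positivity
  rcases le_or_gt X 0 with hX | hX
  · exact hX.trans hR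
  · refine le_of_sq_le_sq ?_ hR
    have e : (μ / 2 * δ ^ 2 + K / μ * n ^ 2) ^ 2 =
        (μ / 2 * δ ^ 2 - K / μ * n ^ 2) ^ 2 + 2 * K * (δ * n) ^ 2 := by
      field_simp
      ring
    have h3 : X ^ 2 ≤ D₁ * D₂ * (δ * n) ^ 2 := by
      calc X ^ 2 = X * X := sq X
        _ ≤ (D₁ * δ * n) * (D₂ * δ * n) := mul_le_mul h₁ h₂ hX.le (hX.le.trans h₁)
        _ = _ := by ring
    rw [e]
    nlinarith [mul_le_mul_of_nonneg_right hK (sq_nonneg (δ * n)),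
      sq_nonneg (μ / 2 * δ ^ 2 - K / μ * n ^ 2)]

/-- Convexity of the square at `d` and `β * ν / a`, with weights `1 - a` and `a`. -/
theorem error_sq_le {a β d ν : ℝ} (ha : 0 < a) (ha1 : a ≤ 1) :
    ((1 - a) * d + β * ν) ^ 2 ≤ (1 - a) * d ^ 2 + β ^ 2 / a * ν ^ 2 := by
  have h : (1 - a) * d ^ 2 + β ^ 2 / a * ν ^ 2 - ((1 - a) * d + β * ν) ^ 2 =
      (1 - a) / a * (a * d - β * ν) ^ 2 := by
    field_simp
    ring
  have : 0 ≤ (1 - a) / a * (a * d - β * ν) ^ 2 :=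
    mul_nonneg (div_nonneg (sub_nonneg.2 ha1) ha.le) (sq_nonneg _)
  linarith

namespace Model.Assumptions

variable (h : M.Assumptions Cα Cr Lr Lψ μ CM ρ ζ₀)
include h

theorem oscBound (hCM : 1 ≤ CM) (hρ₀ : 0 < ρ) (hρ₁ : ρ < 1) :
    M.OscBound (2 * mixConst CM ρ - 3) := M.oscBound hCM hρ₀ hρ₁ h.ergodic

theorem abs_inner_polGrad_sub_le (hCM : 1 ≤ CM) (hρ₀ : 0 < ρ) (hρ₁ : ρ < 1)
    (θ π π' : Policy S A) {α₁ α₂ : EuclideanSpace ℝ (Fin q)} (h₁ : α₁ ∈ M.Λ) (h₂ : α₂ ∈ M.Λ) :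
    |inner ℝ (M.polGrad θ (M.r α₁) - M.polGrad θ (M.r α₂)) (π'.1 - π.1)| ≤
      2 * (1 - 1 / mixConst CM ρ) * L21 (Fintype.card A) M.γ Cr CM ρ * ‖α₁ - α₂‖ *
        ‖π'.1 - π.1‖ := by
  have hm := two_le_mixConst hCM hρ₀ hρ₁
  rw [M.polGrad_sub]
  refine ((h.oscBound hCM hρ₀ hρ₁).abs_inner_polGrad_le (by linarith) θ π π'
    (fun s a => h.abs_r_sub_le h₁ h₂ s a) (mul_nonneg h.Cr_nonneg (norm_nonneg _))).trans
      (le_of_eq ?_)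
  rw [L21]
  have := M.one_sub_pos
  field_simp
  ring

/-- The marginal maximum satisfies the descent inequality with a constant that is smaller than
the inverse stepsize. -/
theorem g_le (hμ : 0 < μ) (hCM : 1 ≤ CM) (hρ₀ : 0 < ρ) (hρ₁ : ρ < 1) (θ θ' : Policy S A) :
    M.g θ' ≤ M.g θ + inner ℝ (M.polGrad θ (M.r (M.best θ))) (θ'.1 - θ.1) +
      (1 - 1 / mixConst CM ρ) * (L11 (Fintype.card A) M.γ Cα Cr CM ρ +
        L12 (Fintype.card A) M.γ Cr * L21 (Fintype.card A) M.γ Cr CM ρ / μ) *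
          ‖θ'.1 - θ.1‖ ^ 2 := by
  have hm := two_le_mixConst hCM hρ₀ hρ₁
  have h0 := M.one_sub_pos
  have hCr := h.Cr_nonneg
  have hCα := h.Cα_nonneg
  have hα := h.best_mem θ
  have hα' := h.best_mem θ'
  -- The reward is frozen at the maximizer of the new policy. There `F(θ, ·)` lies below `g θ` by
  -- `μ/2` times the squared motion of the maximizer, which absorbs the change of the gradient
  -- between the two rewards.
  have e1 : M.g θ' = M.F θ (M.best θ') - (M.V θ' (M.r (M.best θ')) - M.V θ (M.r (M.best θ'))) := by
    rw [h.g_eq, Model.F, Model.F]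
    ring
  have h1 := h.F_le_sub θ hα'
  have h2 := (abs_le.1 ((h.oscBound hCM hρ₀ hρ₁).abs_V_sub_le θ θ' (h.r_bound _ hα'))).1
  have h3 : (inner ℝ (M.polGrad θ (M.r (M.best θ'))) (θ'.1 - θ.1) : ℝ) =
      inner ℝ (M.polGrad θ (M.r (M.best θ))) (θ'.1 - θ.1) +
        inner ℝ (M.polGrad θ (M.r (M.best θ')) - M.polGrad θ (M.r (M.best θ))) (θ'.1 - θ.1) := by
    rw [← inner_add_left, add_sub_cancel]
  have h4 := (abs_le.1 (h.abs_inner_polGrad_sub_le hCM hρ₀ hρ₁ θ θ θ' hα' hα)).2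
  have h5 : (inner ℝ (M.polGrad θ (M.r (M.best θ')) - M.polGrad θ (M.r (M.best θ)))
      (θ'.1 - θ.1) : ℝ) ≤ L12 (Fintype.card A) M.γ Cr * ‖M.best θ' - M.best θ‖ * ‖θ'.1 - θ.1‖ := by
    rw [M.polGrad_sub]
    refine (abs_le.1 (M.abs_inner_polGrad_le θ θ θ'
      (fun s a => h.abs_r_sub_le hα' hα s a))).2.trans (le_of_eq ?_)
    rw [L12]
    ring
  have hD₂ : 0 ≤ 2 * (1 - 1 / mixConst CM ρ) * L21 (Fintype.card A) M.γ Cr CM ρ := by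
    have h7 : 1 / mixConst CM ρ ≤ 1 := by
      rw [div_le_one (by linarith)]
      linarith
    have h8 : 0 ≤ 1 - 1 / mixConst CM ρ := sub_nonneg.2 h7
    rw [L21]
    positivity
  have h6 := le_of_two_bounds (K := (1 - 1 / mixConst CM ρ) * (L12 (Fintype.card A) M.γ Cr *
    L21 (Fintype.card A) M.γ Cr CM ρ)) hμ (by rw [L12]; positivity) hD₂ h5 h4 (le_of_eq (by ring))
  -- `L11` has room for the factor `1 - 1/m`, since `2m - 3 ≤ √2 (2m - 2)`.
  have h7 : Fintype.card A * (Cr * Cα) * (2 * mixConst CM ρ - 3) / (1 - M.γ) ^ 2 ≤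
      (1 - 1 / mixConst CM ρ) * L11 (Fintype.card A) M.γ Cα Cr CM ρ := by
    have hs : 1 ≤ √2 := by
      rw [Real.one_le_sqrt]
      norm_num
    have e : (1 - 1 / mixConst CM ρ) * L11 (Fintype.card A) M.γ Cα Cr CM ρ =
        Fintype.card A * (Cr * Cα) * (√2 * (2 * mixConst CM ρ - 2)) / (1 - M.γ) ^ 2 := by
      rw [L11]
      field_simp
    rw [e]
    gcongr
    nlinarith
  have h8 := mul_le_mul_of_nonneg_right h7 (sq_nonneg ‖θ'.1 - θ.1‖)
  have e2 : (1 - 1 / mixConst CM ρ) * (L12 (Fintype.card A) M.γ Cr *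
    L21 (Fintype.card A) M.γ Cr CM ρ) / μ = (1 - 1 / mixConst CM ρ) * (L12 (Fintype.card A) M.γ Cr *
    L21 (Fintype.card A) M.γ Cr CM ρ / μ) := by ring
  rw [e2] at h6
  rw [e1, mul_add, add_mul]
  linarith

/-- Gradient dominance of the marginal maximum. -/
theorem g_sub_le (hζ₀ : 0 < ζ₀) (θ θs : Policy S A) :
    ∃ θb : Policy S A, M.g θ - M.g θs ≤ 1 / ((1 - M.γ) * ζ₀) *
      inner ℝ (M.polGrad θ (M.r (M.best θ))) (θ.1 - θb.1) := by
  obtain ⟨θb, hθb⟩ := M.exists_V_sub_le hζ₀ h.ζ_min θ θs (M.r (M.best θ))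
  refine ⟨θb, hθb.trans' ?_⟩
  -- With `g θs` tested at the maximizer of `θ`, the expert and regularizer terms cancel and a
  -- difference of values remains.
  have h1 := h.F_le_g θs (h.best_mem θ)
  rw [h.g_eq θ]
  rw [Model.F] at h1 ⊢
  linarith

theorem abs_g_sub_le (θ θ' : Policy S A) : |M.g θ - M.g θ'| ≤ 2 * (Cr * Cα) / (1 - M.γ) := by
  have key : ∀ θ θ' : Policy S A, M.g θ - M.g θ' ≤ 2 * (Cr * Cα) / (1 - M.γ) := fun θ θ' => by
    have h1 := h.F_le_g θ' (h.best_mem θ)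
    have hV : ∀ π : Policy S A, |M.V π (M.r (M.best θ))| ≤ Cr * Cα / (1 - M.γ) := fun π => by
      rw [M.V_eq]
      exact M.abs_init_le (M.abs_res_le π (abs_avg_le π (h.r_bound _ (h.best_mem θ))))
    have h2 := abs_le.1 (hV θ)
    have h3 := abs_le.1 (hV θ')
    have e : 2 * (Cr * Cα) / (1 - M.γ) = Cr * Cα / (1 - M.γ) + Cr * Cα / (1 - M.γ) := by ring
    rw [h.g_eq θ, e]
    rw [Model.F] at h1 ⊢
    linarith
  exact abs_le.2 ⟨by linarith [key θ' θ], key θ θ'⟩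

/-- The progress made by one step of projected gradient descent with an inexact gradient `v`. -/
theorem gap_le (hμ : 0 < μ) (hCM : 1 ≤ CM) (hρ₀ : 0 < ρ) (hρ₁ : ρ < 1) (hζ₀ : 0 < ζ₀) {L : ℝ}
    (hL : L = L11 (Fintype.card A) M.γ Cα Cr CM ρ +
      L12 (Fintype.card A) M.γ Cr * L21 (Fintype.card A) M.γ Cr CM ρ / μ) (hL0 : 0 < L)
    (θ θ' θs : Policy S A) (v : EuclideanSpace ℝ (S × A))
    (hθ' : ∀ z ∈ policySet S A, inner ℝ (θ.1 - L⁻¹ • v - θ'.1) (z - θ'.1) ≤ 0)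
    {α : EuclideanSpace ℝ (Fin q)} (hα : α ∈ M.Λ) {τ : ℝ} (hτ : 0 < τ) {e : ℝ}
    (he : e = ‖v - M.polGrad θ (M.r α)‖ + 2 * L21 (Fintype.card A) M.γ Cr CM ρ * ‖α - M.best θ‖) :
    M.g θ - M.g θs ≤ (1 + 2 * √(Fintype.card S)) / ((1 - M.γ) * ζ₀) *
      (τ + 1 / τ * (mixConst CM ρ * L * (M.g θ - M.g θ') + mixConst CM ρ ^ 2 * e ^ 2)) := by
  have hm := two_le_mixConst hCM hρ₀ hρ₁
  have h0 := M.one_sub_pos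
  have hCr := h.Cr_nonneg
  have hCα := h.Cα_nonneg
  have hL21 : 0 ≤ L21 (Fintype.card A) M.γ Cr CM ρ := by rw [L21]; positivity
  have hL12 : 0 ≤ L12 (Fintype.card A) M.γ Cr := by rw [L12]; positivity
  have he0 : 0 ≤ e := by rw [he]; positivity
  set m := mixConst CM ρ with hmdef
  set D := 2 * √(Fintype.card S : ℝ) with hD
  set G := M.polGrad θ (M.r (M.best θ)) with hG
  set n := ‖θ'.1 - θ.1‖ with hn
  have hn0 : 0 ≤ n := norm_nonneg _
  have hD0 : 0 ≤ D := by positivity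
  -- The error is tested only along differences of policies, where the oscillation bound applies;
  -- the norm estimate for `polGrad` would cost another `(1 - γ)⁻¹`.
  have herr : ∀ π π' : Policy S A, |(inner ℝ (v - G) (π'.1 - π.1) : ℝ)| ≤ e * ‖π'.1 - π.1‖ := by
    intro π π'
    have h1 := abs_real_inner_le_norm (v - M.polGrad θ (M.r α)) (π'.1 - π.1)
    have h2 := h.abs_inner_polGrad_sub_le hCM hρ₀ hρ₁ θ π π' hα (h.best_mem θ)
    have h3 : (inner ℝ (v - G) (π'.1 - π.1) : ℝ) =
        inner ℝ (v - M.polGrad θ (M.r α)) (π'.1 - π.1) +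
          inner ℝ (M.polGrad θ (M.r α) - G) (π'.1 - π.1) := by
      rw [← inner_add_left, sub_add_sub_cancel]
    have h4 : 2 * (1 - 1 / m) * L21 (Fintype.card A) M.γ Cr CM ρ * ‖α - M.best θ‖ *
        ‖π'.1 - π.1‖ ≤ 2 * 1 * L21 (Fintype.card A) M.γ Cr CM ρ * ‖α - M.best θ‖ *
        ‖π'.1 - π.1‖ := by
      gcongr
      have : 0 ≤ 1 / m := by positivity
      linarith
    rw [h3, he]
    refine (abs_add_le _ _).trans ?_
    linarith
  have hproj : ∀ z : Policy S A, inner ℝ v (θ'.1 - z.1) ≤ L * inner ℝ (θ.1 - θ'.1) (θ'.1 - z.1) := by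
    intro z
    have h1 := hθ' z.1 z.2
    have e1 : (inner ℝ (θ.1 - L⁻¹ • v - θ'.1) (z.1 - θ'.1) : ℝ) =
        L⁻¹ * inner ℝ v (θ'.1 - z.1) - inner ℝ (θ.1 - θ'.1) (θ'.1 - z.1) := by
      rw [← neg_sub θ'.1 z.1, inner_neg_right, sub_right_comm, inner_sub_left (θ.1 - θ'.1),
        real_inner_smul_left]
      ring
    rw [e1] at h1
    have h2 := mul_le_mul_of_nonneg_left h1 hL0.le
    rw [mul_sub, mul_inv_cancel_left₀ hL0.ne', mul_zero] at h2
    linarith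
  -- The projection yields `-L n²` and the quadratic model gives back `(1 - 1/m) L n²`, so a
  -- decrease `L n² / m` survives. The error `e n` is absorbed by a square after multiplication by
  -- `2mL`.
  have hdesc : L ^ 2 * n ^ 2 ≤ 2 * m * L * (M.g θ - M.g θ') + m ^ 2 * e ^ 2 := by
    have h1 := h.g_le hμ hCM hρ₀ hρ₁ θ θ'
    rw [← hL, ← hmdef, ← hG, ← hn] at h1
    have h2 := hproj θ
    rw [← neg_sub θ'.1 θ.1, inner_neg_left, real_inner_self_eq_norm_sq, ← hn] at h2
    have h3 := (abs_le.1 (herr θ θ')).1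
    rw [inner_sub_left, ← hn] at h3
    have h4 : L / m * n ^ 2 ≤ M.g θ - M.g θ' + e * n := by
      have : (1 - 1 / m) * L * n ^ 2 = L * n ^ 2 - L / m * n ^ 2 := by ring
      linarith
    have h5 := mul_le_mul_of_nonneg_left h4 (show 0 ≤ 2 * m * L by positivity)
    have h6 : 2 * m * L * (L / m * n ^ 2) = 2 * (L ^ 2 * n ^ 2) := by field_simp
    nlinarith [sq_nonneg (L * n - m * e)]
  have hgap : M.g θ - M.g θs ≤ (1 + D) / ((1 - M.γ) * ζ₀) * (L * n + e) := by
    obtain ⟨θb, hθb⟩ := h.g_sub_le hζ₀ θ θs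
    refine hθb.trans ?_
    -- The three pieces are controlled by `‖G‖ ≤ L`, by the projection inequality, and by the
    -- gradient error times the diameter of the policy set.
    have h1 : (inner ℝ G (θ.1 - θb.1) : ℝ) = inner ℝ G (θ.1 - θ'.1) +
        inner ℝ v (θ'.1 - θb.1) - inner ℝ (v - G) (θ'.1 - θb.1) := by
      rw [inner_sub_left, ← sub_add_sub_cancel θ.1 θ'.1 θb.1,
        inner_add_right]
      ring
    have hGL : ‖G‖ ≤ L := by
      refine (M.norm_polGrad_le θ (h.r_bound _ (h.best_mem θ)) (by positivity)).trans ?_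
      have h2 : L11 (Fintype.card A) M.γ Cα Cr CM ρ ≤ L := by
        rw [hL]
        exact le_add_of_nonneg_right (by positivity)
      refine le_trans ?_ h2
      rw [L11, ← hmdef]
      have hs : 1 ≤ √2 := by
        rw [Real.one_le_sqrt]
        norm_num
      have hA : √(Fintype.card A : ℝ) ≤ Fintype.card A := by
        rw [Real.sqrt_le_left (Nat.cast_nonneg _)]
        exact_mod_cast Nat.le_self_pow two_ne_zero _
      calc √(Fintype.card A) * (Cr * Cα) / (1 - M.γ) ^ 2
          ≤ 1 * 1 * Fintype.card A * (Cr * Cα) / (1 - M.γ) ^ 2 * 1 := by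
            rw [mul_one, one_mul, one_mul]
            gcongr
        _ ≤ 2 * √2 * Fintype.card A * (Cr * Cα) / (1 - M.γ) ^ 2 * m := by
            gcongr <;> linarith
        _ = _ := by ring
    have h2 : (inner ℝ G (θ.1 - θ'.1) : ℝ) ≤ L * n := by
      refine (real_inner_le_norm _ _).trans ?_
      rw [norm_sub_rev]
      gcongr
    have h3 : (inner ℝ v (θ'.1 - θb.1) : ℝ) ≤ L * (n * D) := by
      refine (hproj θb).trans ?_
      gcongr
      refine (real_inner_le_norm _ _).trans ?_
      rw [norm_sub_rev]
      gcongr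
      exact norm_policy_sub_le _ _
    have h4 : -(inner ℝ (v - G) (θ'.1 - θb.1) : ℝ) ≤ e * D := by
      have h5 := (abs_le.1 (herr θb θ')).1
      have h6 := mul_le_mul_of_nonneg_left (norm_policy_sub_le θ' θb) he0
      rw [← hD] at h6
      linarith
    have h5 : (inner ℝ G (θ.1 - θb.1) : ℝ) ≤ (1 + D) * (L * n + e) := by
      rw [h1]
      nlinarith
    calc _ ≤ 1 / ((1 - M.γ) * ζ₀) * ((1 + D) * (L * n + e)) := by gcongr
      _ = _ := by ring
  refine hgap.trans (mul_le_mul_of_nonneg_left ?_ (by positivity))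
  -- This is `x ≤ (τ² + x²) / (2τ)` for `x = L n` and `x = e`, written as an identity. It trades
  -- first powers for squares, which makes the final bound affine in `g` and `e ^ 2`.
  have h1 : τ + 1 / τ * (m * L * (M.g θ - M.g θ') + m ^ 2 * e ^ 2) - (L * n + e) =
      1 / (2 * τ) * ((τ - L * n) ^ 2 + (τ - e) ^ 2 + (2 * m * L * (M.g θ - M.g θ') +
        m ^ 2 * e ^ 2 - L ^ 2 * n ^ 2) + (m ^ 2 - 1) * e ^ 2) := by
    field_simp
    ring
  have h2 : 0 ≤ (m ^ 2 - 1) * e ^ 2 := mul_nonneg (by nlinarith) (sq_nonneg _)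
  have h3 : 0 ≤ 1 / (2 * τ) * ((τ - L * n) ^ 2 + (τ - e) ^ 2 + (2 * m * L * (M.g θ - M.g θ') +
        m ^ 2 * e ^ 2 - L ^ 2 * n ^ 2) + (m ^ 2 - 1) * e ^ 2) := by
    refine mul_nonneg (by positivity) ?_
    have := sq_nonneg (τ - L * n)
    have := sq_nonneg (τ - e)
    linarith
  linarith

/-- One step of projected gradient ascent with an inexact gradient in the reward parameter. -/
theorem reward_step_le (hμ : 0 < μ) (hL : μ ≤ L22 q M.γ Lr Lψ) (θ : Policy S A) {L a β : ℝ}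
    (hLd : L = L22 q M.γ Lr Lψ) (ha : a = 7 / 32 * μ ^ 2 / L ^ 2) (hβ : β = μ / (4 * L ^ 2))
    (α : M.Λ) (v : EuclideanSpace ℝ (Fin q)) :
    ‖((proj ⟨α⟩ ((α : EuclideanSpace ℝ (Fin q)) + β • v) : M.Λ) : EuclideanSpace ℝ (Fin q)) -
      M.best θ‖ ^ 2 ≤ (1 - a) * ‖(α : EuclideanSpace ℝ (Fin q)) - M.best θ‖ ^ 2 +
        a * (64 / (49 * μ ^ 2) * ‖v - M.gradF θ α‖ ^ 2) := by
  rw [← hLd] at hL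
  have hL0 : 0 < L := hμ.trans_le hL
  have hx : μ ^ 2 / L ^ 2 ≤ 1 := by
    rw [div_le_one (by positivity)]
    gcongr
  have hx0 : 0 < μ ^ 2 / L ^ 2 := by positivity
  have ha0 : 0 < a := by rw [ha]; positivity
  have ha1 : a ≤ 1 := by
    rw [ha, mul_div_assoc]
    linarith
  have hβ0 : 0 < β := by rw [hβ]; positivity
  set d := ‖(α : EuclideanSpace ℝ (Fin q)) - M.best θ‖ with hd
  have hd0 : 0 ≤ d := norm_nonneg _
  set p := ((proj ⟨α⟩ ((α : EuclideanSpace ℝ (Fin q)) + β • v) : M.Λ) : EuclideanSpace ℝ (Fin q))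
    with hp
  -- The maximizer is a fixed point of the exact projected ascent step, so the unprojected points
  -- may be compared.
  have h1 : ‖p - M.best θ‖ ≤ ‖((α : EuclideanSpace ℝ (Fin q)) + β • v) -
      (M.best θ + β • M.gradF θ (M.best θ))‖ := by
    refine norm_sub_le_of_inner_le (inner_proj_le ⟨α⟩ h.Λ_closed h.convex _ _ (h.best_mem θ)) ?_
    rw [add_sub_cancel_left, real_inner_smul_left]
    exact mul_nonpos_of_nonneg_of_nonpos hβ0.le
      (h.inner_gradF_best_le θ (proj ⟨α⟩ ((α : EuclideanSpace ℝ (Fin q)) + β • v)).2)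
  -- The value of `a` makes `βμ = 8a/7` and `β²L² = 2a/7`, so that `1 - 2βμ + β²L² = 1 - 2a ≤ (1 -
  -- a)²`.
  have h2 : ‖((α : EuclideanSpace ℝ (Fin q)) - M.best θ) +
      β • (M.gradF θ α - M.gradF θ (M.best θ))‖ ≤ (1 - a) * d := by
    refine le_of_sq_le_sq ?_ (mul_nonneg (sub_nonneg.2 ha1) hd0)
    have h3 := h.inner_gradF_sub_le θ α.2 (h.best_mem θ)
    have h4 := h.norm_gradF_sub_le θ α.2 (h.best_mem θ)
    rw [← hLd, ← hd] at h4
    rw [← hd, real_inner_comm] at h3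
    have h5 : ‖M.gradF θ α - M.gradF θ (M.best θ)‖ ^ 2 ≤ L ^ 2 * d ^ 2 := by
      rw [← mul_pow]
      gcongr
    rw [norm_add_sq_real, norm_smul, Real.norm_of_nonneg hβ0.le, mul_pow, real_inner_smul_right,
      ← hd]
    have h6 : β ^ 2 * ‖M.gradF θ α - M.gradF θ (M.best θ)‖ ^ 2 ≤ β ^ 2 * (L ^ 2 * d ^ 2) := by
      gcongr
    have h7 := mul_le_mul_of_nonneg_left h3 hβ0.le
    have h8 : β * μ = 8 / 7 * a := by
      rw [hβ, ha]
      field_simp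
      norm_num
    have h9 : β ^ 2 * L ^ 2 = 2 / 7 * a := by
      rw [hβ, ha]
      field_simp
      norm_num
    have h10 : β ^ 2 * (L ^ 2 * d ^ 2) = 2 / 7 * a * d ^ 2 := by rw [← h9]; ring
    have h11 : β * -(μ * d ^ 2) = -(8 / 7 * a * d ^ 2) := by rw [← h8]; ring
    nlinarith [sq_nonneg (a * d)]
  have h3 : ‖p - M.best θ‖ ≤ (1 - a) * d + β * ‖v - M.gradF θ α‖ := by
    have e1 : ((α : EuclideanSpace ℝ (Fin q)) + β • v) -
        (M.best θ + β • M.gradF θ (M.best θ)) = (((α : EuclideanSpace ℝ (Fin q)) - M.best θ) +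
      β • (M.gradF θ α - M.gradF θ (M.best θ))) + β • (v - M.gradF θ α) := by
      simp only [smul_sub]
      abel
    rw [e1] at h1
    refine h1.trans ((norm_add_le _ _).trans (add_le_add h2 ?_))
    rw [norm_smul, Real.norm_of_nonneg hβ0.le]
  have h4 : ‖p - M.best θ‖ ^ 2 ≤ ((1 - a) * d + β * ‖v - M.gradF θ α‖) ^ 2 := by gcongr
  have h5 : β ^ 2 / a = a * (64 / (49 * μ ^ 2)) := by
    rw [hβ, ha]
    field_simp
    norm_num
  refine h4.trans ((error_sq_le ha0 ha1).trans (le_of_eq ?_))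
  rw [h5]
  ring

end Model.Assumptions

end OneStep

/-! ### Batch means along one Markov trajectory. -/

section Batch

variable {S A : Type*} [Fintype S] [Fintype A] {q : ℕ} (M : Model S A q)

/-- The cross term `2 * y * ξ` has mean zero. The square is first bounded by an expression affine in
`ξ`, which is bounded on the support, so a real expectation may be used. The constant `c` holds the
variance of later steps. -/
theorem lexp_sq_add_le {X : Type*} (p : PMF X) {ξ : X → ℝ} {H c : ℝ} (y : ℝ) (hc : 0 ≤ c)
    (hξ : ∀ x ∈ p.support, |ξ x| ≤ H) (h0 : expect p ξ = 0) :
    lexp p (fun x => (y + ξ x) ^ 2 + c) ≤ ENNReal.ofReal (y ^ 2 + H ^ 2 + c) := by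
  have h1 : ∀ x ∈ p.support, |(y ^ 2 + H ^ 2 + c) + 2 * y * ξ x| ≤
      |y ^ 2 + H ^ 2 + c| + |2 * y| * H := fun x hx => by
    refine (abs_add_le _ _).trans ?_
    rw [abs_mul (2 * y)]
    gcongr
    exact hξ x hx
  have h2 : ∀ x ∈ p.support, (y + ξ x) ^ 2 + c ≤ (y ^ 2 + H ^ 2 + c) + 2 * y * ξ x :=
    fun x hx => by nlinarith [sq_le_sq' (abs_le.1 (hξ x hx)).1 (abs_le.1 (hξ x hx)).2]
  have h3 : ∀ x, 0 ≤ (y + ξ x) ^ 2 + c := fun x => by positivity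
  refine (lexp_mono p h2).trans ?_
  rw [lexp_eq p h1 fun x hx => (h3 x).trans (h2 x hx),
    expect_add p (D := |2 * y| * H) (fun _ _ => le_refl |y ^ 2 + H ^ 2 + c|) fun x hx => by
      rw [abs_mul (2 * y)]
      gcongr
      exact hξ x hx]
  rw [expect_const, expect_const_mul, h0, mul_zero, add_zero]

/-- The sum of the increments along `n` steps of a chain that produces an increment at each step,
jointly with the final state. -/
def batch {X : Type*} [AddCommMonoid X] (k : S → PMF (X × S)) : ℕ → S → PMF (X × S)
  | 0, s => PMF.pure (0, s)
  | n + 1, s => (k s).bind fun z => (batch k n z.2).map fun x => (z.1 + x.1, x.2)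

-- Orthogonality of martingale differences: the corrected increments have conditional mean zero. The
-- offset `y` stands for the past and has to vary in the induction.
omit [Fintype S] in
theorem lexp_batch_le {X : Type*} [AddCommMonoid X] (k : S → PMF (X × S)) (φ : X →+ ℝ) (c : ℝ)
    (u : S → ℝ) {H : ℝ}
    (hH : ∀ s, ∀ z ∈ (k s).support, |φ z.1 - c + (u z.2 - u s)| ≤ H)
    (h0 : ∀ s, expect (k s) (fun z => φ z.1 - c + (u z.2 - u s)) = 0) (n : ℕ) (s : S) (y : ℝ) :
    lexp (batch k n s) (fun x => (y + (φ x.1 - n * c + (u x.2 - u s))) ^ 2) ≤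
      ENNReal.ofReal (y ^ 2 + n * H ^ 2) := by
  induction n generalizing s y with
  | zero => simp [batch, lexp_pure]
  | succ n ih =>
    rw [batch]
    refine (lexp_bind_le (c := fun z => (y + (φ z.1 - c + (u z.2 - u s))) ^ 2 + n * H ^ 2)
      _ _ fun z _ => ?_).trans ?_
    · rw [lexp_map]
      refine le_trans (le_of_eq ?_) (ih z.2 (y + (φ z.1 - c + (u z.2 - u s))))
      congr 1
      funext x
      rw [map_add]
      push_cast
      ring
    · refine (lexp_sq_add_le (k s) y (by positivity) (hH s) (h0 s)).trans (le_of_eq ?_)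
      push_cast
      ring_nf

-- Poisson's equation: `u = M.res π f` satisfies `u = f + γ P_π u`, and the restarted operator sends
-- `u` to `γ P_π u + c` with `c = (1 - γ) * M.init u`. So `φ - c + u(next) - u` has conditional mean
-- zero, from every state and with no stationarity.
variable {M} in
theorem Model.OscBound.lexp_batch_le {κ : ℝ} (hκ : M.OscBound κ) (hκ0 : 0 ≤ κ) (π : Policy S A)
    {X : Type*} [AddCommMonoid X] (k : S → PMF (X × S)) (φ : X →+ ℝ) (f : S → ℝ) {h : ℝ}
    (hk : ∀ s, ∀ z ∈ (k s).support, |φ z.1| ≤ h)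
    (hf : ∀ s, expect (k s) (fun z => φ z.1) = f s)
    (hP : ∀ s (w : S → ℝ), expect (k s) (fun z => w z.2) = stepOp M.restart π w s)
    (n : ℕ) (hn : 1 ≤ n) (s : S) :
    lexp (batch k n s) (fun x => (φ x.1 - n * ((1 - M.γ) * M.init (M.res π f))) ^ 2) ≤
      ENNReal.ofReal (16 * (1 + κ) ^ 2 * n * h ^ 2) := by
  have h0 := M.one_sub_pos
  have hfb : ∀ s, |f s| ≤ h := fun s => hf s ▸ abs_expect_le _ (hk s)
  have hh : 0 ≤ h := (abs_nonneg _).trans (hfb s)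
  set u := M.res π f with hu
  set c := (1 - M.γ) * M.init u with hc
  have hcb : |c| ≤ h := by
    rw [hc, abs_mul, abs_of_pos h0]
    calc (1 - M.γ) * |M.init u| ≤ (1 - M.γ) * (h / (1 - M.γ)) := by
          gcongr
          exact M.abs_init_le (M.abs_res_le π hfb)
      _ = h := by field_simp
  have hosc : ∀ s s', u s - u s' ≤ κ * (2 * h) := hκ π f _ fun s s' => by
    have h1 := abs_le.1 (hfb s)
    have h2 := abs_le.1 (hfb s')
    linarith
  have hosc' : ∀ s s', |u s - u s'| ≤ 2 * h * κ := fun s s' =>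
    abs_le.2 ⟨by linarith [hosc s' s], by linarith [hosc s s']⟩
  have hH : ∀ s, ∀ z ∈ (k s).support, |φ z.1 - c + (u z.2 - u s)| ≤ 2 * h * (1 + κ) := by
    intro s z hz
    have h1 := abs_le.1 (hk s z hz)
    have h2 := abs_le.1 hcb
    have h3 := abs_le.1 (hosc' z.2 s)
    exact abs_le.2 ⟨by linarith, by linarith⟩
  have hmean : ∀ s, expect (k s) (fun z => φ z.1 - c + (u z.2 - u s)) = 0 := by
    intro s
    rw [expect_add (f := fun z : X × S => φ z.1 - c)
        (g := fun z => u z.2 - u s) (C := h + |c|)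
        (D := 2 * h * κ),
      expect_sub (f := fun z : X × S => φ z.1) (g := fun _ => c) (C := h) (D := |c|),
      expect_sub (f := fun z : X × S => u z.2) (g := fun _ => u s) (C := |u s| + 2 * h * κ) (D := |u s|),
      hf, hP, expect_const, expect_const, M.stepOp_restart]
    · have := M.res_eq π f s
      rw [← hu] at this
      linarith
    · intro z _
      have := hosc' z.2 s
      calc |u z.2| = |u s + (u z.2 - u s)| := by ring_nf
        _ ≤ _ := (abs_add_le _ _).trans (by gcongr)
    · exact fun _ _ => le_rfl
    · exact hk s
    · exact fun _ _ => le_rfl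
    · exact fun z hz => (abs_sub _ _).trans (by gcongr; exact hk s z hz)
    · exact fun z _ => hosc' _ _
  have h1 := GAIL.lexp_batch_le k φ c u hH hmean n s 0
  -- The boundary term `u x.2 - u s` is split off. Its size does not depend on `n`, and `1 ≤ n`
  -- absorbs it in the constant.
  calc _ ≤ lexp (batch k n s) (fun x => 2 * (0 + (φ x.1 - n * c + (u x.2 - u s))) ^ 2 +
          2 * (2 * h * κ) ^ 2) := by
        refine lexp_mono _ fun x _ => ?_
        have h2 := sq_le_sq' (abs_le.1 (hosc' x.2 s)).1 (abs_le.1 (hosc' x.2 s)).2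
        nlinarith [sq_nonneg (φ x.1 - n * c + 2 * (u x.2 - u s))]
    _ ≤ ENNReal.ofReal 2 * ENNReal.ofReal (0 ^ 2 + n * (2 * h * (1 + κ)) ^ 2) +
          ENNReal.ofReal (2 * (2 * h * κ) ^ 2) := by
        refine (lexp_add_le _ _ _).trans ?_
        rw [lexp_const, lexp_const_mul _ zero_le_two]
        gcongr
    _ ≤ _ := by
        rw [← ENNReal.ofReal_mul zero_le_two, ← ENNReal.ofReal_add (by positivity) (by positivity)]
        refine ENNReal.ofReal_le_ofReal ?_
        have hn' : (1 : ℝ) ≤ n := by exact_mod_cast hn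
        have h3 : κ ^ 2 ≤ n * (1 + κ) ^ 2 := by nlinarith [sq_nonneg (1 + κ)]
        nlinarith [mul_le_mul_of_nonneg_right h3 (sq_nonneg h)]

/-- A coordinate of a vector, as an additive map. -/
def coord {ι : Type*} (i : ι) : EuclideanSpace ℝ ι →+ ℝ where
  toFun x := x i
  map_zero' := rfl
  map_add' _ _ := rfl

theorem coord_apply {ι : Type*} (i : ι) (x : EuclideanSpace ℝ ι) : coord i x = x i := rfl

/-- The kernel of the chain of which `rewardBatch` sums the increments. -/
def Model.rewardKernel (π : Policy S A) (α : EuclideanSpace ℝ (Fin q)) (s : S) :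
    PMF (EuclideanSpace ℝ (Fin q) × S) :=
  (π.act s).bind fun a => (M.restart s a).map fun s' => (M.gradR α s a, s')

theorem Model.rewardBatch_eq (π : Policy S A) (α : EuclideanSpace ℝ (Fin q)) (n : ℕ) (s : S) :
    M.rewardBatch π α n s = batch (M.rewardKernel π α) n s := by
  induction n generalizing s with
  | zero => rfl
  | succ n ih =>
    rw [Model.rewardBatch, batch, Model.rewardKernel, PMF.bind_bind]
    simp only [PMF.bind_map, Function.comp_def, ih]

-- The scalar bound is applied to each coordinate with its own supremum. The squares of the suprema
-- sum to at most `Cr ^ 2`, so no extra factor `q` arises.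
variable {M} in
theorem Model.OscBound.lexp_rewardBatch_le {κ : ℝ} (hκ : M.OscBound κ) (hκ0 : 0 ≤ κ)
    (π : Policy S A) (α : EuclideanSpace ℝ (Fin q)) {Cr : ℝ}
    (hα : ∑ i : Fin q, (⨆ x : S × A, |M.gradR α x.1 x.2 i|) ^ 2 ≤ Cr ^ 2)
    (n : ℕ) (hn : 1 ≤ n) (s : S) :
    lexp (M.rewardBatch π α n s) (fun x => ‖x.1 - (n * (1 - M.γ)) • M.valGrad π α‖ ^ 2) ≤
      ENNReal.ofReal (16 * (1 + κ) ^ 2 * n * Cr ^ 2) := by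
  have hcoord : ∀ i, lexp (M.rewardBatch π α n s)
      (fun x => (x.1 i - n * (1 - M.γ) * M.valGrad π α i) ^ 2) ≤
        ENNReal.ofReal (16 * (1 + κ) ^ 2 * n * (⨆ x : S × A, |M.gradR α x.1 x.2 i|) ^ 2) := by
    intro i
    have hb : ∀ s a, |M.gradR α s a i| ≤ ⨆ x : S × A, |M.gradR α x.1 x.2 i| := fun s a =>
      Model.Assumptions.abs_gradR_le α s a i
    have hsupp : ∀ s, ∀ z ∈ (M.rewardKernel π α s).support,
        |coord i z.1| ≤ ⨆ x : S × A, |M.gradR α x.1 x.2 i| := by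
      intro s z hz
      simp only [Model.rewardKernel, PMF.mem_support_bind_iff, PMF.mem_support_map_iff] at hz
      obtain ⟨a, -, s', -, rfl⟩ := hz
      exact hb s a
    have hV : M.init (M.res π (avg π fun s a => M.gradR α s a i)) = M.valGrad π α i := by
      rw [M.init_res, Model.valGrad]
      simp [avg, Finset.mul_sum, mul_assoc]
    have := hκ.lexp_batch_le hκ0 π (M.rewardKernel π α) (coord i) (avg π fun s a => M.gradR α s a i)
      hsupp (fun s => ?_) (fun s w => ?_) n hn s
    · rw [hV] at this
      rw [M.rewardBatch_eq]
      simpa only [mul_assoc, coord_apply] using this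
    · obtain ⟨C, hC0, hC⟩ := finite_bdd fun x : S × A => M.gradR α x.1 x.2 i
      rw [Model.rewardKernel, expect_bind _ _ hC0, expect_act, avg]
      · refine Finset.sum_congr rfl fun a _ => ?_
        rw [expect_map (f := fun z : EuclideanSpace ℝ (Fin q) × S => coord i z.1) _
          (fun s' => (M.gradR α s a, s')) hC0 fun s' _ => hC (s, a)]
        exact congrArg _ (expect_const (M.restart s a) (M.gradR α s a i))
      · intro a _ z hz
        rw [PMF.mem_support_map_iff] at hz
        obtain ⟨s', -, rfl⟩ := hz
        exact hC (s, a)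
    · obtain ⟨C, hC0, hC⟩ := finite_bdd w
      have hC' : ∀ z : EuclideanSpace ℝ (Fin q) × S, |w z.2| ≤ C := fun z => hC z.2
      rw [Model.rewardKernel, expect_bind_of_bounded _ _ hC', expect_act, stepOp_apply]
      refine Finset.sum_congr rfl fun a _ => ?_
      rw [expect_map_of_bounded _ _ hC', expect_fintype]
  calc _ = lexp (M.rewardBatch π α n s)
        (fun x => ∑ i, (x.1 i - n * (1 - M.γ) * M.valGrad π α i) ^ 2) := by
        congr 1
        funext x
        rw [EuclideanSpace.real_norm_sq_eq]
        simp
    _ ≤ ∑ i, ENNReal.ofReal (16 * (1 + κ) ^ 2 * n * (⨆ x : S × A, |M.gradR α x.1 x.2 i|) ^ 2) :=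
        (lexp_sum_le _ _ _).trans (Finset.sum_le_sum fun i _ => hcoord i)
    _ ≤ _ := by
        rw [← ENNReal.ofReal_sum_of_nonneg fun i _ => by positivity, ← Finset.mul_sum]
        refine ENNReal.ofReal_le_ofReal ?_
        gcongr

end Batch

/-! ### The random-horizon estimator. -/

section EstQ

variable {S A : Type*} [Fintype S] [Fintype A] {q : ℕ} (M : Model S A q)

theorem Model.sqrt_γ_lt_one : √M.γ < 1 := by
  rw [Real.sqrt_lt' one_pos, one_pow]
  exact M.γ_lt_one

theorem Model.one_sub_sqrt_pos : 0 < 1 - √M.γ := sub_pos.2 M.sqrt_γ_lt_one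

theorem Model.abs_rollout_le (π : Policy S A) {r : S → A → ℝ} {R : ℝ} (hr : ∀ s a, |r s a| ≤ R)
    (n : ℕ) (s : S) (a : A) : ∀ v ∈ (M.rollout π r n s a).support, |v| ≤ R / (1 - √M.γ) := by
  have h1 := M.one_sub_sqrt_pos
  have hR : 0 ≤ R := (abs_nonneg _).trans (hr s a)
  have h0 := Real.sqrt_nonneg M.γ
  induction n generalizing s a with
  | zero =>
    intro v hv
    rw [Model.rollout, PMF.mem_support_pure_iff] at hv
    rw [hv, le_div_iff₀ h1]
    nlinarith [hr s a, abs_nonneg (r s a)]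
  | succ n ih =>
    intro v hv
    simp only [Model.rollout, PMF.mem_support_bind_iff, PMF.mem_support_map_iff] at hv
    obtain ⟨s', -, a', -, w, hw, rfl⟩ := hv
    calc |r s a + √M.γ * w| ≤ |r s a| + √M.γ * |w| := by
          refine (abs_add_le _ _).trans (le_of_eq ?_)
          rw [abs_mul, abs_of_nonneg h0]
      _ ≤ R + √M.γ * (R / (1 - √M.γ)) := by
          gcongr
          · exact hr s a
          · exact ih s' a' w hw
      _ = _ := by field_simp; ring

theorem Model.abs_estQ_le (π : Policy S A) {r : S → A → ℝ} {R : ℝ} (hr : ∀ s a, |r s a| ≤ R)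
    (s : S) (a : A) : ∀ v ∈ (M.estQ π r s a).support, |v| ≤ R / (1 - √M.γ) := by
  intro v hv
  rw [Model.estQ, PMF.mem_support_bind_iff] at hv
  obtain ⟨n, -, hv⟩ := hv
  exact M.abs_rollout_le π hr n s a v hv

theorem Model.abs_estQList_le (π : Policy S A) {r : S → A → ℝ} {R : ℝ} (hR : 0 ≤ R)
    (hr : ∀ s a, |r s a| ≤ R) (s : S) (l : List A) :
    ∀ f ∈ (M.estQList π r s l).support, ∀ a, |f a| ≤ R / (1 - √M.γ) := by
  classical
  have h1 := M.one_sub_sqrt_pos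
  induction l with
  | nil =>
    intro f hf a
    rw [Model.estQList, PMF.mem_support_pure_iff] at hf
    rw [hf, Pi.zero_apply, abs_zero]
    positivity
  | cons b l ih =>
    intro f hf a
    simp only [Model.estQList, PMF.mem_support_bind_iff, PMF.mem_support_map_iff] at hf
    obtain ⟨v, hv, f', hf', rfl⟩ := hf
    rw [Function.update_apply]
    split_ifs
    · exact M.abs_estQ_le π hr s b v hv
    · exact ih f' hf' a

/-- The head overwrites the tail, so entry `a` is the draw made at the first occurrence of `a` in
the list. -/
theorem Model.expect_estQList (π : Policy S A) {r : S → A → ℝ} {R : ℝ} (hR : 0 ≤ R)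
    (hr : ∀ s a, |r s a| ≤ R) (s : S) (l : List A) (a : A) (ha : a ∈ l) :
    expect (M.estQList π r s l) (fun f => f a) = expect (M.estQ π r s a) fun v => v := by
  classical
  have h1 := M.one_sub_sqrt_pos
  have hRb : 0 ≤ R / (1 - √M.γ) := by positivity
  induction l with
  | nil => simp at ha
  | cons b l ih =>
    have hbd : ∀ v ∈ (M.estQ π r s b).support, ∀ f ∈ (M.estQList π r s l).support,
        |Function.update f b v a| ≤ R / (1 - √M.γ) := by
      intro v hv f hf
      rw [Function.update_apply]
      split_ifs
      · exact M.abs_estQ_le π hr s b v hv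
      · exact M.abs_estQList_le π hR hr s l f hf a
    have e : expect (M.estQList π r s (b :: l)) (fun f => f a) =
        expect (M.estQ π r s b) fun v => expect (M.estQList π r s l) fun f =>
          Function.update f b v a := by
      rw [Model.estQList, expect_bind _ _ hRb]
      · refine expect_congr _ fun v hv => ?_
        rw [expect_map _ _ hRb]
        intro f hf
        exact hbd v hv f hf
      · intro v hv f hf
        rw [PMF.mem_support_map_iff] at hf
        obtain ⟨f', hf', rfl⟩ := hf
        exact hbd v hv f' hf'
    rw [e]
    by_cases hab : a = b
    · subst hab
      simp only [Function.update_self, expect_const]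
    · simp only [Function.update_of_ne hab, expect_const]
      exact ih ((List.mem_cons.1 ha).resolve_left hab)

theorem Model.expect_rollout_succ (π : Policy S A) {r : S → A → ℝ} {R : ℝ}
    (hr : ∀ s a, |r s a| ≤ R) (n : ℕ) (s : S) (a : A) :
    expect (M.rollout π r (n + 1) s a) (fun v => v) = r s a + √M.γ * ∑ s', (M.P s a s').toReal *
      avg π (fun s' a' => expect (M.rollout π r n s' a') fun v => v) s' := by
  have h1 := M.one_sub_sqrt_pos
  have hR : 0 ≤ R := (abs_nonneg _).trans (hr s a)
  have hRb : 0 ≤ R / (1 - √M.γ) := by positivity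
  have hb := M.abs_rollout_le π hr (n + 1) s a
  have hb' : ∀ s' ∈ (M.P s a).support, ∀ a' ∈ (π.act s').support,
      ∀ w ∈ (M.rollout π r n s' a').support, |r s a + √M.γ * w| ≤ R / (1 - √M.γ) := by
    intro s' hs' a' ha' w hw
    refine hb _ ?_
    simp only [Model.rollout, PMF.mem_support_bind_iff, PMF.mem_support_map_iff]
    exact ⟨s', hs', a', ha', w, hw, rfl⟩
  rw [Model.rollout, expect_bind _ _ hRb]
  · have e1 : ∀ s' ∈ (M.P s a).support, expect ((π.act s').bind fun a' =>
        (M.rollout π r n s' a').map fun v => r s a + √M.γ * v) (fun v => v) =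
        r s a + √M.γ * avg π (fun s' a' => expect (M.rollout π r n s' a') fun v => v) s' := by
      intro s' hs'
      rw [expect_bind _ _ hRb]
      · have e2 : ∀ a' ∈ (π.act s').support,
            expect ((M.rollout π r n s' a').map fun v => r s a + √M.γ * v) (fun v => v) =
            r s a + √M.γ * expect (M.rollout π r n s' a') fun v => v := by
          intro a' ha'
          rw [expect_map (f := fun v => v) _ _ hRb (hb' s' hs' a' ha'),
            expect_add (f := fun _ => r s a) (g := fun v => √M.γ * v) _ (fun _ _ => le_refl |r s a|)
            (D := √M.γ * (R / (1 - √M.γ))), expect_const, expect_const_mul]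
          intro v hv
          rw [abs_mul, abs_of_nonneg (Real.sqrt_nonneg _)]
          gcongr
          exact M.abs_rollout_le π hr n s' a' v hv
        rw [expect_congr _ e2, expect_act, avg]
        simp only [mul_add, Finset.sum_add_distrib, ← Finset.sum_mul, π.2.2, one_mul, Finset.mul_sum]
        congr 1
        exact Finset.sum_congr rfl fun _ _ => by ring
      · intro a' ha' w hw
        rw [PMF.mem_support_map_iff] at hw
        obtain ⟨v, hv, rfl⟩ := hw
        exact hb' s' hs' a' ha' v hv
    rw [expect_congr _ e1, expect_fintype]
    simp only [mul_add, Finset.sum_add_distrib, ← Finset.sum_mul, sum_toReal, one_mul,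
      Finset.mul_sum]
    congr 1
    exact Finset.sum_congr rfl fun _ _ => by ring
  · intro s' hs' w hw
    simp only [PMF.mem_support_bind_iff, PMF.mem_support_map_iff] at hw
    obtain ⟨a', ha', v, hv, rfl⟩ := hw
    exact hb' s' hs' a' ha' v hv

theorem Model.horizon_toReal (n : ℕ) : (M.horizon n).toReal = (1 - √M.γ) * √M.γ ^ n :=
  ENNReal.toReal_ofReal (mul_nonneg M.one_sub_sqrt_pos.le (pow_nonneg (Real.sqrt_nonneg _) n))

/-- The estimator EstQ is unbiased. -/
theorem Model.expect_estQ (π : Policy S A) {r : S → A → ℝ} {R : ℝ}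
    (hr : ∀ s a, |r s a| ≤ R) (s : S) (a : A) :
    expect (M.estQ π r s a) (fun v => v) = M.Q π r s a := by
  have h1 := M.one_sub_sqrt_pos
  have hRb : 0 ≤ R / (1 - √M.γ) := div_nonneg ((abs_nonneg _).trans (hr s a)) h1.le
  set p : ℕ → S → A → ℝ := fun n s a => expect (M.rollout π r n s a) fun v => v with hp
  have hpb : ∀ n s a, |p n s a| ≤ R / (1 - √M.γ) := fun n s a =>
    abs_expect_le _ (M.abs_rollout_le π hr n s a)
  have hsm : ∀ s a, Summable fun n => (1 - √M.γ) * √M.γ ^ n * p n s a := fun s a => by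
    have := summable_expect M.horizon (f := fun n => p n s a) fun n _ => hpb n s a
    simpa only [M.horizon_toReal] using this
  set Qb : S → A → ℝ := fun s a => expect (M.estQ π r s a) (fun v => v) with hQb
  have hQe : ∀ s a, Qb s a = ∑' n, (1 - √M.γ) * √M.γ ^ n * p n s a := fun s a => by
    rw [hQb]
    dsimp only
    rw [Model.estQ, expect_bind _ _ hRb fun n _ v hv => M.abs_rollout_le π hr n s a v hv, expect]
    simp only [M.horizon_toReal, hp]
  -- A shift of the horizon costs `√γ` and the recursion of the rollout another `√γ`, which together
  -- give `γ`. The immediate reward occurs for every horizon and collects total weight one.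
  have hrec : ∀ s a, Qb s a = r s a + M.γ * ∑ s', (M.P s a s').toReal * avg π Qb s' := by
    intro s a
    have hs2 : HasSum (fun n => ∑ s', (M.P s a s').toReal * ∑ a', π.1 (s', a') *
        ((1 - √M.γ) * √M.γ ^ n * p n s' a')) (∑ s', (M.P s a s').toReal * avg π Qb s') := by
      refine hasSum_sum fun s' _ => HasSum.mul_left _ ?_
      refine hasSum_sum fun a' _ => HasSum.mul_left _ ?_
      rw [hQe]
      exact (hsm s' a').hasSum
    have hg := (hasSum_geometric_of_lt_one (Real.sqrt_nonneg M.γ) M.sqrt_γ_lt_one).mul_left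
      ((1 - √M.γ) * √M.γ * r s a)
    have hsum := hg.add (hs2.mul_left M.γ)
    have e0 : p 0 s a = r s a := expect_pure _ _
    have e1 : ∀ n, (1 - √M.γ) * √M.γ ^ (n + 1) * p (n + 1) s a =
        (1 - √M.γ) * √M.γ * r s a * √M.γ ^ n + M.γ * ∑ s', (M.P s a s').toReal *
          ∑ a', π.1 (s', a') * ((1 - √M.γ) * √M.γ ^ n * p n s' a') := by
      intro n
      have e2 : p (n + 1) s a = r s a + √M.γ * ∑ s', (M.P s a s').toReal *
          ∑ a', π.1 (s', a') * p n s' a' := M.expect_rollout_succ π hr n s a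
      have e3 : ∑ s', (M.P s a s').toReal *
          ∑ a', π.1 (s', a') * ((1 - √M.γ) * √M.γ ^ n * p n s' a') =
          (1 - √M.γ) * √M.γ ^ n * ∑ s', (M.P s a s').toReal * ∑ a', π.1 (s', a') * p n s' a' := by
        simp only [Finset.mul_sum]
        exact Finset.sum_congr rfl fun _ _ => Finset.sum_congr rfl fun _ _ => by ring
      rw [e2, e3]
      have e4 : ∀ x, M.γ * x = √M.γ * √M.γ * x := fun x => by
        rw [Real.mul_self_sqrt M.γ_pos.le]
      rw [e4]
      ring
    rw [hQe, (hsm s a).tsum_eq_zero_add, e0, tsum_congr e1, hsum.tsum_eq]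
    field_simp
    ring
  have hu : avg π Qb = M.res π (avg π r) := by
    refine M.eq_res π fun s => ?_
    rw [avg, avg, stepOp_apply, Finset.mul_sum, ← Finset.sum_add_distrib]
    refine Finset.sum_congr rfl fun a _ => ?_
    rw [hrec]
    ring
  rw [Model.Q, ← hu]
  exact hrec s a

end EstQ

/-! ### Batches of policy gradient estimates. -/

section PolicyBatch

variable {S A : Type*} [Fintype S] [Fintype A] {q : ℕ} (M : Model S A q)

/-- The kernel of the chain of which `policyBatch` sums the increments. -/
def Model.policyKernel (π : Policy S A) (r : S → A → ℝ) (s : S) :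
    PMF (EuclideanSpace ℝ (S × A) × S) :=
  (π.act s).bind fun a => (M.estQList π r s Finset.univ.toList).bind fun f =>
    (M.restart s a).map fun s' => (rowVec s f, s')

theorem Model.policyBatch_eq (π : Policy S A) (r : S → A → ℝ) (n : ℕ) (s : S) :
    M.policyBatch π r n s = batch (M.policyKernel π r) n s := by
  induction n generalizing s with
  | zero => rfl
  | succ n ih =>
    rw [Model.policyBatch, batch, Model.policyKernel, PMF.bind_bind]
    simp only [PMF.bind_bind, PMF.bind_map, Function.comp_def, ih]

variable {M} in
theorem Model.OscBound.lexp_policyBatch_le {κ : ℝ} (hκ : M.OscBound κ) (hκ0 : 0 ≤ κ)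
    (π : Policy S A) {r : S → A → ℝ} {R : ℝ} (hR : 0 ≤ R) (hr : ∀ s a, |r s a| ≤ R)
    (n : ℕ) (hn : 1 ≤ n) (s : S) :
    lexp (M.policyBatch π r n s) (fun x => ‖x.1 + (n * (1 - M.γ)) • M.polGrad π r‖ ^ 2) ≤
      ENNReal.ofReal (Fintype.card (S × A) *
        (16 * (1 + κ) ^ 2 * n * (2 * R / (1 - M.γ)) ^ 2)) := by
  classical
  have h0 := M.one_sub_pos
  have h1 := M.one_sub_sqrt_pos
  have hRb : 0 ≤ R / (1 - √M.γ) := by positivity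
  -- Since `1 - γ = (1 - √γ)(1 + √γ)`, the estimates exceed the a priori bound for `Q` by a factor
  -- of at most two.
  have hR2 : R / (1 - √M.γ) ≤ 2 * R / (1 - M.γ) := by
    rw [div_le_div_iff₀ h1 h0]
    have e : 1 - M.γ = (1 - √M.γ) * (1 + √M.γ) := by
      nlinarith [Real.mul_self_sqrt M.γ_pos.le]
    rw [e]
    have := M.sqrt_γ_lt_one
    have h2 : (1 - √M.γ) * (1 + √M.γ) ≤ (1 - √M.γ) * 2 := by gcongr; linarith
    nlinarith
  have hcoord : ∀ i : S × A, lexp (M.policyBatch π r n s)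
      (fun x => (x.1 i + n * (1 - M.γ) * M.polGrad π r i) ^ 2) ≤
        ENNReal.ofReal (16 * (1 + κ) ^ 2 * n * (2 * R / (1 - M.γ)) ^ 2) := by
    rintro ⟨s₀, a₀⟩
    set φ : EuclideanSpace ℝ (S × A) →+ ℝ := coord (s₀, a₀)
    have hφ : ∀ s f, φ (rowVec s f) = if s₀ = s then f a₀ else 0 := fun _ _ => rfl
    have hbd : ∀ s, ∀ f ∈ (M.estQList π r s Finset.univ.toList).support,
        |φ (rowVec s f)| ≤ R / (1 - √M.γ) := by
      intro s f hf
      rw [hφ]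
      split_ifs
      · exact M.abs_estQList_le π hR hr s _ f hf a₀
      · simpa using hRb
    have hsupp : ∀ s, ∀ z ∈ (M.policyKernel π r s).support, |φ z.1| ≤ R / (1 - √M.γ) := by
      intro s z hz
      simp only [Model.policyKernel, PMF.mem_support_bind_iff, PMF.mem_support_map_iff] at hz
      obtain ⟨a, -, f, hf, s', -, rfl⟩ := hz
      exact hbd s f hf
    -- The conditional mean of entry `(s₀, a₀)` of an increment. Its discounted total is the
    -- occupation of `s₀` times `Q`, the negative of a gradient entry.
    let fm : S → ℝ := fun s => if s₀ = s then M.Q π r s a₀ else 0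
    have hV : M.init (M.res π fm) = -M.polGrad π r (s₀, a₀) := by
      rw [M.init_res, Model.polGrad]
      simp [fm]
    have hmain := hκ.lexp_batch_le hκ0 π (M.policyKernel π r) φ fm
      (fun s z hz => (hsupp s z hz).trans hR2) (fun s => ?_) (fun s w => ?_) n hn s
    · rw [hV] at hmain
      rw [M.policyBatch_eq]
      refine le_trans (le_of_eq ?_) hmain
      congr 1
      funext x
      rw [coord_apply]
      ring
    · rw [Model.policyKernel, expect_bind _ _ hRb]
      · have e1 : ∀ a, expect ((M.estQList π r s Finset.univ.toList).bind fun f =>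
            (M.restart s a).map fun s' => (rowVec s f, s')) (fun z => φ z.1) = fm s := by
          intro a
          rw [expect_bind _ _ hRb]
          · have e2 : ∀ f ∈ (M.estQList π r s Finset.univ.toList).support,
                expect ((M.restart s a).map fun s' => (rowVec s f, s')) (fun z => φ z.1) =
                  if s₀ = s then f a₀ else 0 := by
              intro f hf
              rw [expect_map (f := fun z : EuclideanSpace ℝ (S × A) × S => φ z.1) _ _ hRb
                  fun s' _ => hbd s f hf, ← hφ]
              exact expect_const _ _
            rw [expect_congr _ e2]
            simp only [fm]
            split_ifs
            · rw [M.expect_estQList π hR hr s _ a₀ (by simp), M.expect_estQ π hr]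
            · exact expect_const _ _
          · intro f hf z hz
            rw [PMF.mem_support_map_iff] at hz
            obtain ⟨s', -, rfl⟩ := hz
            exact hbd s f hf
        simp only [e1, expect_const]
      · intro a ha z hz
        refine hsupp s z ?_
        rw [Model.policyKernel, PMF.mem_support_bind_iff]
        exact ⟨a, ha, hz⟩
    · obtain ⟨C, hC0, hC⟩ := finite_bdd w
      have hC' : ∀ z : EuclideanSpace ℝ (S × A) × S, |w z.2| ≤ C := fun z => hC z.2
      rw [Model.policyKernel, expect_bind_of_bounded _ _ hC', expect_act, stepOp_apply]
      refine Finset.sum_congr rfl fun a _ => ?_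
      rw [expect_bind_of_bounded _ _ hC']
      simp only [expect_map_of_bounded _ _ hC', expect_const]
      simp only [expect_fintype]
  calc _ = lexp (M.policyBatch π r n s)
        (fun x => ∑ i, (x.1 i + n * (1 - M.γ) * M.polGrad π r i) ^ 2) := by
        congr 1
        funext x
        rw [EuclideanSpace.real_norm_sq_eq]
        simp
    _ ≤ ∑ i : S × A, ENNReal.ofReal (16 * (1 + κ) ^ 2 * n * (2 * R / (1 - M.γ)) ^ 2) :=
        (lexp_sum_le _ _ _).trans (Finset.sum_le_sum fun i _ => hcoord i)
    _ = _ := by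
        rw [Finset.sum_const, Finset.card_univ, nsmul_eq_mul, ENNReal.ofReal_mul (Nat.cast_nonneg _),
          ENNReal.ofReal_natCast]

end PolicyBatch

/-! ### The inner and the outer loop in expectation. -/

section Loop

theorem lexp_affine_le {X : Type*} (p : PMF X) {f : X → ℝ} {a b c : ℝ} (ha : 0 ≤ a) (hb : 0 ≤ b)
    (hc : 0 ≤ c) (h : lexp p f ≤ ENNReal.ofReal c) :
    lexp p (fun x => a + b * f x) ≤ ENNReal.ofReal (a + b * c) := by
  refine (lexp_add_le _ _ _).trans ?_
  rw [lexp_const, lexp_const_mul _ hb, ENNReal.ofReal_add ha (mul_nonneg hb hc),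
    ENNReal.ofReal_mul hb]
  gcongr

variable {S A : Type*} [Fintype S] [Fintype A] {q : ℕ} {M : Model S A q}
  {Cα Cr Lr Lψ μ CM ρ ζ₀ : ℝ}

namespace Model.Assumptions

variable (h : M.Assumptions Cα Cr Lr Lψ μ CM ρ ζ₀)
include h

theorem lexp_rewardBatch_le (hCM : 1 ≤ CM) (hρ₀ : 0 < ρ) (hρ₁ : ρ < 1) (π : Policy S A)
    (α : M.Λ) {n : ℕ} (hn : 1 ≤ n) (s : S) :
    lexp (M.rewardBatch π α n s) (fun x => ‖x.1 - (n * (1 - M.γ)) • M.valGrad π α‖ ^ 2) ≤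
      ENNReal.ofReal (64 * mixConst CM ρ ^ 2 * n * Cr ^ 2) := by
  have hm := two_le_mixConst hCM hρ₀ hρ₁
  refine ((h.oscBound hCM hρ₀ hρ₁).lexp_rewardBatch_le (by linarith) π α (h.sum_sup_sq_le α.2) n hn
    s).trans (ENNReal.ofReal_le_ofReal ?_)
  have : (1 + (2 * mixConst CM ρ - 3)) ^ 2 ≤ (2 * mixConst CM ρ) ^ 2 := by
    gcongr <;> linarith
  calc 16 * (1 + (2 * mixConst CM ρ - 3)) ^ 2 * n * Cr ^ 2
      ≤ 16 * (2 * mixConst CM ρ) ^ 2 * n * Cr ^ 2 := by gcongr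
    _ = _ := by ring

/-- Given the current parameter, the batch bounds hold from whatever states the two chains have
reached. The gradient of `ψ` is exact and cancels, so only the two batch errors remain. -/
theorem lexp_rewardStep_le (hμ : 0 < μ) (hCM : 1 ≤ CM) (hρ₀ : 0 < ρ) (hρ₁ : ρ < 1)
    (hL : μ ≤ L22 q M.γ Lr Lψ) {a : ℝ} (ha : a = 7 / 32 * μ ^ 2 / L22 q M.γ Lr Lψ ^ 2)
    (ha1 : a ≤ 1) {B : ℕ} (hB : 1 ≤ B) (θ : Policy S A) (x : M.Λ × S × S) :
    lexp (M.rewardStep B (stepβ q M.γ Lr Lψ μ) θ x)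
        (fun z => ‖(z.1 : EuclideanSpace ℝ (Fin q)) - M.best θ‖ ^ 2) ≤
      ENNReal.ofReal ((1 - a) * ‖(x.1 : EuclideanSpace ℝ (Fin q)) - M.best θ‖ ^ 2 +
        a * (64 / (49 * μ ^ 2) * (256 * mixConst CM ρ ^ 2 * Cr ^ 2 / ((1 - M.γ) ^ 2 * B)))) := by
  have h0 := M.one_sub_pos
  have hB0 : (0 : ℝ) < B := by exact_mod_cast hB
  have ha0 : 0 ≤ a := by rw [ha]; positivity
  have ha1' : 0 ≤ 1 - a := sub_nonneg.2 ha1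
  set W := 64 * mixConst CM ρ ^ 2 * B * Cr ^ 2 with hW
  have hW0 : 0 ≤ W := by positivity
  set d := ‖(x.1 : EuclideanSpace ℝ (Fin q)) - M.best θ‖ with hd
  set K := a * (64 / (49 * μ ^ 2)) * (2 / ((1 - M.γ) * B) ^ 2) with hK
  have hK0 : 0 ≤ K := by positivity
  set XE : EuclideanSpace ℝ (Fin q) × S → ℝ := fun e =>
    ‖e.1 - (B * (1 - M.γ)) • M.valGrad M.πE x.1‖ ^ 2 with hXE
  set XL : EuclideanSpace ℝ (Fin q) × S → ℝ := fun l =>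
    ‖l.1 - (B * (1 - M.γ)) • M.valGrad θ x.1‖ ^ 2 with hXL
  have hstep : ∀ e l : EuclideanSpace ℝ (Fin q) × S,
      ‖((proj ⟨x.1⟩ ((x.1 : EuclideanSpace ℝ (Fin q)) + stepβ q M.γ Lr Lψ μ •
        ((1 / ((1 - M.γ) * B)) • (e.1 - l.1) - gradient M.ψ x.1)) : M.Λ) :
          EuclideanSpace ℝ (Fin q)) - M.best θ‖ ^ 2 ≤
        ((1 - a) * d ^ 2 + K * XE e) + K * XL l := by
    intro e l
    refine (h.reward_step_le hμ hL θ rfl ha rfl x.1 _).trans ?_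
    have e1 : ((1 / ((1 - M.γ) * B)) • (e.1 - l.1) - gradient M.ψ x.1) - M.gradF θ x.1 =
        (1 / ((1 - M.γ) * B)) • ((e.1 - (B * (1 - M.γ)) • M.valGrad M.πE x.1) -
          (l.1 - (B * (1 - M.γ)) • M.valGrad θ x.1)) := by
      have hne : (1 / ((1 - M.γ) * B)) * (B * (1 - M.γ)) = 1 := by field_simp
      simp only [Model.gradF, smul_sub, smul_smul, hne, one_smul]
      abel
    rw [e1, norm_smul, mul_pow, Real.norm_eq_abs, sq_abs]
    have h2 : ‖(e.1 - (B * (1 - M.γ)) • M.valGrad M.πE x.1) -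
          (l.1 - (B * (1 - M.γ)) • M.valGrad θ x.1)‖ ^ 2 ≤ 2 * (XE e + XL l) := by
      refine (pow_le_pow_left₀ (norm_nonneg _) (norm_sub_le _ _) 2).trans ?_
      exact add_sq_le
    calc _ ≤ (1 - a) * d ^ 2 + a * (64 / (49 * μ ^ 2) *
          ((1 / ((1 - M.γ) * B)) ^ 2 * (2 * (XE e + XL l)))) := by gcongr
      _ = _ := by
        rw [hK, div_pow, one_pow]
        ring
  have hEl := h.lexp_rewardBatch_le hCM hρ₀ hρ₁ θ x.1 hB x.2.2
  have hEe := h.lexp_rewardBatch_le hCM hρ₀ hρ₁ M.πE x.1 hB x.2.1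
  rw [Model.rewardStep]
  refine (lexp_bind_le (c := fun e => ((1 - a) * d ^ 2 + K * W) + K * XE e) _ _
    fun e _ => ?_).trans ?_
  · rw [lexp_map]
    refine (lexp_mono _ fun l _ => hstep e l).trans
      ((lexp_affine_le _ (by positivity) hK0 hW0 hEl).trans (le_of_eq ?_))
    congr 1
    ring
  · refine (lexp_affine_le _ (by positivity) hK0 hW0 hEe).trans (le_of_eq ?_)
    congr 1
    rw [hK, hW]
    field_simp
    ring

/-- The squared error of the inner loop. -/
theorem lexp_rewardLoop_le (hμ : 0 < μ) (hCM : 1 ≤ CM) (hρ₀ : 0 < ρ) (hρ₁ : ρ < 1)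
    {ℓ : ℝ} (hℓ : 0 < ℓ) (hLℓ : L22 q M.γ Lr Lψ * (1 - M.γ) ≤ ℓ) {B : ℕ} (hB : 1 ≤ B)
    (θ : Policy S A) (K : ℕ) (x : M.Λ × S × S) :
    lexp (M.rewardLoop B (stepβ q M.γ Lr Lψ μ) θ K x)
        (fun z => ‖(z.1 : EuclideanSpace ℝ (Fin q)) - M.best θ‖ ^ 2) ≤
      ENNReal.ofReal (Cα ^ 2 * Real.exp (-(7 / 32 * μ ^ 2 / ℓ ^ 2) * (1 - M.γ) ^ 2 * K) +
        64 / (49 * μ ^ 2) * (256 * mixConst CM ρ ^ 2 * Cr ^ 2 / ((1 - M.γ) ^ 2 * B))) := by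
  have h0 := M.one_sub_pos
  set Y := 64 / (49 * μ ^ 2) * (256 * mixConst CM ρ ^ 2 * Cr ^ 2 / ((1 - M.γ) ^ 2 * B)) with hY
  have hY0 : 0 ≤ Y := by positivity
  -- If `Λ` is a single point, `μ ≤ L22` may fail, but the error is zero.
  by_cases hne : ∃ α₁ ∈ M.Λ, ∃ α₂ ∈ M.Λ, α₁ ≠ α₂
  · have hL := h.le_L22 hne
    have hL0 := hμ.trans_le hL
    set a := 7 / 32 * μ ^ 2 / L22 q M.γ Lr Lψ ^ 2 with ha
    have ha0 : 0 ≤ a := by positivity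
    have ha1 : a ≤ 1 := by
      have hx : μ ^ 2 / L22 q M.γ Lr Lψ ^ 2 ≤ 1 := by
        rw [div_le_one (by positivity)]
        gcongr
      rw [ha, mul_div_assoc]
      linarith
    have key : lexp (M.rewardLoop B (stepβ q M.γ Lr Lψ μ) θ K x)
        (fun z => ‖(z.1 : EuclideanSpace ℝ (Fin q)) - M.best θ‖ ^ 2) ≤
        ENNReal.ofReal ((1 - a) ^ K * Cα ^ 2 + Y) := by
      have ha1' : 0 ≤ 1 - a := sub_nonneg.2 ha1
      induction K with
      | zero =>
        rw [Model.rewardLoop, lexp_pure]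
        refine ENNReal.ofReal_le_ofReal ?_
        have := pow_le_pow_left₀ (norm_nonneg _)
          (h.Λ_bounded x.1 x.1.2 (M.best θ) (h.best_mem θ)) 2
        linarith
      | succ K ih =>
        rw [Model.rewardLoop]
        -- The noise level `Y` is the fixed point of `y ↦ a * Y + (1 - a) * y`, so noise does not
        -- accumulate over the inner steps.
        refine (lexp_bind_le (c := fun z : M.Λ × S × S =>
          a * Y + (1 - a) * ‖(z.1 : EuclideanSpace ℝ (Fin q)) - M.best θ‖ ^ 2) _ _
            fun z _ => ?_).trans ?_
        · rw [add_comm (a * Y)]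
          exact h.lexp_rewardStep_le hμ hCM hρ₀ hρ₁ hL ha ha1 hB θ z
        · refine (lexp_affine_le _ (by positivity) ha1' (by positivity) ih).trans (le_of_eq ?_)
          congr 1
          ring
    refine key.trans (ENNReal.ofReal_le_ofReal ?_)
    rw [mul_comm]
    gcongr
    have h1 : 7 / 32 * μ ^ 2 / ℓ ^ 2 * (1 - M.γ) ^ 2 ≤ a := by
      have h2 : (L22 q M.γ Lr Lψ * (1 - M.γ)) ^ 2 ≤ ℓ ^ 2 := by gcongr
      rw [ha, div_mul_eq_mul_div, div_le_div_iff₀ (by positivity) (by positivity), mul_assoc]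
      gcongr
      linarith
    calc (1 - a) ^ K ≤ (Real.exp (-a)) ^ K := by
          gcongr
          exact Real.one_sub_le_exp_neg a
      _ = Real.exp (K * -a) := (Real.exp_nat_mul _ _).symm
      _ ≤ _ := by
          rw [Real.exp_le_exp]
          have hK0 : (0 : ℝ) ≤ K := Nat.cast_nonneg K
          nlinarith
  · push Not at hne
    have : (fun z : M.Λ × S × S => ‖(z.1 : EuclideanSpace ℝ (Fin q)) - M.best θ‖ ^ 2) =
        fun _ => 0 := by
      funext z
      rw [hne z.1 z.1.2 (M.best θ) (h.best_mem θ), sub_self, norm_zero]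
      norm_num
    rw [this, lexp_const, ENNReal.ofReal_zero]
    exact zero_le

theorem lexp_policyBatch_le (hCM : 1 ≤ CM) (hρ₀ : 0 < ρ) (hρ₁ : ρ < 1) (θ : Policy S A)
    (α : M.Λ) {b : ℕ} (hb : 1 ≤ b) (s : S) :
    lexp (M.policyBatch θ (M.r α) b s)
        (fun x => ‖(-(1 / (b * (1 - M.γ)))) • x.1 - M.polGrad θ (M.r α)‖ ^ 2) ≤
      ENNReal.ofReal (256 * Fintype.card (S × A) * mixConst CM ρ ^ 2 * (Cr * Cα) ^ 2 /
        ((1 - M.γ) ^ 4 * b)) := by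
  have hm := two_le_mixConst hCM hρ₀ hρ₁
  have h0 := M.one_sub_pos
  have hb0 : (0 : ℝ) < b := by exact_mod_cast hb
  have h1 := (h.oscBound hCM hρ₀ hρ₁).lexp_policyBatch_le (by linarith) θ
    (mul_nonneg h.Cr_nonneg h.Cα_nonneg) (h.r_bound α α.2) b hb s
  have e : ∀ x : EuclideanSpace ℝ (S × A) × S,
      ‖(-(1 / (b * (1 - M.γ)))) • x.1 - M.polGrad θ (M.r α)‖ ^ 2 =
      (1 / (b * (1 - M.γ))) ^ 2 * ‖x.1 + (b * (1 - M.γ)) • M.polGrad θ (M.r α)‖ ^ 2 := by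
    intro x
    have hne : (1 / (b * (1 - M.γ))) * (b * (1 - M.γ)) = 1 := by field_simp
    have e1 : (-(1 / (b * (1 - M.γ)))) • x.1 - M.polGrad θ (M.r α) =
        -((1 / (b * (1 - M.γ))) • (x.1 + (b * (1 - M.γ)) • M.polGrad θ (M.r α))) := by
      rw [smul_add, smul_smul, hne, one_smul, neg_smul]
      abel
    rw [e1, norm_neg, norm_smul, mul_pow, Real.norm_eq_abs, sq_abs]
  simp only [e]
  rw [lexp_const_mul _ (by positivity)]
  refine (mul_le_mul_right h1 _).trans ?_
  rw [← ENNReal.ofReal_mul (by positivity)]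
  refine ENNReal.ofReal_le_ofReal ?_
  have h2 : (1 + (2 * mixConst CM ρ - 3)) ^ 2 ≤ (2 * mixConst CM ρ) ^ 2 := by
    gcongr <;> linarith
  calc _ ≤ (1 / (b * (1 - M.γ))) ^ 2 * (Fintype.card (S × A) *
        (16 * (2 * mixConst CM ρ) ^ 2 * b * (2 * (Cr * Cα) / (1 - M.γ)) ^ 2)) := by gcongr
    _ = _ := by
        field_simp
        ring

theorem abs_g_le (θ θs : Policy S A) :
    |M.g θ| ≤ |M.g θs| + 2 * (Cr * Cα) / (1 - M.γ) := by
  have h1 := h.abs_g_sub_le θ θs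
  calc |M.g θ| = |M.g θs + (M.g θ - M.g θs)| := by ring_nf
    _ ≤ _ := (abs_add_le _ _).trans (by gcongr)

/-- The expected progress of the policy update, in terms of the error of the reward parameter. -/
theorem expect_policyStep_le (hμ : 0 < μ) (hCM : 1 ≤ CM) (hρ₀ : 0 < ρ) (hρ₁ : ρ < 1)
    (hζ₀ : 0 < ζ₀) {L : ℝ} (hL : L = L11 (Fintype.card A) M.γ Cα Cr CM ρ +
      L12 (Fintype.card A) M.γ Cr * L21 (Fintype.card A) M.γ Cr CM ρ / μ) (hL0 : 0 < L)
    (θ θs : Policy S A) (α : M.Λ) {b : ℕ} (hb : 1 ≤ b) (s : S) {τ : ℝ} (hτ : 0 < τ) {c₁ : ℝ}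
    (hc₁ : c₁ = (1 + 2 * √(Fintype.card S)) / ((1 - M.γ) * ζ₀)) :
    expect (M.policyStep b L⁻¹ θ α s) (fun z => M.g z.1) ≤
      (M.g θ + τ / (mixConst CM ρ * L) * (τ - (M.g θ - M.g θs) / c₁) +
        mixConst CM ρ / L * (2 * (256 * Fintype.card (S × A) * mixConst CM ρ ^ 2 * (Cr * Cα) ^ 2 /
          ((1 - M.γ) ^ 4 * b)))) +
        8 * mixConst CM ρ / L * L21 (Fintype.card A) M.γ Cr CM ρ ^ 2 *
          ‖(α : EuclideanSpace ℝ (Fin q)) - M.best θ‖ ^ 2 := by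
  have hm := two_le_mixConst hCM hρ₀ hρ₁
  have h0 := M.one_sub_pos
  have hc0 : 0 < c₁ := by rw [hc₁]; positivity
  set m := mixConst CM ρ with hmdef
  set δ := ‖(α : EuclideanSpace ℝ (Fin q)) - M.best θ‖ with hδ
  set σ := 256 * Fintype.card (S × A) * m ^ 2 * (Cr * Cα) ^ 2 / ((1 - M.γ) ^ 4 * b) with hσ
  have hσ0 : 0 ≤ σ := by positivity
  set l := L21 (Fintype.card A) M.γ Cr CM ρ with hl
  rw [Model.policyStep, expect_map_of_bounded (f := fun z : Policy S A × S => M.g z.1) _ _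
    (fun z => h.abs_g_le z.1 θs)]
  have hlexp := h.lexp_policyBatch_le hCM hρ₀ hρ₁ θ α hb s
  rw [← hmdef, ← hσ] at hlexp
  refine (expect_le_of_lexp
    (a := M.g θ + τ / (m * L) * (τ - (M.g θ - M.g θs) / c₁) + 8 * m / L * l ^ 2 * δ ^ 2)
    (b := 2 * m / L) _ (fun x => h.abs_g_le _ θs) (by positivity) hσ0 (fun x => sq_nonneg _)
    (fun x _ => ?_) hlexp).trans (le_of_eq (by ring))
  set v := (-(1 / (b * (1 - M.γ)))) • x.1 with hv
  set θ' := proj ⟨θ⟩ ((θ : EuclideanSpace ℝ (S × A)) - L⁻¹ • v) with hθ'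
  have hgap := h.gap_le hμ hCM hρ₀ hρ₁ hζ₀ hL hL0 θ θ' θs v
    (fun z hz => inner_proj_le ⟨θ⟩ isClosed_policySet convex_policySet _ z hz) α.2 hτ rfl
  rw [← hc₁, ← hmdef, ← hl, ← hδ] at hgap
  set e := ‖v - M.polGrad θ (M.r α)‖ + 2 * l * δ with he
  have he2 : e ^ 2 ≤ 2 * ‖v - M.polGrad θ (M.r α)‖ ^ 2 + 8 * l ^ 2 * δ ^ 2 := by
    refine add_sq_le.trans (le_of_eq ?_)
    ring
  have h1 : (M.g θ - M.g θs) / c₁ ≤ τ + 1 / τ * (m * L * (M.g θ - M.g θ') + m ^ 2 * e ^ 2) := by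
    rw [div_le_iff₀ hc0]
    linarith
  have h2 := mul_le_mul_of_nonneg_left h1 (show 0 ≤ τ / (m * L) by positivity)
  have h3 : τ / (m * L) * (τ + 1 / τ * (m * L * (M.g θ - M.g θ') + m ^ 2 * e ^ 2)) =
      τ / (m * L) * τ + (M.g θ - M.g θ') + m / L * e ^ 2 := by
    field_simp
    ring
  have h4 := mul_le_mul_of_nonneg_left he2 (show 0 ≤ m / L by positivity)
  have h5 : m / L * (2 * ‖v - M.polGrad θ (M.r α)‖ ^ 2 + 8 * l ^ 2 * δ ^ 2) =
      2 * m / L * ‖v - M.polGrad θ (M.r α)‖ ^ 2 + 8 * m / L * l ^ 2 * δ ^ 2 := by ring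
  rw [mul_sub]
  linarith

/-- The expected progress of one iteration of the outer loop. -/
theorem expect_ppg_succ_le (hμ : 0 < μ) (hCM : 1 ≤ CM) (hρ₀ : 0 < ρ) (hρ₁ : ρ < 1)
    (hζ₀ : 0 < ζ₀) {L : ℝ} (hL : L = L11 (Fintype.card A) M.γ Cα Cr CM ρ +
      L12 (Fintype.card A) M.γ Cr * L21 (Fintype.card A) M.γ Cr CM ρ / μ) (hL0 : 0 < L)
    {ℓ : ℝ} (hℓ : 0 < ℓ) (hLℓ : L22 q M.γ Lr Lψ * (1 - M.γ) ≤ ℓ)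
    (θ₀ : Policy S A) (ι : PMF (S × S)) (pick : ℕ → Policy S A × S × S → PMF M.Λ)
    (θs : Policy S A) (K : ℕ) {B b : ℕ} (hB : 1 ≤ B) (hb : 1 ≤ b) {τ : ℝ} (hτ : 0 < τ) {c₁ : ℝ}
    (hc₁ : c₁ = (1 + 2 * √(Fintype.card S)) / ((1 - M.γ) * ζ₀)) {E : ℝ}
    (hE : E = 2 * (256 * Fintype.card (S × A) * mixConst CM ρ ^ 2 * (Cr * Cα) ^ 2 /
          ((1 - M.γ) ^ 4 * b)) + 8 * L21 (Fintype.card A) M.γ Cr CM ρ ^ 2 *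
      (Cα ^ 2 * Real.exp (-(7 / 32 * μ ^ 2 / ℓ ^ 2) * (1 - M.γ) ^ 2 * K) +
        64 / (49 * μ ^ 2) * (256 * mixConst CM ρ ^ 2 * Cr ^ 2 / ((1 - M.γ) ^ 2 * B)))) (t : ℕ) :
    expect (M.ppg K B b L⁻¹ (stepβ q M.γ Lr Lψ μ) θ₀ ι pick (t + 1)) (fun x => M.g x.1) ≤
      expect (M.ppg K B b L⁻¹ (stepβ q M.γ Lr Lψ μ) θ₀ ι pick t) (fun x => M.g x.1) +
        τ / (mixConst CM ρ * L) * (τ -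
          (expect (M.ppg K B b L⁻¹ (stepβ q M.γ Lr Lψ μ) θ₀ ι pick t) (fun x => M.g x.1) -
            M.g θs) / c₁) + mixConst CM ρ / L * E := by
  have hm := two_le_mixConst hCM hρ₀ hρ₁
  have h0 := M.one_sub_pos
  have hb' : ∀ z : Policy S A × S × S, |M.g z.1| ≤ |M.g θs| + 2 * (Cr * Cα) / (1 - M.γ) :=
    fun z => h.abs_g_le z.1 θs
  set m := mixConst CM ρ with hmdef
  set C := |M.g θs| + 2 * (Cr * Cα) / (1 - M.γ)
  set p := M.ppg K B b L⁻¹ (stepβ q M.γ Lr Lψ μ) θ₀ ι pick t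
  -- The conditional bound is affine in `g`, so its expectation is computed exactly; `a₁` may have
  -- any sign.
  set a₁ := 1 - τ / (m * L) / c₁ with ha₁
  set a₀ := τ / (m * L) * (τ + M.g θs / c₁) + m / L * E with ha₀
  have hstep : ∀ x : Policy S A × S × S, expect ((pick t x).bind fun α₀ =>
      (M.rewardLoop B (stepβ q M.γ Lr Lψ μ) x.1 K (α₀, x.2)).bind fun y =>
        (M.policyStep b L⁻¹ x.1 y.1 y.2.2).map fun z => (z.1, y.2.1, z.2)) (fun x => M.g x.1) ≤
      a₁ * M.g x.1 + a₀ := by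
    intro x
    rw [expect_bind_of_bounded _ _ hb']
    refine expect_le _ (fun _ _ => abs_expect_le _ fun z _ => hb' z) fun α₀ _ => ?_
    rw [expect_bind_of_bounded _ _ hb']
    refine (expect_le_of_lexp (a := M.g x.1 + τ / (m * L) * (τ - (M.g x.1 - M.g θs) / c₁) +
        m / L * (2 * (256 * Fintype.card (S × A) * m ^ 2 * (Cr * Cα) ^ 2 / ((1 - M.γ) ^ 4 * b))))
      (b := 8 * m / L * L21 (Fintype.card A) M.γ Cr CM ρ ^ 2) _
      (fun y => abs_expect_le _ fun z _ => hb' z) ?_ ?_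
      (fun _ => sq_nonneg _) (fun y _ => ?_)
      (h.lexp_rewardLoop_le hμ hCM hρ₀ hρ₁ hℓ hLℓ hB x.1 K (α₀, x.2))).trans ?_
    · positivity
    · positivity
    · rw [expect_map_of_bounded _ _ hb']
      exact h.expect_policyStep_le hμ hCM hρ₀ hρ₁ hζ₀ hL hL0 x.1 θs y.1 hb y.2.2 hτ hc₁
    · rw [ha₀, ha₁, hE]
      refine le_of_eq ?_
      ring
  have hlin : expect p (fun x => a₁ * M.g x.1 + a₀) = a₁ * expect p (fun x => M.g x.1) + a₀ := by
    rw [expect_add (f := fun x => a₁ * M.g x.1) (g := fun _ => a₀) (C := |a₁| * C) (D := |a₀|) p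
      (fun x _ => by rw [abs_mul]; gcongr; exact hb' x) (fun _ _ => le_rfl), expect_const_mul,
      expect_const]
  rw [Model.ppg, expect_bind_of_bounded _ _ hb']
  refine (expect_mono p (fun x _ => abs_expect_le _ fun z _ => hb' z) (D := |a₁| * C + |a₀|)
    (fun x _ => (abs_add_le _ _).trans (by rw [abs_mul]; gcongr; exact hb' x))
      fun x _ => hstep x).trans ?_
  rw [hlin, ha₁, ha₀]
  refine le_of_eq ?_
  ring

/-- The averaged optimality gap, with a free parameter `τ`. -/
theorem avgGap_le (hμ : 0 < μ) (hCM : 1 ≤ CM) (hρ₀ : 0 < ρ) (hρ₁ : ρ < 1)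
    (hζ₀ : 0 < ζ₀) {L : ℝ} (hL : L = L11 (Fintype.card A) M.γ Cα Cr CM ρ +
      L12 (Fintype.card A) M.γ Cr * L21 (Fintype.card A) M.γ Cr CM ρ / μ) (hL0 : 0 < L)
    {ℓ : ℝ} (hℓ : 0 < ℓ) (hLℓ : L22 q M.γ Lr Lψ * (1 - M.γ) ≤ ℓ)
    (θ₀ : Policy S A) (ι : PMF (S × S)) (pick : ℕ → Policy S A × S × S → PMF M.Λ)
    (θs : Policy S A) {T : ℕ} (hT : 1 ≤ T) (K : ℕ) {B b : ℕ} (hB : 1 ≤ B) (hb : 1 ≤ b) {τ : ℝ}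
    (hτ : 0 < τ) {c₁ : ℝ} (hc₁ : c₁ = (1 + 2 * √(Fintype.card S)) / ((1 - M.γ) * ζ₀)) {E : ℝ}
    (hE : E = 2 * (256 * Fintype.card (S × A) * mixConst CM ρ ^ 2 * (Cr * Cα) ^ 2 /
          ((1 - M.γ) ^ 4 * b)) + 8 * L21 (Fintype.card A) M.γ Cr CM ρ ^ 2 *
      (Cα ^ 2 * Real.exp (-(7 / 32 * μ ^ 2 / ℓ ^ 2) * (1 - M.γ) ^ 2 * K) +
        64 / (49 * μ ^ 2) * (256 * mixConst CM ρ ^ 2 * Cr ^ 2 / ((1 - M.γ) ^ 2 * B)))) :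
    M.avgGap T K B b L⁻¹ (stepβ q M.γ Lr Lψ μ) θ₀ ι pick θs ≤
      c₁ * (τ + 1 / τ * (mixConst CM ρ * L * (2 * (Cr * Cα) / (1 - M.γ)) / T +
        mixConst CM ρ ^ 2 * E)) := by
  have hm := two_le_mixConst hCM hρ₀ hρ₁
  have h0 := M.one_sub_pos
  have hc0 : 0 < c₁ := by rw [hc₁]; positivity
  have hT0 : (0 : ℝ) < T := by exact_mod_cast hT
  set m := mixConst CM ρ with hmdef
  set G : ℕ → ℝ := fun t =>
    expect (M.ppg K B b L⁻¹ (stepβ q M.γ Lr Lψ μ) θ₀ ι pick t) (fun x => M.g x.1) with hG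
  have hstep : ∀ t, G t - M.g θs ≤ c₁ * (τ + 1 / τ * (m * L * (G t - G (t + 1)) + m ^ 2 * E)) := by
    intro t
    have h1 := h.expect_ppg_succ_le hμ hCM hρ₀ hρ₁ hζ₀ hL hL0 hℓ hLℓ θ₀ ι pick θs K hB hb hτ hc₁ hE t
    rw [← hmdef] at h1
    change G (t + 1) ≤ G t + τ / (m * L) * (τ - (G t - M.g θs) / c₁) + m / L * E at h1
    have h2 := mul_le_mul_of_nonneg_left h1 (show 0 ≤ c₁ * (1 / τ) * (m * L) by positivity)
    have h3 : c₁ * (1 / τ) * (m * L) * (G t + τ / (m * L) * (τ - (G t - M.g θs) / c₁) + m / L * E) =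
        c₁ * (τ + 1 / τ * (m * L * G t + m ^ 2 * E)) - (G t - M.g θs) := by
      field_simp
      ring
    rw [h3] at h2
    linarith
  have hR : G 0 - G T ≤ 2 * (Cr * Cα) / (1 - M.γ) := by
    have hb' : ∀ z : Policy S A × S × S, |M.g z.1| ≤ |M.g θs| + 2 * (Cr * Cα) / (1 - M.γ) :=
      fun z => h.abs_g_le z.1 θs
    have h1 : G 0 = M.g θ₀ := by
      rw [hG]
      dsimp only
      rw [Model.ppg, expect_map_of_bounded _ _ hb']
      exact expect_const ι (M.g θ₀)
    have h2 : M.g θ₀ - 2 * (Cr * Cα) / (1 - M.γ) ≤ G T := by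
      rw [← expect_const (M.ppg K B b L⁻¹ (stepβ q M.γ Lr Lψ μ) θ₀ ι pick T)
        (M.g θ₀ - 2 * (Cr * Cα) / (1 - M.γ))]
      refine expect_mono _ (fun _ _ => le_rfl) (fun z _ => hb' z) fun z _ => ?_
      linarith [(abs_le.1 (h.abs_g_sub_le θ₀ z.1)).2]
    linarith
  have hsum : ∑ t ∈ Finset.range T, (G t - M.g θs) ≤
      c₁ * (τ * T + 1 / τ * (m * L * (G 0 - G T) + m ^ 2 * E * T)) := by
    refine (Finset.sum_le_sum fun t _ => hstep t).trans (le_of_eq ?_)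
    rw [← Finset.mul_sum, Finset.sum_add_distrib, ← Finset.mul_sum, Finset.sum_add_distrib,
      ← Finset.mul_sum, Finset.sum_range_sub']
    simp only [Finset.sum_const, Finset.card_range, nsmul_eq_mul]
    ring
  have e1 : M.avgGap T K B b L⁻¹ (stepβ q M.γ Lr Lψ μ) θ₀ ι pick θs =
      1 / T * ∑ t ∈ Finset.range T, (G t - M.g θs) := by
    rw [Model.avgGap, Finset.sum_sub_distrib, Finset.sum_const, Finset.card_range, nsmul_eq_mul,
      mul_sub]
    congr 1
    field_simp
  rw [e1]
  calc _ ≤ 1 / T * (c₁ * (τ * T + 1 / τ * (m * L * (2 * (Cr * Cα) / (1 - M.γ)) +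
        m ^ 2 * E * T))) := by
        refine mul_le_mul_of_nonneg_left (hsum.trans ?_) (by positivity)
        gcongr
    _ = _ := by
        field_simp

end Model.Assumptions

end Loop

/-! ### The explicit rate. -/

section Rate

variable {S A : Type*} [Fintype S] [Fintype A] {q : ℕ} {M : Model S A q}
  {Cα Cr Lr Lψ μ CM ρ ζ₀ : ℝ}

theorem L22_mul_le {γ : ℝ} (h0 : 0 < γ) (h1 : γ < 1) :
    L22 q γ Lr Lψ * (1 - γ) ≤ 2 * √q * |Lr| + |Lψ| + 1 := by
  have h2 : 0 < 1 - γ := sub_pos.2 h1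
  have e : L22 q γ Lr Lψ * (1 - γ) = 2 * √q * Lr + Lψ * (1 - γ) := by
    rw [L22]
    field_simp
  have h3 : 2 * √q * Lr ≤ 2 * √q * |Lr| := by
    gcongr
    exact le_abs_self _
  have h4 : Lψ * (1 - γ) ≤ |Lψ| * 1 := by
    refine mul_le_mul (le_abs_self _) (by linarith) h2.le (abs_nonneg _)
  rw [e]
  linarith

/-- The constant of the rate. -/
def rateConst (nA nSA : ℕ) (Cα Cr μ CM ρ : ℝ) : ℝ :=
  |mixConst CM ρ * (2 * (Cr * Cα)) *
      (2 * √2 * nA * Cr * Cα * mixConst CM ρ + nA * Cr ^ 2 * mixConst CM ρ / μ)| +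
    mixConst CM ρ ^ 2 * (512 * nSA * mixConst CM ρ ^ 2 * (Cr * Cα) ^ 2 +
      8 * Cr ^ 2 * nA * mixConst CM ρ ^ 2 * Cα ^ 2 +
      8 * Cr ^ 2 * nA * mixConst CM ρ ^ 2 * (64 / (49 * μ ^ 2) *
        (256 * mixConst CM ρ ^ 2 * Cr ^ 2))) + 1

theorem one_le_rateConst (nA nSA : ℕ) (Cα Cr μ CM ρ : ℝ) :
    1 ≤ rateConst nA nSA Cα Cr μ CM ρ := by
  rw [rateConst]
  exact le_add_of_nonneg_left (by positivity)

theorem add_sq_sum_le {N a b c d : ℝ} (hN : 1 ≤ N) (ha : 0 ≤ a) (hb : 0 ≤ b) (hc : 0 ≤ c)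
    (hd : 0 ≤ d) : N * (a ^ 2 + b ^ 2 + c ^ 2 + d ^ 2) ≤ (N * (a + b + c + d)) ^ 2 := by
  have h1 : a ^ 2 + b ^ 2 + c ^ 2 + d ^ 2 ≤ (a + b + c + d) ^ 2 := by
    nlinarith [mul_nonneg ha hb, mul_nonneg ha hc, mul_nonneg ha hd, mul_nonneg hb hc,
      mul_nonneg hb hd, mul_nonneg hc hd]
  rw [mul_pow]
  refine mul_le_mul ?_ h1 (by positivity) (by positivity)
  nlinarith

theorem Model.Assumptions.avgGap_le_rate (h : M.Assumptions Cα Cr Lr Lψ μ CM ρ ζ₀) (hμ : 0 < μ)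
    (hCM : 1 ≤ CM) (hρ₀ : 0 < ρ) (hρ₁ : ρ < 1) (hζ₀ : 0 < ζ₀)
    (θ₀ : Policy S A) (ι : PMF (S × S)) (pick : ℕ → Policy S A × S × S → PMF M.Λ)
    (θs : Policy S A) {T K B b : ℕ} (hT : 1 ≤ T) (hB : 1 ≤ B) (hb : 1 ≤ b) {C c : ℝ}
    (hC : C = 2 * (1 + 2 * √(Fintype.card S)) / ζ₀ *
      rateConst (Fintype.card A) (Fintype.card (S × A)) Cα Cr μ CM ρ)
    (hc : c = 7 / 64 * μ ^ 2 / (2 * √q * |Lr| + |Lψ| + 1) ^ 2) :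
    M.avgGap T K B b (stepη (Fintype.card A) M.γ Cα Cr μ CM ρ) (stepβ q M.γ Lr Lψ μ) θ₀ ι pick θs ≤
      C / ((1 - M.γ) ^ 3 * √T) + C / (1 - M.γ) ^ 2 * Real.exp (-c * (1 - M.γ) ^ 2 * K) +
            C / ((1 - M.γ) ^ 3 * √B) + C / ((1 - M.γ) ^ 3 * √b) := by
  have hm := two_le_mixConst hCM hρ₀ hρ₁
  have h0 := M.one_sub_pos
  have hw1 : 1 - M.γ ≤ 1 := by linarith [M.γ_pos]
  have hCr := h.Cr_nonneg
  have hCα := h.Cα_nonneg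
  have hT0 : (0 : ℝ) < T := by exact_mod_cast hT
  have hB0 : (0 : ℝ) < B := by exact_mod_cast hB
  have hb0 : (0 : ℝ) < b := by exact_mod_cast hb
  set m := mixConst CM ρ with hmdef
  set N := rateConst (Fintype.card A) (Fintype.card (S × A)) Cα Cr μ CM ρ with hN
  have hN1 : 1 ≤ N := one_le_rateConst _ _ _ _ _ _ _
  have hC0 : 0 ≤ C := by rw [hC]; positivity
  -- For `Cr = 0` the stepsize is the inverse of zero, but `g` is constant and the gap vanishes.
  rcases hCr.eq_or_lt with hCr0 | hCr0
  · have hg : ∀ θ, M.g θ = M.g θs := fun θ => by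
      have := h.abs_g_sub_le θ θs
      rw [← hCr0] at this
      simp only [zero_mul, mul_zero, zero_div] at this
      exact sub_eq_zero.1 (abs_nonpos_iff.1 this)
    rw [Model.avgGap]
    simp only [hg, expect_const, Finset.sum_const, Finset.card_range, nsmul_eq_mul]
    rw [one_div, inv_mul_cancel_left₀ hT0.ne', sub_self]
    positivity
  set w := 1 - M.γ with hw
  have hnA : (0 : ℝ) < Fintype.card A := by
    obtain ⟨s, -⟩ := M.ζ.support_nonempty
    obtain ⟨a, -⟩ := (M.πE.act s).support_nonempty
    have : Nonempty A := ⟨a⟩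
    exact_mod_cast Fintype.card_pos
  set nA : ℝ := ((Fintype.card A : ℕ) : ℝ) with hnAdef
  set L := L11 (Fintype.card A) M.γ Cα Cr CM ρ +
      L12 (Fintype.card A) M.γ Cr * L21 (Fintype.card A) M.γ Cr CM ρ / μ with hL
  have hsA : √nA * √nA = nA := Real.mul_self_sqrt hnA.le
  have hLe : L = 2 * √2 * nA * Cr * Cα * m / w ^ 2 + nA * Cr ^ 2 * m / μ / w ^ 3 := by
    rw [hL, L11, L12, L21, ← hmdef, ← hnAdef, ← hw]
    have : √nA * Cr / w ^ 2 * (Cr * √nA / w * m) = (√nA * √nA) * Cr ^ 2 * m / w ^ 3 := by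
      field_simp
    rw [this, hsA]
    ring
  have hL0 : 0 < L := by rw [hLe]; positivity
  have hη : stepη (Fintype.card A) M.γ Cα Cr μ CM ρ = L⁻¹ := rfl
  have hℓ : 0 < 2 * √q * |Lr| + |Lψ| + 1 := by positivity
  set ex := Real.exp (-c * w ^ 2 * K) with hex
  -- The rate contains the square root of the squared inner error, hence half of its exponent in
  -- `c`.
  have hex2 : Real.exp (-(7 / 32 * μ ^ 2 / (2 * √q * |Lr| + |Lψ| + 1) ^ 2) * w ^ 2 * K) =
      ex ^ 2 := by
    rw [hex, ← Real.exp_nat_mul, hc]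
    congr 1
    push_cast
    ring
  -- `X` adds the square roots of the four error sources, without the power of `(1 - γ)⁻¹` that the
  -- prefactor supplies. The choice `τ = N * X` balances the bound, whose bracket is at most `(N *
  -- X) ^ 2`.
  set X := 1 / (w ^ 2 * √T) + 1 / w * ex + 1 / (w ^ 2 * √B) + 1 / (w ^ 2 * √b) with hX
  have hX0 : 0 < X := by positivity
  have hτ : 0 < N * X := by positivity
  rw [hη]
  refine (h.avgGap_le hμ hCM hρ₀ hρ₁ hζ₀ hL hL0 hℓ (L22_mul_le M.γ_pos M.γ_lt_one) θ₀ ι pick θs hT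
    K hB hb hτ rfl rfl).trans ?_
  rw [← hw, hex2, ← hmdef]
  have hZ : m * L * (2 * (Cr * Cα) / w) / T + m ^ 2 * (2 * (256 * Fintype.card (S × A) * m ^ 2 *
      (Cr * Cα) ^ 2 / (w ^ 4 * b)) + 8 * L21 (Fintype.card A) M.γ Cr CM ρ ^ 2 *
        (Cα ^ 2 * ex ^ 2 + 64 / (49 * μ ^ 2) * (256 * m ^ 2 * Cr ^ 2 / (w ^ 2 * B)))) ≤
      (N * X) ^ 2 := by
    refine le_trans ?_ (add_sq_sum_le hN1 (by positivity) (by positivity) (by positivity)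
      (by positivity))
    set K₁ := m * (2 * (Cr * Cα)) * (2 * √2 * nA * Cr * Cα * m + nA * Cr ^ 2 * m / μ) with hK₁
    set K₂ := 512 * Fintype.card (S × A) * m ^ 2 * (Cr * Cα) ^ 2 with hK₂
    set K₃ := 8 * Cr ^ 2 * nA * m ^ 2 * Cα ^ 2 with hK₃
    set K₄ := 8 * Cr ^ 2 * nA * m ^ 2 * (64 / (49 * μ ^ 2) * (256 * m ^ 2 * Cr ^ 2)) with hK₄
    have hK₁0 : 0 ≤ K₁ := by positivity
    have hK₂0 : 0 ≤ K₂ := by positivity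
    have hK₃0 : 0 ≤ K₃ := by positivity
    have hK₄0 : 0 ≤ K₄ := by positivity
    have hNe : N = |K₁| + m ^ 2 * (K₂ + K₃ + K₄) + 1 := rfl
    rw [abs_of_nonneg hK₁0] at hNe
    have hKm : m ^ 2 * (K₂ + K₃ + K₄) = m ^ 2 * K₂ + m ^ 2 * K₃ + m ^ 2 * K₄ := by ring
    have hp2 : 0 ≤ m ^ 2 * K₂ := by positivity
    have hp3 : 0 ≤ m ^ 2 * K₃ := by positivity
    have hp4 : 0 ≤ m ^ 2 * K₄ := by positivity
    have t1 : m * L * (2 * (Cr * Cα) / w) / T ≤ K₁ * (1 / (w ^ 2 * √T)) ^ 2 := by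
      have hLle : L ≤ (2 * √2 * nA * Cr * Cα * m + nA * Cr ^ 2 * m / μ) / w ^ 3 := by
        rw [hLe, add_div]
        gcongr ?_ + _
        refine div_le_div_of_nonneg_left (by positivity) (by positivity) ?_
        exact pow_le_pow_of_le_one h0.le hw1 (by norm_num)
      have e : (1 / (w ^ 2 * √T)) ^ 2 = 1 / (w ^ 4 * T) := by
        rw [div_pow, mul_pow, Real.sq_sqrt hT0.le]
        ring_nf
      calc m * L * (2 * (Cr * Cα) / w) / T ≤ m * ((2 * √2 * nA * Cr * Cα * m +
          nA * Cr ^ 2 * m / μ) / w ^ 3) * (2 * (Cr * Cα) / w) / T := by gcongr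
        _ = _ := by
          rw [e, hK₁]
          field_simp
    have eb : (1 / (w ^ 2 * √b)) ^ 2 = 1 / (w ^ 4 * b) := by
      rw [div_pow, mul_pow, Real.sq_sqrt hb0.le]
      ring_nf
    have eB : (1 / (w ^ 2 * √B)) ^ 2 = 1 / (w ^ 4 * B) := by
      rw [div_pow, mul_pow, Real.sq_sqrt hB0.le]
      ring_nf
    have eL : L21 (Fintype.card A) M.γ Cr CM ρ ^ 2 = Cr ^ 2 * nA * m ^ 2 / w ^ 2 := by
      rw [L21, ← hmdef, ← hnAdef, ← hw, mul_pow, div_pow, mul_pow, sq √nA, hsA]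
      ring
    have t2 : m ^ 2 * (2 * (256 * Fintype.card (S × A) * m ^ 2 *
      (Cr * Cα) ^ 2 / (w ^ 4 * b)) + 8 * L21 (Fintype.card A) M.γ Cr CM ρ ^ 2 *
        (Cα ^ 2 * ex ^ 2 + 64 / (49 * μ ^ 2) * (256 * m ^ 2 * Cr ^ 2 / (w ^ 2 * B)))) =
        m ^ 2 * K₂ * (1 / (w ^ 2 * √b)) ^ 2 + m ^ 2 * K₃ * (1 / w * ex) ^ 2 +
          m ^ 2 * K₄ * (1 / (w ^ 2 * √B)) ^ 2 := by
      rw [eb, eB, eL, hK₂, hK₃, hK₄]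
      field_simp
      ring
    have s1 : K₁ * (1 / (w ^ 2 * √T)) ^ 2 ≤ N * (1 / (w ^ 2 * √T)) ^ 2 := by
      gcongr
      linarith
    have s2 : m ^ 2 * K₂ * (1 / (w ^ 2 * √b)) ^ 2 ≤ N * (1 / (w ^ 2 * √b)) ^ 2 := by
      gcongr
      linarith
    have s3 : m ^ 2 * K₃ * (1 / w * ex) ^ 2 ≤ N * (1 / w * ex) ^ 2 := by
      gcongr
      linarith
    have s4 : m ^ 2 * K₄ * (1 / (w ^ 2 * √B)) ^ 2 ≤ N * (1 / (w ^ 2 * √B)) ^ 2 := by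
      gcongr
      linarith
    rw [t2]
    linarith
  calc _ ≤ (1 + 2 * √(Fintype.card S)) / (w * ζ₀) * (N * X + 1 / (N * X) * (N * X) ^ 2) := by
        gcongr
    _ = C * (X / w) := by
        rw [hC]
        field_simp
        ring
    _ = _ := by
        rw [hX]
        field_simp

end Rate

/-! ### Sample sizes for a given accuracy. -/

theorem exists_sample_sizes {C c w : ℝ} (hC : 0 < C) (hc : 0 < c) (hw : 0 < w) :
    ∃ D > 0, ∀ ε : ℝ, 0 < ε → ε < 1 → ∃ T K B b : ℕ, 1 ≤ T ∧ 1 ≤ K ∧ 1 ≤ B ∧ 1 ≤ b ∧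
      T ≤ D / ε ^ 2 ∧ K ≤ D * (1 + Real.log (1 / ε)) ∧ B ≤ D / ε ^ 2 ∧ b ≤ D / ε ^ 2 ∧
      T * (K * B + b) ≤ D / ε ^ 4 * (1 + Real.log (1 / ε)) ∧
      C / (w ^ 3 * √T) + C / w ^ 2 * Real.exp (-c * w ^ 2 * K) +
            C / (w ^ 3 * √B) + C / (w ^ 3 * √b) ≤ ε := by
  set D₁ := (4 * C / w ^ 3) ^ 2 + 1 with hD₁
  set D₀ := (|Real.log (4 * C / w ^ 2)| + 1) / (c * w ^ 2) + 2 with hD₀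
  have hD₁0 : 0 < D₁ := by positivity
  have hD₀0 : 0 < D₀ := by positivity
  refine ⟨D₀ + D₁ + D₁ ^ 2 * (D₀ + 1), by positivity, fun ε hε hε1 => ?_⟩
  set D := D₀ + D₁ + D₁ ^ 2 * (D₀ + 1) with hD
  have hD₁D : D₁ ≤ D := by
    have : 0 ≤ D₁ ^ 2 * (D₀ + 1) := by positivity
    linarith
  have hD₀D : D₀ ≤ D := by
    have : 0 ≤ D₁ ^ 2 * (D₀ + 1) := by positivity
    linarith
  have hD₂D : D₁ ^ 2 * (D₀ + 1) ≤ D := by linarith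
  have hlog : 0 ≤ Real.log (1 / ε) := Real.log_nonneg (by rw [le_div_iff₀ hε]; linarith)
  set l := 1 + Real.log (1 / ε) with hl
  have hl1 : 1 ≤ l := by linarith
  -- Each of the four terms is allotted `ε / 4`; one `n` serves for `T`, `B` and `b`.
  set n := ⌈(4 * C / w ^ 3) ^ 2 / ε ^ 2⌉₊ with hn
  have hn0 : 0 < (4 * C / w ^ 3) ^ 2 / ε ^ 2 := by positivity
  have hn1 : 1 ≤ n := Nat.one_le_iff_ne_zero.2 (Nat.ceil_pos.2 hn0).ne'
  have hnle : (n : ℝ) ≤ D₁ / ε ^ 2 := by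
    have h1 := (Nat.ceil_lt_add_one hn0.le).le
    have h2 : 1 ≤ 1 / ε ^ 2 := by
      rw [le_div_iff₀ (by positivity), one_mul]
      exact pow_le_one₀ hε.le hε1.le
    rw [hD₁, add_div]
    linarith
  set K := ⌈(|Real.log (4 * C / w ^ 2)| + Real.log (1 / ε)) / (c * w ^ 2)⌉₊ + 1 with hK
  have hK0 : 0 ≤ (|Real.log (4 * C / w ^ 2)| + Real.log (1 / ε)) / (c * w ^ 2) := by positivity
  have hKle : (K : ℝ) ≤ D₀ * l := by
    have h1 := (Nat.ceil_lt_add_one hK0).le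
    have h2 : (|Real.log (4 * C / w ^ 2)| + Real.log (1 / ε)) / (c * w ^ 2) ≤
        (|Real.log (4 * C / w ^ 2)| + 1) * l / (c * w ^ 2) := by
      gcongr
      nlinarith [abs_nonneg (Real.log (4 * C / w ^ 2))]
    have e : D₀ * l = (|Real.log (4 * C / w ^ 2)| + 1) * l / (c * w ^ 2) + 2 * l := by
      rw [hD₀]
      ring
    rw [hK, e]
    push_cast
    linarith
  have hnD : (n : ℝ) ≤ D / ε ^ 2 := hnle.trans (by gcongr)
  refine ⟨n, K, n, n, hn1, by omega, hn1, hn1, hnD, hKle.trans (by gcongr), hnD, hnD, ?_, ?_⟩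
  · calc (n : ℝ) * (K * n + n) ≤ D₁ / ε ^ 2 * (D₀ * l * (D₁ / ε ^ 2) + l * (D₁ / ε ^ 2)) := by
          gcongr
          exact hnle.trans (le_mul_of_one_le_left (by positivity) hl1)
      _ = D₁ ^ 2 * (D₀ + 1) / ε ^ 4 * l := by
          field_simp
      _ ≤ _ := by gcongr
  · have h1 : C / (w ^ 3 * √n) ≤ ε / 4 := by
      have h2 : 4 * C / w ^ 3 / ε ≤ √n := by
        refine Real.le_sqrt_of_sq_le ?_
        rw [div_pow]
        exact Nat.le_ceil _
      have h3 : (0 : ℝ) < √n := lt_of_lt_of_le (by positivity) h2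
      rw [div_le_div_iff₀ (by positivity) (by norm_num)]
      rw [div_div, div_le_iff₀ (by positivity)] at h2
      linarith
    have h2 : C / w ^ 2 * Real.exp (-c * w ^ 2 * K) ≤ ε / 4 := by
      have h3 : Real.log (4 * C / w ^ 2) + Real.log (1 / ε) ≤ c * w ^ 2 * K := by
        have h4 : (|Real.log (4 * C / w ^ 2)| + Real.log (1 / ε)) / (c * w ^ 2) ≤ K := by
          rw [hK]
          push_cast
          exact (Nat.le_ceil _).trans (by linarith)
        rw [div_le_iff₀ (by positivity)] at h4
        linarith [le_abs_self (Real.log (4 * C / w ^ 2))]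
      have h4 : Real.exp (-c * w ^ 2 * K) ≤ w ^ 2 / (4 * C) * ε := by
        calc Real.exp (-c * w ^ 2 * K)
            ≤ Real.exp (-(Real.log (4 * C / w ^ 2) + Real.log (1 / ε))) := by
              rw [Real.exp_le_exp]
              linarith
          _ = _ := by
              rw [Real.exp_neg, Real.exp_add, Real.exp_log (by positivity),
                Real.exp_log (by positivity)]
              field_simp
      calc C / w ^ 2 * Real.exp (-c * w ^ 2 * K) ≤ C / w ^ 2 * (w ^ 2 / (4 * C) * ε) := by gcongr
        _ = ε / 4 := by field_simp
    linarith

end GAIL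

end

/-! ### The main theorem. -/

theorem theorem1 {S A : Type*} [Fintype S] [Fintype A] (q : ℕ)
    (Cα Cr Lr Lψ μ CM ρ ζ₀ : ℝ) (hμ : 0 < μ) (hCM : 1 ≤ CM) (hρ₀ : 0 < ρ) (hρ₁ : ρ < 1)
    (hζ₀ : 0 < ζ₀) :
    (∃ C > 0, ∃ c > 0, ∀ M : Model S A q, M.Assumptions Cα Cr Lr Lψ μ CM ρ ζ₀ →
      ∀ (θ₀ : Policy S A) (ι : PMF (S × S)) (pick : ℕ → Policy S A × S × S → PMF M.Λ)
        (θs : Policy S A), (∀ θ : Policy S A, M.g θs ≤ M.g θ) →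
      ∀ T K B b : ℕ, 1 ≤ T → 1 ≤ K → 1 ≤ B → 1 ≤ b →
        M.avgGap T K B b (stepη (Fintype.card A) M.γ Cα Cr μ CM ρ) (stepβ q M.γ Lr Lψ μ)
            θ₀ ι pick θs ≤
          C / ((1 - M.γ) ^ 3 * √T) + C / (1 - M.γ) ^ 2 * Real.exp (-c * (1 - M.γ) ^ 2 * K) +
            C / ((1 - M.γ) ^ 3 * √B) + C / ((1 - M.γ) ^ 3 * √b)) ∧
    (∀ γ : ℝ, 0 < γ → γ < 1 → ∃ D > 0, ∀ ε : ℝ, 0 < ε → ε < 1 →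
      ∃ T K B b : ℕ, 1 ≤ T ∧ 1 ≤ K ∧ 1 ≤ B ∧ 1 ≤ b ∧
        T ≤ D / ε ^ 2 ∧ K ≤ D * (1 + Real.log (1 / ε)) ∧ B ≤ D / ε ^ 2 ∧ b ≤ D / ε ^ 2 ∧
        T * (K * B + b) ≤ D / ε ^ 4 * (1 + Real.log (1 / ε)) ∧
        ∀ M : Model S A q, M.γ = γ → M.Assumptions Cα Cr Lr Lψ μ CM ρ ζ₀ →
        ∀ (θ₀ : Policy S A) (ι : PMF (S × S)) (pick : ℕ → Policy S A × S × S → PMF M.Λ)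
          (θs : Policy S A), (∀ θ : Policy S A, M.g θs ≤ M.g θ) →
          M.avgGap T K B b (stepη (Fintype.card A) γ Cα Cr μ CM ρ) (stepβ q γ Lr Lψ μ)
            θ₀ ι pick θs ≤ ε) := by
  have hN := one_le_rateConst (Fintype.card A) (Fintype.card (S × A)) Cα Cr μ CM ρ
  have hC : 0 < 2 * (1 + 2 * √(Fintype.card S)) / ζ₀ *
      rateConst (Fintype.card A) (Fintype.card (S × A)) Cα Cr μ CM ρ := by
    positivity
  have hc : 0 < 7 / 64 * μ ^ 2 / (2 * √q * |Lr| + |Lψ| + 1) ^ 2 := by positivity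
  refine ⟨⟨_, hC, _, hc, fun M h θ₀ ι pick θs _ T K B b hT _ hB hb =>
    h.avgGap_le_rate hμ hCM hρ₀ hρ₁ hζ₀ θ₀ ι pick θs hT hB hb rfl rfl⟩, fun γ _ hγ₁ => ?_⟩
  obtain ⟨D, hD, hsizes⟩ := exists_sample_sizes hC hc (sub_pos.2 hγ₁)
  refine ⟨D, hD, fun ε hε hε1 => ?_⟩
  obtain ⟨T, K, B, b, hT, hK, hB, hb, hTD, hKD, hBD, hbD, htot, hle⟩ := hsizes ε hε hε1
  refine ⟨T, K, B, b, hT, hK, hB, hb, hTD, hKD, hBD, hbD, htot, fun M hM h θ₀ ι pick θs _ => ?_⟩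
  have := h.avgGap_le_rate hμ hCM hρ₀ hρ₁ hζ₀ θ₀ ι pick θs (K := K) hT hB hb rfl rfl
  rw [hM] at this
  exact this.trans hle
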